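/- Let $\mathcal L_{PA}=\{\cdot,+,\le,0,1,S\}$ be the language of Peano arithmetic $PA$ and $\mathcal L_{PAT}=\mathcal L_{PA}\cup\{T\}$ with a unary predicate $T$. Fix a standard arithmetization of the syntax of $\mathcal L_{PA}$ (with logical symbols $=,\neg,\wedge,\vee,\forall,\exists$) in $PA$, under which the code of a term or formula is larger than the codes of its immediate constituents; write $t^\circ$ for the value of a (code of a) closed term $t$, and $\varphi(t)$ for (the code of) the result of substituting $t$ for the free variable in question. $CT^-$ is the $\mathcal L_{PAT}$-theory that consists of $PA$ (with induction for $\mathcal L_{PA}$-formulas only) and the axioms, in which $s,t$ range over all codes of closed terms and $\varphi,\psi$ over all codes of $\mathcal L_{PA}$-sentences (in the last axiom: of formulas $\varphi$ for which $Qx\,\varphi$ is a sentence), in the sense of the model: 1. $T(s=t)\leftrightarrow s^\circ=t^\circ$ and $T(s\le t)\leftrightarrow s^\circ\le t^\circ$; 2. $T(\varphi\wedge\psi)\leftrightarrow T(\varphi)\wedge T(\psi)$ and $T(\varphi\vee\psi)\leftrightarrow T(\varphi)\vee T(\psi)$; 3. $T(\neg\varphi)\leftrightarrow\neg T(\varphi)$;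 4. $T(\forall x\,\varphi)\leftrightarrow\forall t\,T(\varphi(t))$ and $T(\exists x\,\varphi)\leftrightarrow\exists t\,T(\varphi(t))$. $UTB$ is the $\mathcal L_{PAT}$-theory that consists of $PA$, the uniform Tarski biconditionals $$\forall t_1\cdots\forall t_n\;\bigl(T(\varphi(t_1,\dots,t_n))\leftrightarrow\varphi(t_1^\circ,\dots,t_n^\circ)\bigr)$$ for every $\mathcal L_{PA}$-formula $\varphi(x_1,\dots,x_n)$ (with $t_1,\dots,t_n$ ranging over all codes of closed terms), and the induction scheme, with parameters, for all formulas of $\mathcal L_{PAT}$. Theorem ($\mathfrak{CT}^-\subseteq\mathfrak{UTB}$). Let $M$ be a model of $PA$, of any cardinality. If there is a set $T\subseteq M$ such that $(M,T)\models CT^-$, then there is a set $T'\subseteq M$ such that $(M,T')\models UTB$. -/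

import Mathlib

open FirstOrder FirstOrder.Language

namespace TruthTheories

/-! ### The languages -/

/-- Function symbols of the language of Peano arithmetic. -/
inductive PAFunc : ℕ → Type
  | zero : PAFunc 0
  | one : PAFunc 0
  | succ : PAFunc 1
  | add : PAFunc 2
  | mul : PAFunc 2

/-- Relation symbols of the language of Peano arithmetic (equality is a logical symbol). -/
inductive PARel : ℕ → Type
  | le : PARel 2

/-- The language `{·, +, ≤, 0, 1, S}` of Peano arithmetic. -/
def LPA : Language := ⟨PAFunc, PARel⟩

/-- The only symbol added to the language of arithmetic: a unary predicate. -/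
inductive TruthRel : ℕ → Type
  | truth : TruthRel 1

/-- The language with a single unary predicate symbol `T`. -/
def LT : Language := ⟨fun _ => Empty, TruthRel⟩

/-- The language of Peano arithmetic with an additional unary predicate `T`. -/
abbrev LPAT : Language := LPA.sum LT

/-- The inclusion of the language of arithmetic into its extension by `T`. -/
abbrev incl : LPA →ᴸ LPAT := LHom.sumInl

section Terms

variable {α : Type*}

def zeroT : LPA.Term α := Term.func PAFunc.zero ![]
def oneT : LPA.Term α := Term.func PAFunc.one ![]
def succT (t : LPA.Term α) : LPA.Term α := Term.func PAFunc.succ ![t]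
def addT (s t : LPA.Term α) : LPA.Term α := Term.func PAFunc.add ![s, t]
def mulT (s t : LPA.Term α) : LPA.Term α := Term.func PAFunc.mul ![s, t]

/-- The numeral `S ⋯ S 0` of a natural number. -/
def num : ℕ → LPA.Term α
  | 0 => zeroT
  | n + 1 => succT (num n)

/-- The atomic formula `s ≤ t`. -/
def leF {n : ℕ} (s t : LPA.Term (α ⊕ Fin n)) : LPA.BoundedFormula α n :=
  BoundedFormula.rel PARel.le ![s, t]

/-- `s < t`, written as `S s ≤ t`. -/
def ltF {n : ℕ} (s t : LPA.Term (α ⊕ Fin n)) : LPA.BoundedFormula α n :=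
  leF (succT s) t

/-- The atomic formula `T(t)`. -/
def trF {n : ℕ} (t : LPAT.Term (α ⊕ Fin n)) : LPAT.BoundedFormula α n :=
  BoundedFormula.rel (Sum.inr TruthRel.truth) ![t]

end Terms

/-- The `i`-th free variable of a formula in the variables `Fin k`. -/
abbrev fv {L : Language} {k n : ℕ} (i : Fin k) : L.Term (Fin k ⊕ Fin n) :=
  Term.var (Sum.inl i)

/-- `φ(t₀, …, t_{k-1})`: the terms may contain the bound variables in scope. -/
def plug {L : Language} {α : Type*} {k n : ℕ} (φ : L.Formula (Fin k))
    (ts : Fin k → L.Term (α ⊕ Fin n)) : L.BoundedFormula α n :=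
  BoundedFormula.relabel (id : α ⊕ Fin n → α ⊕ Fin n) (BoundedFormula.subst φ ts)

theorem realize_plug {L : Language} {M : Type*} [L.Structure M] {α : Type*} {k n : ℕ}
    (φ : L.Formula (Fin k)) (ts : Fin k → L.Term (α ⊕ Fin n)) (v : α → M) (xs : Fin n → M) :
    (plug φ ts).Realize v xs ↔ φ.Realize fun i => (ts i).realize (Sum.elim v xs) := by
  unfold plug Formula.Realize
  rw [BoundedFormula.realize_relabel, BoundedFormula.realize_subst]
  simp [Unique.eq_default]

/-- An arithmetical formula, read as a formula of the language with `T`. -/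
def plugT {α : Type*} {k n : ℕ} (φ : LPA.Formula (Fin k))
    (ts : Fin k → LPAT.Term (α ⊕ Fin n)) : LPAT.BoundedFormula α n :=
  plug (incl.onFormula φ) ts

/-! ### Peano arithmetic and induction -/

/-- The axiom of induction for `φ(x, p₁, …, pₙ)` with respect to the variable `x` (of index `0`),
in a language that extends the language of arithmetic by way of `ι`:
`∀ p₁ … pₙ (φ(0, p) → ∀ x (φ(x, p) → φ(S x, p)) → ∀ x φ(x, p))`. -/
def inductionAxiom {L : Language} (ι : LPA →ᴸ L) {n : ℕ} (φ : L.Formula (Fin (n + 1))) :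
    L.Sentence :=
  (plug φ (Matrix.vecCons (ι.onTerm zeroT) fun i => Term.var (Sum.inr i)) ⟹
    (∀' (plug φ (Matrix.vecCons (Term.var (Sum.inr (Fin.last n)))
            fun i => Term.var (Sum.inr i.castSucc)) ⟹
        plug φ (Matrix.vecCons (ι.onTerm (succT (Term.var (Sum.inr (Fin.last n)))))
            fun i => Term.var (Sum.inr i.castSucc)))) ⟹
    (∀' (plug φ (Matrix.vecCons (Term.var (Sum.inr (Fin.last n)))
            fun i => Term.var (Sum.inr i.castSucc))))).alls

/-- The full scheme of induction for a language that extends the language of arithmetic. -/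
def inductionScheme {L : Language} (ι : LPA →ᴸ L) : L.Theory :=
  {σ | ∃ (n : ℕ) (φ : L.Formula (Fin (n + 1))), σ = inductionAxiom ι φ}

/-- The axioms of Peano arithmetic other than induction. -/
def basicAxioms : LPA.Theory :=
  { -- `S x ≠ 0`
    ∀' ∼(succT (&0) =' zeroT),
    -- `S x = S y → x = y`
    ∀' ∀' ((succT (&0) =' succT (&1)) ⟹ (&0 =' &1)),
    -- `1 = S 0`
    oneT =' succT zeroT,
    -- `x + 0 = x`
    ∀' (addT (&0) zeroT =' &0),
    -- `x + S y = S (x + y)`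
    ∀' ∀' (addT (&0) (succT (&1)) =' succT (addT (&0) (&1))),
    -- `x · 0 = 0`
    ∀' (mulT (&0) zeroT =' zeroT),
    -- `x · S y = x · y + x`
    ∀' ∀' (mulT (&0) (succT (&1)) =' addT (mulT (&0) (&1)) (&0)),
    -- `x ≤ y ↔ ∃ z, x + z = y`
    ∀' ∀' (leF (&0) (&1) ⇔ ∃' (addT (&0) (&2) =' &1)) }

/-- Peano arithmetic. -/
def PA : LPA.Theory := basicAxioms ∪ inductionScheme (LHom.id LPA)

/-! ### Coding of finite sets in arithmetic

In the comments below, `x ∈ s` refers to the coding of finite sets by numbers. -/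

/-- `z = ⟨x, y⟩`, in the variables `x, y, z`; in `ℕ` this is the graph of `Nat.pair`. -/
def pairF : LPA.Formula (Fin 3) :=
  (ltF (fv 0) (fv 1) ⊓ (fv 2 =' addT (mulT (fv 1) (fv 1)) (fv 0))) ⊔
  (leF (fv 1) (fv 0) ⊓ (fv 2 =' addT (addT (mulT (fv 0) (fv 0)) (fv 0)) (fv 1)))

/-- `x ∈ s`, in the variables `x, s`: for `s = ⟨n, ⟨a, b⟩⟩` this means that `x < n` and that
`1 + (x + 1) · b` divides `a`. -/
def memF : LPA.Formula (Fin 2) :=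
  ∃' ∃' ∃' ∃' ∃' (plug pairF ![&1, &2, &3] ⊓ plug pairF ![&0, &3, fv 1] ⊓ ltF (fv 0) (&0) ⊓
    (&1 =' mulT (&4) (succT (mulT (succT (fv 0)) (&2)))))

/-- `⟨x, y⟩ ∈ s`, in the variables `x, y, s`. -/
def pairMemF : LPA.Formula (Fin 3) :=
  ∃' (plug pairF ![fv 0, fv 1, &0] ⊓ plug memF ![&0, fv 2])

/-! ### Arithmetization of the syntax of arithmetic

Terms and formulas have variables `v_i` indexed by all numbers `i` of the model; formulas are built
from equations and inequalities of terms by `¬, ∧, ∨, ∀, ∃`. Each term and formula is coded by a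
number `node k a b`, where `k` stands for the outermost symbol:

* `v_i` is `node 0 i 0`, `0` is `node 1 0 0`, `1` is `node 2 0 0`, `S s` is `node 3 s 0`,
  `s + t` is `node 4 s t`, `s · t` is `node 5 s t`;
* `s = t` is `node 6 s t`, `s ≤ t` is `node 7 s t`, `¬ φ` is `node 8 φ 0`, `φ ∧ ψ` is
  `node 9 φ ψ`, `φ ∨ ψ` is `node 10 φ ψ`, `∀ v_i φ` is `node 11 i φ`, `∃ v_i φ` is `node 12 i φ`.

Components of a code are strictly smaller than the code. A recursive notion holds of `x` if `x`
belongs to a coded finite set each of whose elements satisfies the recursive clause, with the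
components taken from the same set. -/

/-- The code with outermost symbol `k` and components `a`, `b`. -/
def node (k a b : ℕ) : ℕ := Nat.pair k (Nat.pair a b) + 1

/-- `x = node k a b`, in the variables `a, b, x`. -/
def nodeF (k : ℕ) : LPA.Formula (Fin 3) :=
  ∃' ∃' (plug pairF ![fv 0, fv 1, &0] ⊓ plug pairF ![num k, &0, &1] ⊓ (fv 2 =' succT (&1)))

/-- `x` is a closed term. -/
def clTermF : LPA.Formula (Fin 1) :=
  ∃' (plug memF ![fv 0, &0] ⊓ ∀' (plug memF ![&1, &0] ⟹
    (plug (nodeF 1) ![zeroT, zeroT, &1] ⊔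
     plug (nodeF 2) ![zeroT, zeroT, &1] ⊔
     (∃' (plug memF ![&2, &0] ⊓ plug (nodeF 3) ![&2, zeroT, &1])) ⊔
     (∃' ∃' (plug memF ![&2, &0] ⊓ plug memF ![&3, &0] ⊓
        (plug (nodeF 4) ![&2, &3, &1] ⊔ plug (nodeF 5) ![&2, &3, &1]))))))

/-- `x` is a term. -/
def termF : LPA.Formula (Fin 1) :=
  ∃' (plug memF ![fv 0, &0] ⊓ ∀' (plug memF ![&1, &0] ⟹
    ((∃' plug (nodeF 0) ![&2, zeroT, &1]) ⊔
     plug (nodeF 1) ![zeroT, zeroT, &1] ⊔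
     plug (nodeF 2) ![zeroT, zeroT, &1] ⊔
     (∃' (plug memF ![&2, &0] ⊓ plug (nodeF 3) ![&2, zeroT, &1])) ⊔
     (∃' ∃' (plug memF ![&2, &0] ⊓ plug memF ![&3, &0] ⊓
        (plug (nodeF 4) ![&2, &3, &1] ⊔ plug (nodeF 5) ![&2, &3, &1]))))))

/-- The closed term `x` has the value `y`; variables `x, y`. The witness is a set of pairs
`⟨subterm, value⟩`. -/
def valF : LPA.Formula (Fin 2) :=
  ∃' (plug pairMemF ![fv 0, fv 1, &0] ⊓ ∀' ∀' (plug pairMemF ![&1, &2, &0] ⟹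
    ((plug (nodeF 1) ![zeroT, zeroT, &1] ⊓ (&2 =' zeroT)) ⊔
     (plug (nodeF 2) ![zeroT, zeroT, &1] ⊓ (&2 =' oneT)) ⊔
     (∃' ∃' (plug pairMemF ![&3, &4, &0] ⊓
        plug (nodeF 3) ![&3, zeroT, &1] ⊓ (&2 =' succT (&4)))) ⊔
     (∃' ∃' ∃' ∃' (plug pairMemF ![&3, &4, &0] ⊓ plug pairMemF ![&5, &6, &0] ⊓
        ((plug (nodeF 4) ![&3, &5, &1] ⊓ (&2 =' addT (&4) (&6))) ⊔
         (plug (nodeF 5) ![&3, &5, &1] ⊓ (&2 =' mulT (&4) (&6)))))))))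

/-- The variable `v_i` occurs in the term `x`; variables `i, x`. -/
def occursF : LPA.Formula (Fin 2) :=
  ∃' (plug memF ![fv 1, &0] ⊓ ∀' (plug memF ![&1, &0] ⟹
    (plug (nodeF 0) ![fv 0, zeroT, &1] ⊔
     (∃' (plug memF ![&2, &0] ⊓ plug (nodeF 3) ![&2, zeroT, &1])) ⊔
     (∃' ∃' ((plug memF ![&2, &0] ⊔ plug memF ![&3, &0]) ⊓
        (plug (nodeF 4) ![&2, &3, &1] ⊔ plug (nodeF 5) ![&2, &3, &1]))))))

/-- The term `y` is the result of replacing the variable `v_i` by the term `t` in the term `x`;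
variables `x, i, t, y`. The witness is a set of pairs `⟨subterm, result⟩`. -/
def termSubstF : LPA.Formula (Fin 4) :=
  ∃' (plug pairMemF ![fv 0, fv 3, &0] ⊓ ∀' ∀' (plug pairMemF ![&1, &2, &0] ⟹
    ((plug (nodeF 0) ![fv 1, zeroT, &1] ⊓ (&2 =' fv 2)) ⊔
     (∃' (∼(&3 =' fv 1) ⊓ plug (nodeF 0) ![&3, zeroT, &1] ⊓ (&2 =' &1))) ⊔
     (plug (nodeF 1) ![zeroT, zeroT, &1] ⊓ (&2 =' &1)) ⊔
     (plug (nodeF 2) ![zeroT, zeroT, &1] ⊓ (&2 =' &1)) ⊔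
     (∃' ∃' (plug pairMemF ![&3, &4, &0] ⊓
        plug (nodeF 3) ![&3, zeroT, &1] ⊓ plug (nodeF 3) ![&4, zeroT, &2])) ⊔
     (∃' ∃' ∃' ∃' (plug pairMemF ![&3, &4, &0] ⊓ plug pairMemF ![&5, &6, &0] ⊓
        ((plug (nodeF 4) ![&3, &5, &1] ⊓ plug (nodeF 4) ![&4, &6, &2]) ⊔
         (plug (nodeF 5) ![&3, &5, &1] ⊓ plug (nodeF 5) ![&4, &6, &2])))))))

/-- `x` is a formula. -/
def formF : LPA.Formula (Fin 1) :=
  ∃' (plug memF ![fv 0, &0] ⊓ ∀' (plug memF ![&1, &0] ⟹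
    ((∃' ∃' (plug termF ![&2] ⊓ plug termF ![&3] ⊓
        (plug (nodeF 6) ![&2, &3, &1] ⊔ plug (nodeF 7) ![&2, &3, &1]))) ⊔
     (∃' (plug memF ![&2, &0] ⊓ plug (nodeF 8) ![&2, zeroT, &1])) ⊔
     (∃' ∃' (plug memF ![&2, &0] ⊓ plug memF ![&3, &0] ⊓
        (plug (nodeF 9) ![&2, &3, &1] ⊔ plug (nodeF 10) ![&2, &3, &1]))) ⊔
     (∃' ∃' (plug memF ![&3, &0] ⊓
        (plug (nodeF 11) ![&2, &3, &1] ⊔ plug (nodeF 12) ![&2, &3, &1]))))))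

/-- The variable `v_i` occurs free in the formula `x`; variables `i, x`. -/
def freeF : LPA.Formula (Fin 2) :=
  ∃' (plug memF ![fv 1, &0] ⊓ ∀' (plug memF ![&1, &0] ⟹
    ((∃' ∃' ((plug occursF ![fv 0, &2] ⊔ plug occursF ![fv 0, &3]) ⊓
        (plug (nodeF 6) ![&2, &3, &1] ⊔ plug (nodeF 7) ![&2, &3, &1]))) ⊔
     (∃' (plug memF ![&2, &0] ⊓ plug (nodeF 8) ![&2, zeroT, &1])) ⊔
     (∃' ∃' ((plug memF ![&2, &0] ⊔ plug memF ![&3, &0]) ⊓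
        (plug (nodeF 9) ![&2, &3, &1] ⊔ plug (nodeF 10) ![&2, &3, &1]))) ⊔
     (∃' ∃' (∼(&2 =' fv 0) ⊓ plug memF ![&3, &0] ⊓
        (plug (nodeF 11) ![&2, &3, &1] ⊔ plug (nodeF 12) ![&2, &3, &1]))))))

/-- `x` is a sentence. -/
def sentF : LPA.Formula (Fin 1) :=
  plug formF ![fv 0] ⊓ ∀' ∼(plug freeF ![&0, fv 0])

/-- The formula `y` is the result of replacing the free occurrences of the variable `v_i` by the
closed term `t` in the formula `x`; variables `x, i, t, y`. The witness is a set of pairs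
`⟨subformula, result⟩`. -/
def substF : LPA.Formula (Fin 4) :=
  ∃' (plug pairMemF ![fv 0, fv 3, &0] ⊓ ∀' ∀' (plug pairMemF ![&1, &2, &0] ⟹
    ((∃' ∃' ∃' ∃' (plug termSubstF ![&3, fv 1, fv 2, &4] ⊓ plug termSubstF ![&5, fv 1, fv 2, &6] ⊓
        ((plug (nodeF 6) ![&3, &5, &1] ⊓ plug (nodeF 6) ![&4, &6, &2]) ⊔
         (plug (nodeF 7) ![&3, &5, &1] ⊓ plug (nodeF 7) ![&4, &6, &2])))) ⊔
     (∃' ∃' (plug pairMemF ![&3, &4, &0] ⊓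
        plug (nodeF 8) ![&3, zeroT, &1] ⊓ plug (nodeF 8) ![&4, zeroT, &2])) ⊔
     (∃' ∃' ∃' ∃' (plug pairMemF ![&3, &4, &0] ⊓ plug pairMemF ![&5, &6, &0] ⊓
        ((plug (nodeF 9) ![&3, &5, &1] ⊓ plug (nodeF 9) ![&4, &6, &2]) ⊔
         (plug (nodeF 10) ![&3, &5, &1] ⊓ plug (nodeF 10) ![&4, &6, &2])))) ⊔
     (∃' ((plug (nodeF 11) ![fv 1, &3, &1] ⊔ plug (nodeF 12) ![fv 1, &3, &1]) ⊓
        (&2 =' &1))) ⊔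
     (∃' ∃' ∃' (∼(&3 =' fv 1) ⊓ plug pairMemF ![&4, &5, &0] ⊓
        ((plug (nodeF 11) ![&3, &4, &1] ⊓ plug (nodeF 11) ![&3, &5, &2]) ⊔
         (plug (nodeF 12) ![&3, &4, &1] ⊓ plug (nodeF 12) ![&3, &5, &2])))))))

/-! ### The theory `CT⁻` -/

/-- The compositional axioms for the truth predicate. -/
def compositionalAxioms : LPAT.Theory :=
  { -- `T(t = s) ↔ t° = s°` for closed terms `t, s`; `&2, &3` are the values and `&4` is the code
    ∀' ∀' ∀' ∀' ∀' (plugT clTermF ![&0] ⊓ plugT clTermF ![&1] ⊓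
      plugT valF ![&0, &2] ⊓ plugT valF ![&1, &3] ⊓ plugT (nodeF 6) ![&0, &1, &4] ⟹
        (trF (&4) ⇔ (&2 =' &3))),
    -- `T(t ≤ s) ↔ t° ≤ s°` for closed terms `t, s`
    ∀' ∀' ∀' ∀' ∀' (plugT clTermF ![&0] ⊓ plugT clTermF ![&1] ⊓
      plugT valF ![&0, &2] ⊓ plugT valF ![&1, &3] ⊓ plugT (nodeF 7) ![&0, &1, &4] ⟹
        (trF (&4) ⇔ plugT (leF (fv 0) (fv 1)) ![&2, &3])),
    -- `T(φ ∧ ψ) ↔ T(φ) ∧ T(ψ)` for sentences `φ, ψ`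
    ∀' ∀' ∀' (plugT sentF ![&0] ⊓ plugT sentF ![&1] ⊓ plugT (nodeF 9) ![&0, &1, &2] ⟹
        (trF (&2) ⇔ trF (&0) ⊓ trF (&1))),
    -- `T(φ ∨ ψ) ↔ T(φ) ∨ T(ψ)` for sentences `φ, ψ`
    ∀' ∀' ∀' (plugT sentF ![&0] ⊓ plugT sentF ![&1] ⊓ plugT (nodeF 10) ![&0, &1, &2] ⟹
        (trF (&2) ⇔ trF (&0) ⊔ trF (&1))),
    -- `T(¬ φ) ↔ ¬ T(φ)` for sentences `φ`
    ∀' ∀' (plugT sentF ![&0] ⊓ plugT (nodeF 8) ![&0, incl.onTerm zeroT, &1] ⟹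
        (trF (&1) ⇔ ∼(trF (&0)))),
    -- `T(∀ v_i φ) ↔ ∀ t T(φ(t))` for `i = &0` and formulas `φ = &1` such that `∀ v_i φ` is a
    -- sentence, where `t = &3` ranges over the closed terms and `φ(t) = &4`
    ∀' ∀' ∀' (plugT formF ![&1] ⊓ plugT (nodeF 11) ![&0, &1, &2] ⊓ plugT sentF ![&2] ⟹
        (trF (&2) ⇔ ∀' ∀' (plugT clTermF ![&3] ⊓ plugT substF ![&1, &0, &3, &4] ⟹ trF (&4)))),
    -- `T(∃ v_i φ) ↔ ∃ t T(φ(t))`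
    ∀' ∀' ∀' (plugT formF ![&1] ⊓ plugT (nodeF 12) ![&0, &1, &2] ⊓ plugT sentF ![&2] ⟹
        (trF (&2) ⇔ ∃' ∃' (plugT clTermF ![&3] ⊓ plugT substF ![&1, &0, &3, &4] ⊓ trF (&4)))) }

/-- The theory `CT⁻`: Peano arithmetic (with induction for arithmetical formulas only) and the
compositional axioms. -/
def CTminus : LPAT.Theory := incl.onTheory PA ∪ compositionalAxioms

/-! ### The theory `UTB` -/

/-- The code of a (standard) arithmetical term. -/
def termCode : LPA.Term ℕ → ℕ
  | Term.var i => node 0 i 0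
  | Term.func PAFunc.zero _ => node 1 0 0
  | Term.func PAFunc.one _ => node 2 0 0
  | Term.func PAFunc.succ ts => node 3 (termCode (ts 0)) 0
  | Term.func PAFunc.add ts => node 4 (termCode (ts 0)) (termCode (ts 1))
  | Term.func PAFunc.mul ts => node 5 (termCode (ts 0)) (termCode (ts 1))

/-- The (standard) arithmetical formulas, with variables `v_0, v_1, …`, in the syntax to which the
codes refer. -/
inductive ArFormula : Type
  | eq (s t : LPA.Term ℕ) : ArFormula
  | le (s t : LPA.Term ℕ) : ArFormula
  | neg (φ : ArFormula) : ArFormula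
  | and (φ ψ : ArFormula) : ArFormula
  | or (φ ψ : ArFormula) : ArFormula
  | all (i : ℕ) (φ : ArFormula) : ArFormula
  | ex (i : ℕ) (φ : ArFormula) : ArFormula

namespace ArFormula

/-- The code of a (standard) arithmetical formula. -/
def code : ArFormula → ℕ
  | eq s t => node 6 (termCode s) (termCode t)
  | le s t => node 7 (termCode s) (termCode t)
  | neg φ => node 8 φ.code 0
  | and φ ψ => node 9 φ.code ψ.code
  | or φ ψ => node 10 φ.code ψ.code
  | all i φ => node 11 i φ.code
  | ex i φ => node 12 i φ.code

/-- The variables that occur free. -/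
def freeVars : ArFormula → Finset ℕ
  | eq s t => s.varFinset ∪ t.varFinset
  | le s t => s.varFinset ∪ t.varFinset
  | neg φ => φ.freeVars
  | and φ ψ => φ.freeVars ∪ ψ.freeVars
  | or φ ψ => φ.freeVars ∪ ψ.freeVars
  | all i φ => φ.freeVars.erase i
  | ex i φ => φ.freeVars.erase i

/-- Turns the free variable `v_i` into a bound variable, ready to be quantified. -/
def bind (i : ℕ) (φ : LPA.Formula ℕ) : LPA.BoundedFormula ℕ 1 :=
  BoundedFormula.relabel (n := 1) (fun j => if j = i then Sum.inr 0 else Sum.inl j) φ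

/-- The formula as a first-order formula of the language of arithmetic. -/
def toFormula : ArFormula → LPA.Formula ℕ
  | eq s t => s.equal t
  | le s t => leF (s.relabel Sum.inl) (t.relabel Sum.inl)
  | neg φ => ∼φ.toFormula
  | and φ ψ => φ.toFormula ⊓ ψ.toFormula
  | or φ ψ => φ.toFormula ⊔ ψ.toFormula
  | all i φ => ∀' (bind i φ.toFormula)
  | ex i φ => ∃' (bind i φ.toFormula)

end ArFormula

/-- The variables of the uniform Tarski biconditionals: closed terms `t_i`, their values `y_i`, and
the results `c_0 = φ, c_1 = φ(t_0), …, c_n = φ(t_0, …, t_{n-1})` of successive substitutions. -/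
inductive BicondVar (n : ℕ) : Type
  | t (i : Fin n) : BicondVar n
  | y (i : Fin n) : BicondVar n
  | c (i : Fin (n + 1)) : BicondVar n

instance (n : ℕ) : Finite (BicondVar n) :=
  Finite.of_injective
    (fun x => match x with
      | BicondVar.t i => (Sum.inl (Sum.inl i) : (Fin n ⊕ Fin n) ⊕ Fin (n + 1))
      | BicondVar.y i => Sum.inl (Sum.inr i)
      | BicondVar.c i => Sum.inr i)
    (by rintro (i | i | i) (j | j | j) h <;> simp_all)

/-- The uniform Tarski biconditional `∀ t_0 … t_{n-1} (T(φ(t_0, …, t_{n-1})) ↔ φ(t_0°, …, t_{n-1}°))`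
for a formula `φ(v_0, …, v_{n-1})`, where the `t_i` range over the closed terms. -/
noncomputable def biconditional (φ : ArFormula) (n : ℕ) : LPAT.Sentence :=
  let x : BicondVar n → LPAT.Term ((Empty ⊕ BicondVar n) ⊕ Fin 0) :=
    fun v => Term.var (Sum.inl (Sum.inr v))
  Formula.iAlls (BicondVar n)
    ((x (.c 0) =' incl.onTerm (num φ.code)) ⊓
      BoundedFormula.iInf (fun i : Fin n =>
        plugT clTermF ![x (.t i)] ⊓ plugT valF ![x (.t i), x (.y i)] ⊓
          plugT substF ![x (.c i.castSucc), incl.onTerm (num i), x (.t i), x (.c i.succ)]) ⟹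
      (trF (x (.c (Fin.last n))) ⇔
        BoundedFormula.subst (incl.onFormula φ.toFormula) fun j =>
          if h : j < n then Term.var (Sum.inr (.y ⟨j, h⟩)) else incl.onTerm zeroT))

/-- The scheme of uniform Tarski biconditionals for arithmetical formulas. -/
def biconditionals : LPAT.Theory :=
  {σ | ∃ (φ : ArFormula) (n : ℕ), φ.freeVars ⊆ Finset.range n ∧ σ = biconditional φ n}

/-- The theory `UTB`: Peano arithmetic, the uniform Tarski biconditionals for arithmetical formulas,
and induction for all formulas of the language with the truth predicate. -/
def UTB : LPAT.Theory := incl.onTheory PA ∪ biconditionals ∪ inductionScheme incl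

/-! ### Expansions -/

/-- The interpretation of the predicate symbol `T` by a set. -/
abbrev truthStructure {M : Type*} (T : Set M) : LT.Structure M where
  funMap := fun f => f.elim
  RelMap := fun r xs => match r with
    | TruthRel.truth => xs 0 ∈ T

/-- `(M, T) ⊨ Th`. -/
def ExpansionModels (M : Type*) [LPA.Structure M] (T : Set M) (Th : LPAT.Theory) : Prop :=
  letI := truthStructure T
  Th.Model M

/-- `M` admits an expansion `(M, T)` to a model of `Th`. -/
def ExpandsTo (M : Type*) [LPA.Structure M] (Th : LPAT.Theory) : Prop :=
  ∃ T : Set M, ExpansionModels M T Th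

end TruthTheories

namespace TruthTheories

universe u

/-! ### Arithmetical operations on a structure -/

section Operations

variable {M : Type u} [LPA.Structure M]

/-! If all elements of `M` are standard, `T` itself works: compositionality yields the
biconditionals, and induction is ordinary induction on natural numbers. Otherwise `T` may violate
induction, and another set has to be found.

Let V_n be truth for formulas of depth at most n, and D_n the set of codes of depth at most n. Call
a set G fine at n if G agrees with V_n on D_n, and if induction holds for all sets obtained, by
substituting closed terms for v_0 in a code, from the n-th partial truth predicate in which `s ≤ t`
is read as G(t). Since every actual formula has standard depth, and the true order is definable from
addition, a set that is fine at all standard levels gives a model of `UTB` (`models_UTB_of_fine`).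

Such a set is sought along a chain: G_0 is empty, and G_{k+1} = V_{r(k)}, where r(k) is the first
level at which G_k is not fine. For standard r(k), the set V_{r(k)} is arithmetically definable,
hence satisfies induction, and it agrees with the lower levels; so G_{k+1} is fine up to r(k), and
r(k) < r(k+1).

The truth predicate serves to continue the chain to nonstandard k. Fix a nonstandard c. "V_n for the
first bad level n" is written as a nested case distinction of length c: if G_k is not fine at 0 then
V_0, else if not fine at 1 then V_1, and so on. All G_k with k in M are thereby the `T`-extensions
of formulas in the sense of M, built by recursion on codes (`exists_chain`). The compositional
axioms unwind one case at a time, and finitely many unwindings suffice if r(k) is standard. If no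
G_k were fine at all standard levels, then r(c) > r(c-1) > r(c-2) > … would be an infinite descent
of natural numbers (`exists_fine`). Induction for `T` is nowhere needed.

The tools are `exists_isOperation`, which turns a definable predicate with unary holes into an
operation on codes that commutes with every truth predicate, and `exists_rec`, which iterates such
operations in the model. Behind the former is `IsTruth.fcode_iff`: compositional truth evaluates a
standard formula correctly even when formulas of nonstandard size replace some of its atoms. -/

instance (priority := low) instZeroOfLPA : Zero M := ⟨Structure.funMap (L := LPA) PAFunc.zero ![]⟩
instance (priority := low) instOneOfLPA : One M := ⟨Structure.funMap (L := LPA) PAFunc.one ![]⟩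
instance (priority := low) instAddOfLPA : Add M :=
  ⟨fun a b => Structure.funMap (L := LPA) PAFunc.add ![a, b]⟩
instance (priority := low) instMulOfLPA : Mul M :=
  ⟨fun a b => Structure.funMap (L := LPA) PAFunc.mul ![a, b]⟩
instance (priority := low) instLEOfLPA : LE M :=
  ⟨fun a b => Structure.RelMap (L := LPA) PARel.le ![a, b]⟩

/-- The interpretation of the successor symbol. -/
def suc (a : M) : M := Structure.funMap (L := LPA) PAFunc.succ ![a]

/-- The value of a standard numeral. -/
def natVal : ℕ → M
  | 0 => 0
  | n + 1 => suc (natVal n)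

variable {α : Type*} (v : α → M)

@[simp] theorem realize_zeroT : (zeroT : LPA.Term α).realize v = 0 := by
  simp only [zeroT, Term.realize]
  exact congrArg _ (Subsingleton.elim _ _)

@[simp] theorem realize_oneT : (oneT : LPA.Term α).realize v = 1 := by
  simp only [oneT, Term.realize]
  exact congrArg _ (Subsingleton.elim _ _)

@[simp] theorem realize_succT (t : LPA.Term α) : (succT t).realize v = suc (t.realize v) := by
  simp only [succT, Term.realize, suc]
  congr 1; funext i; fin_cases i; rfl

@[simp] theorem realize_addT (s t : LPA.Term α) :
    (addT s t).realize v = s.realize v + t.realize v := by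
  simp only [addT, Term.realize]
  refine congrArg (Structure.funMap (L := LPA) PAFunc.add) ?_
  funext i; fin_cases i <;> rfl

@[simp] theorem realize_mulT (s t : LPA.Term α) :
    (mulT s t).realize v = s.realize v * t.realize v := by
  simp only [mulT, Term.realize]
  refine congrArg (Structure.funMap (L := LPA) PAFunc.mul) ?_
  funext i; fin_cases i <;> rfl

@[simp] theorem realize_num (n : ℕ) : (num n : LPA.Term α).realize v = natVal n := by
  induction n with
  | zero => simp [num, natVal]
  | succ n ih => simp [num, natVal, ih]

@[simp] theorem realize_leF {n : ℕ} (s t : LPA.Term (α ⊕ Fin n)) (xs : Fin n → M) :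
    (leF s t).Realize v xs ↔
      s.realize (Sum.elim v xs) ≤ t.realize (Sum.elim v xs) := by
  simp only [leF, BoundedFormula.Realize]
  refine iff_of_eq (congrArg (Structure.RelMap (L := LPA) PARel.le) ?_)
  funext i; fin_cases i <;> rfl

end Operations

/-! ### Definable predicates

Predicates depend on unary predicates `Q h`, for `h : ℕ`, and on finitely many elements of the
model; parameters are allowed. -/

section Definable

variable {M : Type u} [LPA.Structure M]

/-- The predicates definable, with parameters, from addition, multiplication and the unary
predicates `Q h`, uniformly in `Q`. -/
inductive BasicDef : {n : ℕ} → ((ℕ → M → Prop) → (Fin n → M) → Prop) → Prop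
  | const {n : ℕ} (i : Fin n) (m : M) : BasicDef fun _ xs => xs i = m
  | eq {n : ℕ} (i j : Fin n) : BasicDef fun _ xs => xs i = xs j
  | add {n : ℕ} (i j k : Fin n) : BasicDef fun _ xs => xs i + xs j = xs k
  | mul {n : ℕ} (i j k : Fin n) : BasicDef fun _ xs => xs i * xs j = xs k
  | hole {n : ℕ} (h : ℕ) (i : Fin n) : BasicDef fun Q xs => Q h (xs i)
  | neg {n : ℕ} {P : (ℕ → M → Prop) → (Fin n → M) → Prop} :
      BasicDef P → BasicDef fun Q xs => ¬ P Q xs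
  | and {n : ℕ} {P P' : (ℕ → M → Prop) → (Fin n → M) → Prop} :
      BasicDef P → BasicDef P' → BasicDef fun Q xs => P Q xs ∧ P' Q xs
  | ex {n : ℕ} {P : (ℕ → M → Prop) → (Fin (n + 1) → M) → Prop} :
      BasicDef P → BasicDef fun Q xs => ∃ y, P Q (Fin.snoc xs y)

/-- Definable predicates. -/
class Dfn {n : ℕ} (P : (ℕ → M → Prop) → (Fin n → M) → Prop) : Prop where
  out : BasicDef P

/-- Functions with a definable graph. -/
class DfnT {n : ℕ} (f : (ℕ → M → Prop) → (Fin n → M) → M) : Prop where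
  out : BasicDef fun Q (ys : Fin (n + 1) → M) => f Q (fun i => ys i.castSucc) = ys (Fin.last n)

/-- The change of variables `σ` is arbitrary, so that weakening, permutation and identification of
arguments are all instances. -/
theorem BasicDef.rename {n : ℕ} {P : (ℕ → M → Prop) → (Fin n → M) → Prop} (h : BasicDef P) :
    ∀ {m : ℕ} (σ : Fin n → Fin m), BasicDef fun Q (xs : Fin m → M) => P Q fun i => xs (σ i) := by
  induction h with
  | const i m => exact fun σ => .const (σ i) m
  | eq i j => exact fun σ => .eq (σ i) (σ j)
  | add i j k => exact fun σ => .add (σ i) (σ j) (σ k)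
  | mul i j k => exact fun σ => .mul (σ i) (σ j) (σ k)
  | hole h i => exact fun σ => .hole h (σ i)
  | neg _ ih => exact fun σ => .neg (ih σ)
  | and _ _ ih ih' => exact fun σ => .and (ih σ) (ih' σ)
  | @ex n P _ ih =>
    intro m σ
    have := (ih (Fin.snoc (fun i => (σ i).castSucc) (Fin.last m) : Fin (n + 1) → Fin (m + 1))).ex
    convert this using 5 with Q xs y
    refine iff_of_eq (congrArg _ (funext fun i => ?_))
    refine Fin.lastCases ?_ (fun i => ?_) i <;> simp

theorem Dfn.rename {n m : ℕ} {P : (ℕ → M → Prop) → (Fin n → M) → Prop} (h : Dfn P)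
    (σ : Fin n → Fin m) : Dfn fun Q (xs : Fin m → M) => P Q fun i => xs (σ i) :=
  ⟨h.out.rename σ⟩

variable {n : ℕ}

theorem Dfn.of_iff {P P' : (ℕ → M → Prop) → (Fin n → M) → Prop} (h : Dfn P)
    (e : ∀ Q xs, P' Q xs ↔ P Q xs) : Dfn P' := by
  have : P' = P := by funext Q xs; exact propext (e Q xs)
  rwa [this]

instance Dfn.and {P P' : (ℕ → M → Prop) → (Fin n → M) → Prop} [h : Dfn P] [h' : Dfn P'] :
    Dfn fun Q xs => P Q xs ∧ P' Q xs := ⟨h.out.and h'.out⟩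

instance Dfn.or {P P' : (ℕ → M → Prop) → (Fin n → M) → Prop} [h : Dfn P] [h' : Dfn P'] :
    Dfn fun Q xs => P Q xs ∨ P' Q xs :=
  Dfn.of_iff (P := fun Q xs => ¬ (¬ P Q xs ∧ ¬ P' Q xs)) ⟨(h.out.neg.and h'.out.neg).neg⟩
    fun Q xs => by tauto

instance Dfn.imp {P P' : (ℕ → M → Prop) → (Fin n → M) → Prop} [h : Dfn P] [h' : Dfn P'] :
    Dfn fun Q xs => P Q xs → P' Q xs :=
  Dfn.of_iff (P := fun Q xs => ¬ (P Q xs ∧ ¬ P' Q xs)) ⟨(h.out.and h'.out.neg).neg⟩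
    fun Q xs => by tauto

instance Dfn.iff {P P' : (ℕ → M → Prop) → (Fin n → M) → Prop} [h : Dfn P] [h' : Dfn P'] :
    Dfn fun Q xs => P Q xs ↔ P' Q xs :=
  Dfn.of_iff (P := fun Q xs => (P Q xs → P' Q xs) ∧ (P' Q xs → P Q xs)) inferInstance
    fun Q xs => by tauto

/-- The bound variable is a separate argument of `P`, so that the instance unifies with quantifiers
as they are written; in the premise it is the last variable of a longer context. Definability is
thus proved by instance search along the shape of a predicate. -/
instance Dfn.exists {P : (ℕ → M → Prop) → (Fin n → M) → M → Prop}
    [h : Dfn fun Q (ys : Fin (n + 1) → M) => P Q (fun i => ys i.castSucc) (ys (Fin.last n))] :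
    Dfn fun Q xs => ∃ y, P Q xs y :=
  Dfn.of_iff ⟨h.out.ex⟩ fun Q xs => by simp

instance Dfn.forall {P : (ℕ → M → Prop) → (Fin n → M) → M → Prop}
    [h : Dfn fun Q (ys : Fin (n + 1) → M) => P Q (fun i => ys i.castSucc) (ys (Fin.last n))] :
    Dfn fun Q xs => ∀ y, P Q xs y :=
  Dfn.of_iff ⟨h.out.neg.ex.neg⟩ fun Q xs => by simp

instance Dfn.false : Dfn fun (_ : ℕ → M → Prop) (_ : Fin n → M) => False :=
  Dfn.of_iff ⟨(BasicDef.eq (Fin.last n) (Fin.last n)).neg.ex⟩ fun _ _ => by simp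

instance DfnT.var (i : Fin n) : DfnT fun (_ : ℕ → M → Prop) xs => xs i :=
  ⟨.eq i.castSucc (Fin.last n)⟩

instance (priority := low) DfnT.const (m : M) :
    DfnT fun (_ : ℕ → M → Prop) (_ : Fin n → M) => m :=
  ⟨by simpa [eq_comm] using BasicDef.const (Fin.last n) m⟩

theorem Dfn.bind {P : (ℕ → M → Prop) → (Fin n → M) → M → Prop}
    {f : (ℕ → M → Prop) → (Fin n → M) → M} (hf : DfnT f)
    (h : Dfn fun Q (ys : Fin (n + 1) → M) => P Q (fun i => ys i.castSucc) (ys (Fin.last n))) :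
    Dfn fun Q xs => P Q xs (f Q xs) :=
  Dfn.of_iff ⟨(hf.out.and h.out).ex⟩ fun Q xs => by simp

/-- A definable function, in a context with an additional variable. -/
theorem DfnT.weaken {f : (ℕ → M → Prop) → (Fin n → M) → M} (hf : DfnT f) :
    DfnT fun Q (ys : Fin (n + 1) → M) => f Q fun i => ys i.castSucc := by
  refine ⟨?_⟩
  have := hf.out.rename (m := n + 2)
    (Fin.snoc (fun i : Fin n => i.castSucc.castSucc) (Fin.last (n + 1)) : Fin (n + 1) → Fin (n + 2))
  simpa using this

theorem Dfn.comp₁ {P : M → Prop} (h : Dfn (n := 1) fun _ xs => P (xs 0))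
    {f : (ℕ → M → Prop) → (Fin n → M) → M} [hf : DfnT f] : Dfn fun Q xs => P (f Q xs) :=
  Dfn.bind (P := fun _ _ y => P y) hf (h.rename fun _ => Fin.last n)

theorem Dfn.comp₂ {P : M → M → Prop} (h : Dfn (n := 2) fun _ xs => P (xs 0) (xs 1))
    {f g : (ℕ → M → Prop) → (Fin n → M) → M} [hf : DfnT f] [hg : DfnT g] :
    Dfn fun Q xs => P (f Q xs) (g Q xs) :=
  Dfn.bind (P := fun Q xs y => P (f Q xs) y) hg <|
    Dfn.bind (P := fun _ xs y => P y (xs (Fin.last n))) hf.weaken <|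
      -- The last argument was bound first, so the arguments stand in the context in reverse order.
      h.rename ![Fin.last (n + 1), (Fin.last n).castSucc]

theorem Dfn.comp₃ {P : M → M → M → Prop} (h : Dfn (n := 3) fun _ xs => P (xs 0) (xs 1) (xs 2))
    {f g k : (ℕ → M → Prop) → (Fin n → M) → M} [hf : DfnT f] [hg : DfnT g] [hk : DfnT k] :
    Dfn fun Q xs => P (f Q xs) (g Q xs) (k Q xs) :=
  Dfn.bind (P := fun Q xs y => P (f Q xs) (g Q xs) y) hk <|
    Dfn.bind (P := fun Q xs y => P (f Q fun i => xs i.castSucc) y (xs (Fin.last n))) hg.weaken <|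
      Dfn.bind (P := fun _ xs y => P y (xs (Fin.last (n + 1))) (xs (Fin.last n).castSucc))
        hf.weaken.weaken <|
        h.rename ![Fin.last (n + 2), (Fin.last (n + 1)).castSucc, (Fin.last n).castSucc.castSucc]

theorem Dfn.comp₄ {P : M → M → M → M → Prop}
    (h : Dfn (n := 4) fun _ xs => P (xs 0) (xs 1) (xs 2) (xs 3))
    {f g k l : (ℕ → M → Prop) → (Fin n → M) → M} [hf : DfnT f] [hg : DfnT g] [hk : DfnT k]
    [hl : DfnT l] : Dfn fun Q xs => P (f Q xs) (g Q xs) (k Q xs) (l Q xs) :=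
  Dfn.bind (P := fun Q xs y => P (f Q xs) (g Q xs) (k Q xs) y) hl <|
    Dfn.bind (P := fun Q xs y => P (f Q fun i => xs i.castSucc) (g Q fun i => xs i.castSucc) y
      (xs (Fin.last n))) hk.weaken <|
      Dfn.bind (P := fun Q xs y => P (f Q fun i => xs i.castSucc.castSucc) y
        (xs (Fin.last (n + 1))) (xs (Fin.last n).castSucc)) hg.weaken.weaken <|
        Dfn.bind (P := fun _ xs y => P y (xs (Fin.last (n + 2))) (xs (Fin.last (n + 1)).castSucc)
          (xs (Fin.last n).castSucc.castSucc)) hf.weaken.weaken.weaken <|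
          h.rename ![Fin.last (n + 3), (Fin.last (n + 2)).castSucc,
            (Fin.last (n + 1)).castSucc.castSucc, (Fin.last n).castSucc.castSucc.castSucc]

instance Dfn.equal {f g : (ℕ → M → Prop) → (Fin n → M) → M} [DfnT f] [DfnT g] :
    Dfn fun Q xs => f Q xs = g Q xs :=
  Dfn.comp₂ (P := fun a b => a = b) ⟨.eq 0 1⟩

instance Dfn.hole (h : ℕ) {f : (ℕ → M → Prop) → (Fin n → M) → M} [hf : DfnT f] :
    Dfn fun Q xs => Q h (f Q xs) :=
  Dfn.bind (P := fun Q _ y => Q h y) hf ⟨.hole h (Fin.last n)⟩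

/-- A function is definable if its graph is. -/
theorem DfnT.of_graph {f : (ℕ → M → Prop) → (Fin n → M) → M}
    (h : Dfn fun Q (ys : Fin (n + 1) → M) => f Q (fun i => ys i.castSucc) = ys (Fin.last n)) :
    DfnT f := ⟨h.out⟩

theorem DfnT.comp₁ {F : M → M} (h : Dfn (n := 2) fun _ xs => F (xs 0) = xs 1)
    {f : (ℕ → M → Prop) → (Fin n → M) → M} [hf : DfnT f] : DfnT fun Q xs => F (f Q xs) :=
  haveI := hf.weaken
  .of_graph (Dfn.comp₂ (P := fun a b => F a = b) h)

theorem DfnT.comp₂ {F : M → M → M} (h : Dfn (n := 3) fun _ xs => F (xs 0) (xs 1) = xs 2)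
    {f g : (ℕ → M → Prop) → (Fin n → M) → M} [hf : DfnT f] [hg : DfnT g] :
    DfnT fun Q xs => F (f Q xs) (g Q xs) :=
  haveI := hf.weaken
  haveI := hg.weaken
  .of_graph (Dfn.comp₃ (P := fun a b c => F a b = c) h)

theorem DfnT.comp₃ {F : M → M → M → M}
    (h : Dfn (n := 4) fun _ xs => F (xs 0) (xs 1) (xs 2) = xs 3)
    {f g k : (ℕ → M → Prop) → (Fin n → M) → M} [hf : DfnT f] [hg : DfnT g] [hk : DfnT k] :
    DfnT fun Q xs => F (f Q xs) (g Q xs) (k Q xs) :=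
  haveI := hf.weaken
  haveI := hg.weaken
  haveI := hk.weaken
  .of_graph (Dfn.comp₄ (P := fun a b c d => F a b c = d) h)

instance DfnT.add {f g : (ℕ → M → Prop) → (Fin n → M) → M} [DfnT f] [DfnT g] :
    DfnT fun Q xs => f Q xs + g Q xs :=
  DfnT.comp₂ (F := fun a b => a + b) ⟨.add 0 1 2⟩

instance DfnT.mul {f g : (ℕ → M → Prop) → (Fin n → M) → M} [DfnT f] [DfnT g] :
    DfnT fun Q xs => f Q xs * g Q xs :=
  DfnT.comp₂ (F := fun a b => a * b) ⟨.mul 0 1 2⟩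

end Definable

/-! ### Evaluation of coded formulas, with the inequality symbol read as an arbitrary relation -/

section Evaluation

variable {M : Type u} [LPA.Structure M]

namespace ArFormula

/-- Truth of an arithmetical formula, where `s ≤ t` is read as `R s t`. -/
def Eval (R : M → M → Prop) : ArFormula → (ℕ → M) → Prop
  | eq s t, v => s.realize v = t.realize v
  | le s t, v => R (s.realize v) (t.realize v)
  | neg φ, v => ¬ φ.Eval R v
  | and φ ψ, v => φ.Eval R v ∧ ψ.Eval R v
  | or φ ψ, v => φ.Eval R v ∨ ψ.Eval R v
  | all i φ, v => ∀ x, φ.Eval R (Function.update v i x)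
  | ex i φ, v => ∃ x, φ.Eval R (Function.update v i x)

end ArFormula

theorem realize_congr_varFinset {α : Type*} [DecidableEq α] (t : LPA.Term α) {v w : α → M}
    (h : ∀ i ∈ t.varFinset, v i = w i) : t.realize v = t.realize w := by
  induction t with
  | var i => exact h i (by simp [Term.varFinset])
  | func f ts ih =>
    simp only [Term.realize]
    congr 1; funext i
    exact ih i fun j hj => h j (by simpa [Term.varFinset] using ⟨i, hj⟩)

namespace ArFormula

theorem eval_congr (R : M → M → Prop) (φ : ArFormula) {v w : ℕ → M}
    (h : ∀ i ∈ φ.freeVars, v i = w i) : φ.Eval R v ↔ φ.Eval R w := by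
  induction φ generalizing v w with
  | eq s t =>
    simp only [Eval]
    rw [realize_congr_varFinset s fun i hi => h i (by simp [freeVars, hi]),
      realize_congr_varFinset t fun i hi => h i (by simp [freeVars, hi])]
  | le s t =>
    simp only [Eval]
    rw [realize_congr_varFinset s fun i hi => h i (by simp [freeVars, hi]),
      realize_congr_varFinset t fun i hi => h i (by simp [freeVars, hi])]
  | neg φ ih => exact not_congr (ih h)
  | and φ ψ ih ih' =>
    exact and_congr (ih fun i hi => h i (by simp [freeVars, hi]))
      (ih' fun i hi => h i (by simp [freeVars, hi]))
  | or φ ψ ih ih' =>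
    exact or_congr (ih fun i hi => h i (by simp [freeVars, hi]))
      (ih' fun i hi => h i (by simp [freeVars, hi]))
  | all i φ ih =>
    refine forall_congr' fun x => ih fun j hj => ?_
    by_cases hji : j = i
    · simp [hji]
    · simpa [hji] using h j (by simp [freeVars, hj, hji])
  | ex i φ ih =>
    refine exists_congr fun x => ih fun j hj => ?_
    by_cases hji : j = i
    · simp [hji]
    · simpa [hji] using h j (by simp [freeVars, hj, hji])

theorem realize_bind (i : ℕ) (φ : LPA.Formula ℕ) (v : ℕ → M) (x : M) :
    (bind i φ).Realize v (Fin.snoc default x) ↔ φ.Realize (Function.update v i x) := by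
  unfold bind Formula.Realize
  rw [BoundedFormula.realize_relabel]
  refine iff_of_eq (congrArg₂ _ ?_ (Subsingleton.elim _ _))
  funext j
  by_cases h : j = i
  · subst h; simp [Fin.snoc]
  · simp [h]

theorem realize_toFormula (φ : ArFormula) (v : ℕ → M) :
    φ.toFormula.Realize v ↔ φ.Eval (fun a b => a ≤ b) v := by
  induction φ generalizing v with
  | eq s t => simp [toFormula, Eval]
  | le s t =>
    unfold toFormula Formula.Realize Eval
    rw [realize_leF]
    simp [Function.comp_def]
  | neg φ ih => simp [toFormula, Eval, ← ih]
  | and φ ψ ih ih' => simp [toFormula, Eval, ← ih, ← ih']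
  | or φ ψ ih ih' => simp [toFormula, Eval, ← ih, ← ih']
  | all i φ ih =>
    simp only [toFormula, Eval, Formula.Realize, BoundedFormula.realize_all, ← ih]
    exact forall_congr' fun x => realize_bind i _ v x
  | ex i φ ih =>
    simp only [toFormula, Eval, Formula.Realize, BoundedFormula.realize_ex, ← ih]
    exact exists_congr fun x => realize_bind i _ v x

/-- All inequalities `s ≤ t` that occur in the formula satisfy `p s t`. -/
def AllLe (p : LPA.Term ℕ → LPA.Term ℕ → Prop) : ArFormula → Prop
  | eq _ _ => True
  | le s t => p s t
  | neg φ => φ.AllLe p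
  | and φ ψ => φ.AllLe p ∧ ψ.AllLe p
  | or φ ψ => φ.AllLe p ∧ ψ.AllLe p
  | all _ φ => φ.AllLe p
  | ex _ φ => φ.AllLe p

/-- Inequalities occur only in the form `num h ≤ v_i` with `i ≠ 0`. -/
abbrev HoleSafe : ArFormula → Prop := AllLe fun s t => ∃ h i, s = num h ∧ t = Term.var (i + 1)

end ArFormula

@[simp] theorem varFinset_addT (s t : LPA.Term ℕ) :
    (addT s t).varFinset = s.varFinset ∪ t.varFinset := by
  ext; simp [addT, Term.varFinset, Fin.exists_fin_two]

@[simp] theorem varFinset_mulT (s t : LPA.Term ℕ) :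
    (mulT s t).varFinset = s.varFinset ∪ t.varFinset := by
  ext; simp [mulT, Term.varFinset, Fin.exists_fin_two]

@[simp] theorem varFinset_num (n : ℕ) : (num n : LPA.Term ℕ).varFinset = ∅ := by
  induction n with
  | zero => ext; simp [num, zeroT, Term.varFinset]
  | succ n ih => ext; simp [num, succT, Term.varFinset, ih]

open ArFormula in
/-- A definable predicate is defined by an arithmetical formula in which the predicate `Q h` is
expressed by inequalities `num h ≤ v_i`. The parameters `c ∈ C` are the values of the variables of
index `2 * f c + 1`, and the arguments those of the variables of even index. -/
theorem BasicDef.exists_arFormula {n : ℕ} {P : (ℕ → M → Prop) → (Fin n → M) → Prop}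
    (h : BasicDef P) : ∃ C : Finset M, ∀ f : M → ℕ, ∃ F : ArFormula, F.HoleSafe ∧
      (∀ j ∈ F.freeVars, (∃ i : Fin n, j = 2 * (i : ℕ) + 2) ∨ ∃ c ∈ C, j = 2 * f c + 1) ∧
      ∀ (R : M → M → Prop) (Q : ℕ → M → Prop) (v : ℕ → M), (∀ h b, R (natVal h) b ↔ Q h b) →
        (∀ c ∈ C, v (2 * f c + 1) = c) → (F.Eval R v ↔ P Q fun i => v (2 * (i : ℕ) + 2)) := by
  classical
  induction h with
  | const i m =>
    -- The index `0` is never used: in the coded formulas, `v_0` is the variable bound around a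
    -- formula plugged into a hole.
    refine ⟨{m}, fun f => ⟨.eq (.var (2 * (i : ℕ) + 2)) (.var (2 * f m + 1)), trivial, ?_, ?_⟩⟩
    · intro j hj
      simp only [freeVars, Term.varFinset, Finset.mem_union, Finset.mem_singleton] at hj
      exact hj.imp (fun h => ⟨i, h⟩) fun h => ⟨m, by simp, h⟩
    · intro R Q v _ hv
      simp [Eval, hv m (by simp)]
  | eq i i' =>
    refine ⟨∅, fun f => ⟨.eq (.var (2 * (i : ℕ) + 2)) (.var (2 * (i' : ℕ) + 2)), trivial, ?_, ?_⟩⟩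
    · intro j hj
      simp only [freeVars, Term.varFinset, Finset.mem_union, Finset.mem_singleton] at hj
      exact .inl (hj.elim (fun h => ⟨i, h⟩) fun h => ⟨i', h⟩)
    · intro R Q v _ _
      simp [Eval]
  | add i i' k =>
    refine ⟨∅, fun f => ⟨.eq (addT (.var (2 * (i : ℕ) + 2)) (.var (2 * (i' : ℕ) + 2)))
      (.var (2 * (k : ℕ) + 2)), trivial, ?_, ?_⟩⟩
    · intro j hj
      simp only [freeVars, varFinset_addT, Term.varFinset, Finset.mem_union,
        Finset.mem_singleton] at hj
      rcases hj with (h | h) | h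
      exacts [.inl ⟨i, h⟩, .inl ⟨i', h⟩, .inl ⟨k, h⟩]
    · intro R Q v _ _
      simp [Eval]
  | mul i i' k =>
    refine ⟨∅, fun f => ⟨.eq (mulT (.var (2 * (i : ℕ) + 2)) (.var (2 * (i' : ℕ) + 2)))
      (.var (2 * (k : ℕ) + 2)), trivial, ?_, ?_⟩⟩
    · intro j hj
      simp only [freeVars, varFinset_mulT, Term.varFinset, Finset.mem_union,
        Finset.mem_singleton] at hj
      rcases hj with (h | h) | h
      exacts [.inl ⟨i, h⟩, .inl ⟨i', h⟩, .inl ⟨k, h⟩]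
    · intro R Q v _ _
      simp [Eval]
  | hole h i =>
    refine ⟨∅, fun f => ⟨.le (num h) (.var (2 * (i : ℕ) + 2)), ⟨h, _, rfl, rfl⟩, ?_, ?_⟩⟩
    · intro j hj
      simp only [freeVars, varFinset_num, Term.varFinset, Finset.empty_union,
        Finset.mem_singleton] at hj
      exact .inl ⟨i, hj⟩
    · intro R Q v hR _
      simp [Eval, hR]
  | neg _ ih =>
    obtain ⟨C, hC⟩ := ih
    refine ⟨C, fun f => ?_⟩
    obtain ⟨F, hF, hfv, he⟩ := hC f
    exact ⟨.neg F, hF, hfv, fun R Q v hR hv => not_congr (he R Q v hR hv)⟩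
  | and _ _ ih ih' =>
    obtain ⟨C, hC⟩ := ih
    obtain ⟨C', hC'⟩ := ih'
    -- Since the naming `f` is chosen after the set of parameters, both conjuncts can use the same
    -- one.
    refine ⟨C ∪ C', fun f => ?_⟩
    obtain ⟨F, hF, hfv, he⟩ := hC f
    obtain ⟨F', hF', hfv', he'⟩ := hC' f
    refine ⟨.and F F', ⟨hF, hF'⟩, ?_, fun R Q v hR hv => and_congr
      (he R Q v hR fun c hc => hv c (by simp [hc])) (he' R Q v hR fun c hc => hv c (by simp [hc]))⟩
    intro j hj
    simp only [freeVars, Finset.mem_union] at hj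
    rcases hj with hj | hj
    · exact (hfv j hj).imp id fun ⟨c, hc, h⟩ => ⟨c, by simp [hc], h⟩
    · exact (hfv' j hj).imp id fun ⟨c, hc, h⟩ => ⟨c, by simp [hc], h⟩
  | @ex n P _ ih =>
    obtain ⟨C, hC⟩ := ih
    refine ⟨C, fun f => ?_⟩
    obtain ⟨F, hF, hfv, he⟩ := hC f
    refine ⟨.ex (2 * n + 2) F, hF, ?_, fun R Q v hR hv => exists_congr fun y => ?_⟩
    · intro j hj
      simp only [freeVars, Finset.mem_erase] at hj
      refine (hfv j hj.2).imp ?_ id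
      rintro ⟨i, rfl⟩
      refine Fin.lastCases (fun h => ?_) (fun i _ => ⟨i, rfl⟩) i hj.1
      simp at h
    · rw [he R Q _ hR fun c hc => by
        rw [Function.update_of_ne (by omega), hv c hc] ]
      refine iff_of_eq (congrArg _ (funext fun i => ?_))
      refine Fin.lastCases (by simp) (fun i => ?_) i
      have : (2 * (i : ℕ) + 2) ≠ 2 * n + 2 := by have := i.2; omega
      rw [Fin.snoc_castSucc, Fin.val_castSucc, Function.update_of_ne this]

/-- A finite set of parameters can be named by natural numbers. -/
theorem exists_naming (C : Finset M) : ∃ (f : M → ℕ) (e : ℕ → M), ∀ c ∈ C, e (f c) = c := by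
  classical
  refine ⟨fun c => C.toList.idxOf c, fun i => C.toList.getD i 0, fun c hc => ?_⟩
  have h : C.toList.idxOf c < C.toList.length := List.idxOf_lt_length_iff.2 (by simpa using hc)
  simp [List.getElem?_eq_getElem h]

open ArFormula in
/-- A definable unary predicate is defined by an arithmetical formula with free variable `v_0`,
and with parameters. -/
theorem Dfn.exists_arFormula {P : (ℕ → M → Prop) → (Fin 1 → M) → Prop} (h : Dfn P) :
    ∃ (F : ArFormula) (w : ℕ → M), F.HoleSafe ∧
      ∀ (R : M → M → Prop) (Q : ℕ → M → Prop), (∀ h b, R (natVal h) b ↔ Q h b) →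
        ∀ x, (F.Eval R (Function.update w 0 x) ↔ P Q fun _ => x) := by
  obtain ⟨C, hC⟩ := h.out.exists_arFormula
  obtain ⟨f, e, he⟩ := exists_naming C
  obtain ⟨F, hF, hfv, hev⟩ := hC f
  -- The only argument of `F` is `v_2`; it is moved to `v_0` by an equation, because holes must not
  -- contain `v_0`. The assignment inverts `j = 2 * f c + 1`.
  refine ⟨.ex 2 (.and (.eq (.var 2) (.var 0)) F), fun j => e ((j - 1) / 2), ⟨trivial, hF⟩, ?_⟩
  intro R Q hR x
  have hd : ∀ c : M, (2 * f c + 1 - 1) / 2 = f c := fun c => by omega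
  have key (y : M) : F.Eval R (Function.update (Function.update (fun j => e ((j - 1) / 2)) 0 x) 2 y)
      ↔ P Q fun _ => y := by
    rw [hev R Q _ hR fun c hc => ?_]
    · refine iff_of_eq (congrArg _ (funext fun i => ?_))
      simp [Fin.fin_one_eq_zero i]
    · rw [Function.update_of_ne (by omega), Function.update_of_ne (by omega), hd, he c hc]
  simp [Eval, key]

/-! ### The induction scheme, for definable predicates -/

theorem realize_inductionAxiom {L : Language} [L.Structure M] (ι : LPA →ᴸ L) [ι.IsExpansionOn M]
    {n : ℕ} (φ : L.Formula (Fin (n + 1))) : M ⊨ inductionAxiom ι φ ↔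
      ∀ p : Fin n → M, φ.Realize (Matrix.vecCons 0 p) →
        (∀ x, φ.Realize (Matrix.vecCons x p) → φ.Realize (Matrix.vecCons (suc x) p)) →
        ∀ x, φ.Realize (Matrix.vecCons x p) := by
  unfold inductionAxiom Sentence.Realize
  rw [BoundedFormula.realize_alls]
  refine forall_congr' fun p => ?_
  simp only [BoundedFormula.realize_imp, BoundedFormula.realize_all, realize_plug]
  have e0 : (fun i : Fin (n + 1) => Term.realize (Sum.elim (default : Empty → M) p)
      (Matrix.vecCons (ι.onTerm zeroT)
        (fun i : Fin n => (Term.var (Sum.inr i) : L.Term (Empty ⊕ Fin n))) i)) =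
      Matrix.vecCons 0 p := by
    funext i; refine Fin.cases ?_ (fun i => ?_) i <;> simp
  have e1 (y : M) : (fun i : Fin (n + 1) => Term.realize (Sum.elim (default : Empty → M)
      (Fin.snoc p y)) (Matrix.vecCons (Term.var (Sum.inr (Fin.last n)))
        (fun i : Fin n => (Term.var (Sum.inr i.castSucc) : L.Term (Empty ⊕ Fin (n + 1)))) i)) =
      Matrix.vecCons y p := by
    funext i; refine Fin.cases ?_ (fun i => ?_) i <;> simp
  have e2 (y : M) : (fun i : Fin (n + 1) => Term.realize (Sum.elim (default : Empty → M)
      (Fin.snoc p y)) (Matrix.vecCons (ι.onTerm (succT (Term.var (Sum.inr (Fin.last n)))))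
        (fun i : Fin n => (Term.var (Sum.inr i.castSucc) : L.Term (Empty ⊕ Fin (n + 1)))) i)) =
      Matrix.vecCons (suc y) p := by
    funext i; refine Fin.cases ?_ (fun i => ?_) i <;> simp
  simp only [e0, e1, e2]

/-- Induction for arithmetical formulas. -/
theorem induction_arFormula [PA.Model M] (F : ArFormula) (w : ℕ → M)
    (h0 : F.Eval (fun a b => a ≤ b) (Function.update w 0 0))
    (hs : ∀ x, F.Eval (fun a b => a ≤ b) (Function.update w 0 x) →
      F.Eval (fun a b => a ≤ b) (Function.update w 0 (suc x))) (x : M) :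
    F.Eval (fun a b => a ≤ b) (Function.update w 0 x) := by
  obtain ⟨N, hN⟩ : ∃ N, F.freeVars ⊆ Finset.range (N + 1) :=
    ⟨F.freeVars.sup id, fun i hi => by
      simpa [Nat.lt_succ_iff] using Finset.le_sup (f := id) hi⟩
  -- All free variables have an index at most `N`, where `Fin.ofNat` does not alter the index.
  let φ : LPA.Formula (Fin (N + 1)) := F.toFormula.relabel fun i => Fin.ofNat (N + 1) i
  have hφ (y : M) : φ.Realize (Matrix.vecCons y fun i : Fin N => w (i + 1)) ↔
      F.Eval (fun a b => a ≤ b) (Function.update w 0 y) := by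
    rw [Formula.realize_relabel, ArFormula.realize_toFormula]
    refine ArFormula.eval_congr _ _ fun i hi => ?_
    have hi' := Finset.mem_range.1 (hN hi)
    cases i with
    | zero => simp
    | succ i =>
      have : Fin.ofNat (N + 1) (i + 1) = Fin.succ ⟨i, by omega⟩ := by
        ext; simp [Nat.mod_eq_of_lt hi']
      rw [Function.comp_apply, this]
      simp
  have hmem : inductionAxiom (LHom.id LPA) φ ∈ PA := .inr ⟨N, φ, rfl⟩
  have := (realize_inductionAxiom (M := M) _ _).1 (Theory.realize_sentence_of_mem (M := M) PA hmem)
    fun i => w (i + 1)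
  simp only [hφ] at this
  exact this h0 hs x

/-- Induction for definable predicates. -/
theorem induction_dfn [PA.Model M] (P : M → Prop) [h : Dfn (n := 1) fun _ xs => P (xs 0)]
    (h0 : P 0) (hs : ∀ x, P x → P (suc x)) (x : M) : P x := by
  obtain ⟨F, w, -, hF⟩ := h.exists_arFormula
  -- `P` has no holes, so they may be read as `natVal h ≤ b`; then `F` is evaluated as an ordinary
  -- arithmetical formula.
  have := hF (fun a b => a ≤ b) (fun h b => natVal h ≤ b) fun _ _ => Iff.rfl
  rw [← this x]
  refine induction_arFormula F w ((this 0).2 h0) (fun y hy => (this _).2 (hs _ ((this y).1 hy))) x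

end Evaluation

/-! ### Models of Peano arithmetic as ordered semirings -/

section Arithmetic

variable {M : Type u} [LPA.Structure M] [PA.Model M]

theorem realize_of_basicAxioms {σ : LPA.Sentence} (h : σ ∈ basicAxioms) : M ⊨ σ :=
  Theory.realize_sentence_of_mem PA (.inl h)

theorem suc_ne_zero (x : M) : suc x ≠ 0 := by
  have := realize_of_basicAxioms (M := M) (σ := ∀' ∼(succT (&0) =' zeroT)) (by simp [basicAxioms])
  simpa [Sentence.Realize, Formula.Realize, Fin.snoc] using this x

theorem suc_injective : Function.Injective (suc : M → M) := by
  intro x y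
  have := realize_of_basicAxioms (M := M)
    (σ := ∀' ∀' ((succT (&0) =' succT (&1)) ⟹ (&0 =' &1))) (by simp [basicAxioms])
  simpa [Sentence.Realize, Formula.Realize, Fin.snoc] using this x y

theorem one_eq_suc_zero : (1 : M) = suc 0 := by
  have := realize_of_basicAxioms (M := M) (σ := oneT =' succT zeroT) (by simp [basicAxioms])
  simpa [Sentence.Realize, Formula.Realize, Fin.snoc] using this

theorem pa_add_zero (x : M) : x + 0 = x := by
  have := realize_of_basicAxioms (M := M) (σ := ∀' (addT (&0) zeroT =' &0)) (by simp [basicAxioms])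
  simpa [Sentence.Realize, Formula.Realize, Fin.snoc] using this x

theorem pa_add_suc (x y : M) : x + suc y = suc (x + y) := by
  have := realize_of_basicAxioms (M := M)
    (σ := ∀' ∀' (addT (&0) (succT (&1)) =' succT (addT (&0) (&1)))) (by simp [basicAxioms])
  simpa [Sentence.Realize, Formula.Realize, Fin.snoc] using this x y

theorem pa_mul_zero (x : M) : x * 0 = 0 := by
  have := realize_of_basicAxioms (M := M) (σ := ∀' (mulT (&0) zeroT =' zeroT))
    (by simp [basicAxioms])
  simpa [Sentence.Realize, Formula.Realize, Fin.snoc] using this x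

theorem pa_mul_suc (x y : M) : x * suc y = x * y + x := by
  have := realize_of_basicAxioms (M := M)
    (σ := ∀' ∀' (mulT (&0) (succT (&1)) =' addT (mulT (&0) (&1)) (&0))) (by simp [basicAxioms])
  simpa [Sentence.Realize, Formula.Realize, Fin.snoc] using this x y

theorem pa_le_iff (x y : M) : x ≤ y ↔ ∃ z, x + z = y := by
  have := realize_of_basicAxioms (M := M)
    (σ := ∀' ∀' (leF (&0) (&1) ⇔ ∃' (addT (&0) (&2) =' &1))) (by simp [basicAxioms])
  simpa [Sentence.Realize, Formula.Realize, Fin.snoc] using this x y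

instance DfnT.suc {n : ℕ} {f : (ℕ → M → Prop) → (Fin n → M) → M} [DfnT f] :
    DfnT fun Q xs => suc (f Q xs) :=
  DfnT.comp₁ (F := TruthTheories.suc)
    (Dfn.of_iff (P := fun _ xs => xs 0 + TruthTheories.suc 0 = xs 1) inferInstance fun _ xs => by
      rw [pa_add_suc, pa_add_zero])

theorem pa_zero_add (x : M) : 0 + x = x := by
  refine induction_dfn (fun x : M => 0 + x = x) (pa_add_zero 0) (fun x h => ?_) x
  rw [pa_add_suc, h]

theorem pa_suc_add (x y : M) : suc x + y = suc (x + y) := by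
  refine induction_dfn (fun y : M => suc x + y = suc (x + y)) ?_ (fun y h => ?_) y
  · simp only [pa_add_zero]
  · simp only [pa_add_suc, h]

theorem pa_add_comm (x y : M) : x + y = y + x := by
  refine induction_dfn (fun y : M => x + y = y + x) ?_ (fun y h => ?_) y
  · simp only [pa_add_zero, pa_zero_add]
  · simp only [pa_add_suc, pa_suc_add, h]

theorem pa_add_assoc (x y z : M) : x + y + z = x + (y + z) := by
  refine induction_dfn (fun z : M => x + y + z = x + (y + z)) ?_ (fun z h => ?_) z
  · simp only [pa_add_zero]
  · simp only [pa_add_suc, h]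

theorem pa_zero_mul (x : M) : 0 * x = 0 := by
  refine induction_dfn (fun x : M => 0 * x = 0) (pa_mul_zero 0) (fun x h => ?_) x
  simp only [pa_mul_suc, h, pa_add_zero]

theorem pa_suc_mul (x y : M) : suc x * y = x * y + y := by
  refine induction_dfn (fun y : M => suc x * y = x * y + y) ?_ (fun y h => ?_) y
  · simp only [pa_mul_zero, pa_add_zero]
  · simp only [pa_mul_suc, pa_add_suc, h]
    rw [pa_add_assoc, pa_add_comm y x, ← pa_add_assoc]

theorem pa_mul_comm (x y : M) : x * y = y * x := by
  refine induction_dfn (fun y : M => x * y = y * x) ?_ (fun y h => ?_) y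
  · simp only [pa_mul_zero, pa_zero_mul]
  · simp only [pa_mul_suc, pa_suc_mul, h]

theorem pa_left_distrib (x y z : M) : x * (y + z) = x * y + x * z := by
  refine induction_dfn (fun z : M => x * (y + z) = x * y + x * z) ?_ (fun z h => ?_) z
  · simp only [pa_mul_zero, pa_add_zero]
  · simp only [pa_mul_suc, pa_add_suc, h, pa_add_assoc]

theorem pa_mul_assoc (x y z : M) : x * y * z = x * (y * z) := by
  refine induction_dfn (fun z : M => x * y * z = x * (y * z)) ?_ (fun z h => ?_) z
  · simp only [pa_mul_zero]
  · simp only [pa_mul_suc, h, pa_left_distrib]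

theorem pa_mul_one (x : M) : x * 1 = x := by
  rw [one_eq_suc_zero, pa_mul_suc, pa_mul_zero, pa_zero_add]

instance (priority := low) instCommSemiringOfPA : CommSemiring M where
  add_assoc := pa_add_assoc
  zero_add := pa_zero_add
  add_zero := pa_add_zero
  add_comm := pa_add_comm
  left_distrib := pa_left_distrib
  right_distrib x y z := by rw [pa_mul_comm, pa_left_distrib, pa_mul_comm z, pa_mul_comm z]
  zero_mul := pa_zero_mul
  mul_zero := pa_mul_zero
  mul_assoc := pa_mul_assoc
  mul_comm := pa_mul_comm
  one_mul x := by rw [pa_mul_comm, pa_mul_one]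
  mul_one := pa_mul_one
  nsmul := nsmulRec
  npow := npowRec

theorem suc_eq (x : M) : suc x = x + 1 := by
  rw [one_eq_suc_zero, pa_add_suc, pa_add_zero]

/-- Induction for definable predicates, with the successor of `x` written as `x + 1`. -/
theorem pa_induction (P : M → Prop) [Dfn (n := 1) fun _ xs => P (xs 0)]
    (h0 : P 0) (hs : ∀ x, P x → P (x + 1)) (x : M) : P x :=
  induction_dfn P h0 (fun x hx => suc_eq x ▸ hs x hx) x

/-! ### Cancellation, the linear order and strict monotonicity -/

theorem pa_add_left_cancel {x y z : M} (h : x + y = x + z) : y = z := by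
  revert h
  refine pa_induction (fun x : M => x + y = x + z → y = z) ?_ (fun x ih h => ih ?_) x
  · simp
  · refine suc_injective ?_
    rw [suc_eq, suc_eq, add_right_comm, h, add_right_comm]

theorem add_eq_zero_left {x y : M} (h : x + y = 0) : y = 0 := by
  by_contra hy
  have : ∃ z, y = z + 1 := by
    revert hy h
    refine pa_induction (fun y : M => x + y = 0 → ¬ y = 0 → ∃ z, y = z + 1) ?_ ?_ y
    · simp
    · exact fun y _ _ _ => ⟨y, rfl⟩
  obtain ⟨z, rfl⟩ := this
  rw [← add_assoc, ← suc_eq] at h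
  exact suc_ne_zero _ h

theorem pa_le_total (x y : M) : x ≤ y ∨ y ≤ x := by
  simp only [pa_le_iff]
  refine pa_induction (fun x : M => (∃ z, x + z = y) ∨ ∃ z, y + z = x) ?_ (fun x ih => ?_) x
  · exact .inl ⟨y, zero_add y⟩
  · rcases ih with ⟨z, hz⟩ | ⟨z, rfl⟩
    · have : z = 0 ∨ ∃ w, z = w + 1 :=
        pa_induction (fun z : M => z = 0 ∨ ∃ w, z = w + 1) (.inl rfl) (fun w _ => .inr ⟨w, rfl⟩) z
      rcases this with rfl | ⟨w, rfl⟩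
      · exact .inr ⟨1, by rw [← hz, add_zero]⟩
      · exact .inl ⟨w, by rw [← hz]; ring⟩
    · exact .inr ⟨z + 1, by ring⟩

open Classical in
noncomputable instance (priority := low) instLinearOrderOfPA : LinearOrder M where
  le := (· ≤ ·)
  le_refl x := (pa_le_iff x x).2 ⟨0, add_zero x⟩
  le_trans x y z := by
    simp only [pa_le_iff]
    rintro ⟨a, rfl⟩ ⟨b, rfl⟩
    exact ⟨a + b, by ring⟩
  le_antisymm x y := by
    simp only [pa_le_iff]
    rintro ⟨a, rfl⟩ ⟨b, h⟩
    rw [add_assoc] at h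
    have := pa_add_left_cancel (h.trans (add_zero x).symm)
    rw [add_comm] at this
    rw [add_eq_zero_left this, add_zero]
  le_total := pa_le_total
  toDecidableLE := Classical.decRel _

instance (priority := low) instIsOrderedCancelOfPA : IsOrderedCancelAddMonoid M where
  add_le_add_left x y h z := by
    obtain ⟨a, rfl⟩ := (pa_le_iff _ _).1 h
    exact (pa_le_iff _ _).2 ⟨a, by ring⟩
  le_of_add_le_add_left x y z h := by
    obtain ⟨a, h⟩ := (pa_le_iff _ _).1 h
    rw [add_assoc] at h
    exact (pa_le_iff _ _).2 ⟨a, pa_add_left_cancel h⟩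

instance (priority := low) instCanonicallyOrderedOfPA : CanonicallyOrderedAdd M where
  exists_add_of_le {x y} h := by
    obtain ⟨a, h⟩ := (pa_le_iff _ _).1 h
    exact ⟨a, h.symm⟩
  le_add_self x y := (pa_le_iff _ _).2 ⟨y, add_comm x y⟩
  le_self_add x y := (pa_le_iff _ _).2 ⟨y, rfl⟩

theorem pa_lt_iff (x y : M) : x < y ↔ x + 1 ≤ y := by
  constructor
  · intro h
    obtain ⟨a, rfl⟩ := exists_add_of_le h.le
    have : a = 0 ∨ ∃ w, a = w + 1 :=
      pa_induction (fun z : M => z = 0 ∨ ∃ w, z = w + 1) (.inl rfl) (fun w _ => .inr ⟨w, rfl⟩) a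
    rcases this with rfl | ⟨w, rfl⟩
    · simp at h
    · exact (pa_le_iff _ _).2 ⟨w, by ring⟩
  · intro h
    refine lt_of_lt_of_le (lt_of_le_of_ne (le_self_add) fun e => ?_) h
    have := pa_add_left_cancel ((add_zero x).trans e)
    rw [one_eq_suc_zero] at this
    exact suc_ne_zero _ this.symm

instance (priority := low) instNontrivialOfPA : Nontrivial M :=
  ⟨0, 1, fun h => suc_ne_zero (0 : M) (one_eq_suc_zero.symm.trans h.symm)⟩

theorem pa_exists_pred (x : M) : x = 0 ∨ ∃ y, x = y + 1 :=
  pa_induction (fun z : M => z = 0 ∨ ∃ w, z = w + 1) (.inl rfl) (fun w _ => .inr ⟨w, rfl⟩) x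

instance (priority := low) instIsStrictOrderedRingOfPA : IsStrictOrderedRing M :=
  { instIsOrderedCancelOfPA (M := M) with
    zero_le_one := zero_le
    exists_pair_ne := exists_pair_ne M
    mul_lt_mul_of_pos_left := by
      intro a ha b c h
      simp only [pa_lt_iff] at h ha
      obtain ⟨d, rfl⟩ := exists_add_of_le h
      obtain ⟨e, rfl⟩ := exists_add_of_le ha
      rw [pa_lt_iff, pa_le_iff]
      exact ⟨d + e * d + e, by ring⟩
    mul_lt_mul_of_pos_right := by
      intro a ha b c h
      simp only [pa_lt_iff] at h ha
      obtain ⟨d, rfl⟩ := exists_add_of_le h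
      obtain ⟨e, rfl⟩ := exists_add_of_le ha
      rw [pa_lt_iff, pa_le_iff]
      exact ⟨d + e * d + e, by ring⟩ }

theorem pa_lt_succ_iff {x y : M} : x < y + 1 ↔ x ≤ y := by
  rw [pa_lt_iff, add_le_add_iff_right]

theorem natVal_eq (n : ℕ) : (natVal n : M) = n := by
  induction n with
  | zero => simp [natVal]
  | succ n ih => simp [natVal, ih, suc_eq]

instance Dfn.le {n : ℕ} {f g : (ℕ → M → Prop) → (Fin n → M) → M} [DfnT f] [DfnT g] :
    Dfn fun Q xs => f Q xs ≤ g Q xs :=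
  Dfn.comp₂ (P := fun a b => a ≤ b)
    (Dfn.of_iff (P := fun _ xs => ∃ z, xs 0 + z = xs 1) inferInstance fun _ _ => pa_le_iff _ _)

instance Dfn.lt {n : ℕ} {f g : (ℕ → M → Prop) → (Fin n → M) → M} [DfnT f] [DfnT g] :
    Dfn fun Q xs => f Q xs < g Q xs :=
  Dfn.of_iff (P := fun Q xs => f Q xs + 1 ≤ g Q xs) inferInstance fun _ _ => pa_lt_iff _ _

/-- Strong induction for definable predicates. -/
theorem pa_strong_induction (P : M → Prop) [Dfn (n := 1) fun _ xs => P (xs 0)]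
    (h : ∀ x, (∀ y, y < x → P y) → P x) (x : M) : P x := by
  -- This local instance lets instance search apply `P` to bound variables.
  have {n : ℕ} {f : (ℕ → M → Prop) → (Fin n → M) → M} [DfnT f] : Dfn fun Q xs => P (f Q xs) :=
    Dfn.comp₁ ‹_›
  refine h x (pa_induction (fun x : M => ∀ y, y < x → P y) ?_ (fun x ih y hy => ?_) x)
  · exact fun y hy => absurd hy (by simp)
  · rcases (pa_lt_succ_iff.1 hy).lt_or_eq with h' | rfl
    exacts [ih y h', h y ih]

end Arithmetic

/-! ### Pairs and coded finite sets in models of arithmetic -/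

section Coding

variable {M : Type u} [LPA.Structure M] [PA.Model M]

/-- The pairing function. -/
noncomputable def pr (a b : M) : M := if a < b then b * b + a else a * a + a + b

theorem pr_mono_aux {m m' c : M} (h : m < m') (hc : c < (m + 1) * (m + 1)) (hc' : m' * m' ≤ c) :
    False := by
  have h1 : m + 1 ≤ m' := (pa_lt_iff _ _).1 h
  have h2 : (m + 1) * (m + 1) ≤ m' * m' := by gcongr
  exact absurd (h2.trans hc') (not_le.2 hc)

/-- The code lies between consecutive squares and hence determines the maximum of the two
components; this reduces injectivity to cancellation. -/
theorem pr_bounds (a b : M) : max a b * max a b ≤ pr a b ∧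
    pr a b < (max a b + 1) * (max a b + 1) := by
  have e (m : M) : (m + 1) * (m + 1) = m * m + m + m + 1 := by ring
  unfold pr
  rw [e]
  split_ifs with h
  · rw [max_eq_right h.le]
    have := zero_le (a := a)
    have := zero_le (a := b)
    have := zero_lt_one (α := M)
    constructor <;> grind
  · rw [not_lt] at h
    rw [max_eq_left h]
    have := zero_le (a := a)
    have := zero_le (a := b)
    have := zero_lt_one (α := M)
    constructor <;> grind

theorem pr_injective {a b a' b' : M} (h : pr a b = pr a' b') : a = a' ∧ b = b' := by
  have hm : max a b = max a' b' := by
    rcases lt_trichotomy (max a b) (max a' b') with hl | he | hl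
    · exact (pr_mono_aux hl (pr_bounds a b).2 (h ▸ (pr_bounds a' b').1)).elim
    · exact he
    · exact (pr_mono_aux hl (pr_bounds a' b').2 (h ▸ (pr_bounds a b).1)).elim
  unfold pr at h
  split_ifs at h with h1 h2 h2
  · rw [max_eq_right h1.le, max_eq_right h2.le] at hm
    subst hm
    exact ⟨add_left_cancel h, rfl⟩
  · rw [not_lt] at h2
    rw [max_eq_right h1.le, max_eq_left h2] at hm
    subst hm
    rw [add_assoc] at h
    have := add_left_cancel h
    exact absurd h1 (not_lt.2 (this ▸ le_self_add))
  · rw [not_lt] at h1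
    rw [max_eq_left h1, max_eq_right h2.le] at hm
    subst hm
    rw [add_assoc] at h
    have := add_left_cancel h
    exact absurd h2 (not_lt.2 (this ▸ le_self_add))
  · rw [not_lt] at h1 h2
    rw [max_eq_left h1, max_eq_left h2] at hm
    subst hm
    exact ⟨rfl, add_left_cancel h⟩

@[simp] theorem pr_inj {a b a' b' : M} : pr a b = pr a' b' ↔ a = a' ∧ b = b' :=
  ⟨pr_injective, fun ⟨h, h'⟩ => h ▸ h' ▸ rfl⟩

theorem le_mul_self (a : M) : a ≤ a * a := by
  rcases pa_exists_pred a with rfl | ⟨y, rfl⟩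
  · simp
  · exact (pa_le_iff _ _).2 ⟨y * y + y, by ring⟩

theorem left_le_pr (a b : M) : a ≤ pr a b :=
  (le_max_left a b).trans ((le_mul_self _).trans (pr_bounds a b).1)

theorem right_le_pr (a b : M) : b ≤ pr a b :=
  (le_max_right a b).trans ((le_mul_self _).trans (pr_bounds a b).1)

instance DfnT.pr {n : ℕ} {f g : (ℕ → M → Prop) → (Fin n → M) → M} [DfnT f] [DfnT g] :
    DfnT fun Q xs => pr (f Q xs) (g Q xs) :=
  DfnT.comp₂ (F := TruthTheories.pr) <| Dfn.of_iff (P := fun _ xs =>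
    (xs 0 < xs 1 ∧ xs 1 * xs 1 + xs 0 = xs 2) ∨
      (¬ xs 0 < xs 1 ∧ xs 0 * xs 0 + xs 0 + xs 1 = xs 2)) inferInstance fun _ xs => by
    unfold TruthTheories.pr
    split_ifs with h <;> simp [h]

/-! ### Divisibility and the coding of bounded sets -/

theorem pa_dvd_add_right {m a b : M} (h : m ∣ a + b) (ha : m ∣ a) : m ∣ b := by
  obtain ⟨u, hu⟩ := h
  obtain ⟨v, rfl⟩ := ha
  -- For lack of subtraction the quotients are compared; if `u ≤ v`, then `b = 0`.
  rcases le_total v u with hvu | hvu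
  · obtain ⟨w, rfl⟩ := exists_add_of_le hvu
    rw [mul_add] at hu
    exact ⟨w, add_left_cancel hu⟩
  · obtain ⟨w, rfl⟩ := exists_add_of_le hvu
    have h0 : m * w + b = 0 := by
      refine add_left_cancel (a := m * u) ?_
      rw [← add_assoc, ← mul_add, hu, add_zero]
    rw [(add_eq_zero.1 h0).2]
    exact dvd_zero m

instance Dfn.dvd {n : ℕ} {f g : (ℕ → M → Prop) → (Fin n → M) → M} [DfnT f] [DfnT g] :
    Dfn fun Q xs => f Q xs ∣ g Q xs :=
  Dfn.comp₂ (P := fun a b => a ∣ b) <|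
    inferInstanceAs (Dfn fun _ (xs : Fin 2 → M) => ∃ c, xs 1 = xs 0 * c)

/-- The moduli used for the coding of sets. -/
def modulus (b x : M) : M := 1 + (x + 1) * b

/-- A substitute for coprimality that avoids primes and greatest common divisors. With `d` the
distance of `x` and `y`, the products `(x + 1) * modulus b y` and `(y + 1) * modulus b x` differ by
`d`; hence `modulus b x` divides `a * d`, thus `a * b`, and finally `a`, as `a * modulus b x = (x +
1) * (a * b) + a`. -/
theorem modulus_dvd_of_dvd_mul {a b x y : M} (hxy : x ≠ y)
    (hb : ∀ d, d ≠ 0 → (x + d = y ∨ y + d = x) → d ∣ b)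
    (h : modulus b x ∣ a * modulus b y) : modulus b x ∣ a := by
  have hab : modulus b x ∣ a * b := by
    rcases lt_or_gt_of_ne hxy with hlt | hlt
    · obtain ⟨d, rfl⟩ := exists_add_of_le hlt.le
      have hd : d ∣ b := hb d (by rintro rfl; simp at hlt) (.inl rfl)
      have e : (x + 1) * (a * modulus b (x + d)) + a * d = a * (x + d + 1) * modulus b x := by
        unfold modulus; ring
      exact (pa_dvd_add_right (e ▸ dvd_mul_left _ _) (h.mul_left _)).trans (mul_dvd_mul_left a hd)
    · obtain ⟨d, rfl⟩ := exists_add_of_le hlt.le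
      have hd : d ∣ b := hb d (by rintro rfl; simp at hlt) (.inr rfl)
      have e : a * (y + 1) * modulus b (y + d) + a * d =
          (y + d + 1) * (a * modulus b y) := by
        unfold modulus; ring
      exact (pa_dvd_add_right (e ▸ h.mul_left _) (dvd_mul_left _ _)).trans (mul_dvd_mul_left a hd)
  have e : (x + 1) * (a * b) + a = a * modulus b x := by unfold modulus; ring
  exact pa_dvd_add_right (e ▸ dvd_mul_left _ _) (hab.mul_left _)

/-- Plays the role of a factorial. That `b` is not zero makes all moduli greater than `1`. -/
theorem exists_common_multiple (N : M) : ∃ b : M, b ≠ 0 ∧ ∀ d, d ≠ 0 → d < N → d ∣ b := by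
  refine pa_induction (fun N : M => ∃ b : M, b ≠ 0 ∧ ∀ d, d ≠ 0 → d < N → d ∣ b) ?_ ?_ N
  · exact ⟨1, one_ne_zero, fun d _ h => absurd h (by simp)⟩
  · rintro N ⟨b, hb, h⟩
    by_cases hN : N = 0
    · exact ⟨b, hb, fun d hd hdN => absurd (pa_lt_succ_iff.1 hdN) (by simpa [hN] using hd)⟩
    · refine ⟨b * N, mul_ne_zero hb hN, fun d hd hdN => ?_⟩
      rcases (pa_lt_succ_iff.1 hdN).lt_or_eq with h' | rfl
      exacts [(h d hd h').mul_right N, dvd_mul_left _ _]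

/-- The element `x` belongs to the finite set coded by `s`. -/
def Mem (x s : M) : Prop :=
  ∃ n a b, s = pr n (pr a b) ∧ x < n ∧ modulus b x ∣ a

instance DfnT.modulus {n : ℕ} {f g : (ℕ → M → Prop) → (Fin n → M) → M} [DfnT f] [DfnT g] :
    DfnT fun Q xs => modulus (f Q xs) (g Q xs) := by
  unfold TruthTheories.modulus; infer_instance

instance Dfn.mem {n : ℕ} {f g : (ℕ → M → Prop) → (Fin n → M) → M} [DfnT f] [DfnT g] :
    Dfn fun Q xs => Mem (f Q xs) (g Q xs) :=
  Dfn.comp₂ (P := TruthTheories.Mem) (by unfold TruthTheories.Mem; infer_instance)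

theorem Mem.lt {x s : M} (h : Mem x s) : x < s := by
  obtain ⟨n, a, b, rfl, h, -⟩ := h
  exact h.trans_le (left_le_pr _ _)

/-- Definable bounded sets are coded. -/
theorem exists_coded (P : M → Prop) [Dfn (n := 1) fun _ xs => P (xs 0)] (N : M) :
    ∃ s, ∀ x, Mem x s ↔ x < N ∧ P x := by
  have {n : ℕ} {f : (ℕ → M → Prop) → (Fin n → M) → M} [DfnT f] : Dfn fun Q xs => P (f Q xs) :=
    Dfn.comp₁ ‹_›
  obtain ⟨b, hb, hdvd⟩ := exists_common_multiple N
  -- The number `a` is in effect the product of the moduli of those `x < j` that satisfy `P`; the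
  -- same `b` serves for all `j ≤ N`. The empty product `1` is divisible by no modulus.
  have key (j : M) : j ≤ N → ∃ a : M, ∀ x, x < N → (modulus b x ∣ a ↔ x < j ∧ P x) := by
    refine pa_induction (fun j : M => j ≤ N → ∃ a : M, ∀ x, x < N →
      (modulus b x ∣ a ↔ x < j ∧ P x)) ?_ ?_ j
    · refine fun _ => ⟨1, fun x _ => iff_of_false (fun h => ?_) (by simp)⟩
      have h1 : modulus b x ≤ 1 := by
        obtain ⟨c, hc⟩ := h
        rcases pa_exists_pred c with rfl | ⟨c, rfl⟩
        · simp at hc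
        · rw [hc, mul_add, mul_one]; exact le_add_self
      have h2 : (x + 1) * b ≤ 0 := by
        refine le_of_add_le_add_left (a := (1 : M)) ?_
        rwa [add_zero]
      simp [hb] at h2
    · intro j ih hj
      have hjN : j < N := (pa_lt_iff _ _).2 hj
      obtain ⟨a, ha⟩ := ih hjN.le
      have other (x : M) (hx : x < N) (hxj : x ≠ j) :
          modulus b x ∣ a * modulus b j ↔ modulus b x ∣ a := by
        refine ⟨modulus_dvd_of_dvd_mul hxj fun d hd h => hdvd d hd ?_, fun h => h.mul_right _⟩
        rcases h with rfl | rfl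
        · exact le_add_self.trans_lt hjN
        · exact le_add_self.trans_lt hx
      by_cases hP : P j
      · refine ⟨a * modulus b j, fun x hx => ?_⟩
        by_cases hxj : x = j
        · subst hxj
          exact iff_of_true (dvd_mul_left _ _) ⟨pa_lt_succ_iff.2 le_rfl, hP⟩
        · rw [other x hx hxj, ha x hx, pa_lt_succ_iff, le_iff_lt_or_eq, or_iff_left hxj]
      · refine ⟨a, fun x hx => ?_⟩
        rw [ha x hx, pa_lt_succ_iff, le_iff_lt_or_eq]
        by_cases hxj : x = j
        · subst hxj; simp [hP]
        · simp [hxj]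
  obtain ⟨a, ha⟩ := key N le_rfl
  refine ⟨pr N (pr a b), fun x => ⟨?_, fun ⟨hx, hP⟩ => ⟨N, a, b, rfl, hx, (ha x hx).2 ⟨hx, hP⟩⟩⟩⟩
  rintro ⟨n, a', b', h, hx, hd⟩
  simp only [pr_inj] at h
  obtain ⟨rfl, rfl, rfl⟩ := h
  exact ⟨hx, ((ha x hx).1 hd).2⟩

theorem exists_union_insert (s t x : M) : ∃ u, ∀ y, Mem y u ↔ Mem y s ∨ Mem y t ∨ y = x := by
  obtain ⟨u, hu⟩ := exists_coded (fun y => Mem y s ∨ Mem y t ∨ y = x) (s + t + x + 1)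
  refine ⟨u, fun y => (hu y).trans (and_iff_right_of_imp ?_)⟩
  rintro (h | h | rfl)
  · have := h.lt
    rw [pa_lt_succ_iff, add_assoc]
    exact this.le.trans le_self_add
  · have := h.lt
    rw [pa_lt_succ_iff, add_right_comm]
    exact this.le.trans le_add_self
  · rw [pa_lt_succ_iff]; exact le_add_self

/-- The least predicate generated by the clause `C` in the way of the arithmetized recursive
notions: witnesses are coded sets. -/
def Gen {ι : Type*} (enc : ι → M) (C : (ι → Prop) → ι → Prop) (i : ι) : Prop :=
  ∃ w, Mem (enc i) w ∧ ∀ j, Mem (enc j) w → C (fun k => Mem (enc k) w) j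

theorem Gen.cases {ι : Type*} {enc : ι → M} {C : (ι → Prop) → ι → Prop}
    (mono : ∀ X Y : ι → Prop, (∀ i, X i → Y i) → ∀ i, C X i → C Y i) {i : ι} (h : Gen enc C i) :
    C (Gen enc C) i := by
  obtain ⟨w, hi, hw⟩ := h
  exact mono _ _ (fun j hj => ⟨w, hj, hw⟩) _ (hw i hi)

theorem Gen.intro₀ {ι : Type*} {enc : ι → M} (inj : Function.Injective enc)
    {C : (ι → Prop) → ι → Prop}
    (mono : ∀ X Y : ι → Prop, (∀ i, X i → Y i) → ∀ i, C X i → C Y i) {i : ι}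
    (h : C (fun _ => False) i) : Gen enc C i := by
  obtain ⟨w, hw⟩ := exists_coded (fun y => y = enc i) (enc i + 1)
  refine ⟨w, (hw _).2 ⟨pa_lt_succ_iff.2 le_rfl, rfl⟩, fun j hj => ?_⟩
  rw [inj ((hw _).1 hj).2]
  exact mono _ _ (fun _ h => h.elim) _ h

/-- The witnesses for `a` and `b` are united and the code of `i` is added; by monotonicity, the
clauses verified in the old witnesses persist. -/
theorem Gen.intro₂ {ι : Type*} {enc : ι → M} (inj : Function.Injective enc)
    {C : (ι → Prop) → ι → Prop}
    (mono : ∀ X Y : ι → Prop, (∀ i, X i → Y i) → ∀ i, C X i → C Y i) {i a b : ι}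
    (ha : Gen enc C a) (hb : Gen enc C b) (h : C (fun k => k = a ∨ k = b) i) : Gen enc C i := by
  obtain ⟨w, haw, hw⟩ := ha
  obtain ⟨w', hbw, hw'⟩ := hb
  obtain ⟨u, hu⟩ := exists_union_insert w w' (enc i)
  refine ⟨u, (hu _).2 (.inr (.inr rfl)), fun j hj => ?_⟩
  rcases (hu _).1 hj with hj | hj | hj
  · exact mono _ _ (fun k hk => (hu _).2 (.inl hk)) _ (hw j hj)
  · exact mono _ _ (fun k hk => (hu _).2 (.inr (.inl hk))) _ (hw' j hj)
  · rw [inj hj]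
    refine mono _ _ (fun k hk => (hu _).2 ?_) _ h
    rcases hk with rfl | rfl
    exacts [.inl haw, .inr (.inl hbw)]

end Coding

/-! ### The arithmetized syntax in a model -/

section Syntactic

variable {M : Type u} [LPA.Structure M] [PA.Model M]

/-- The code with outermost symbol `k` and components `a`, `b`, in a model. -/
noncomputable def nd (k : ℕ) (a b : M) : M := pr (k : M) (pr a b) + 1

@[simp] theorem nd_inj {k k' : ℕ} {a b a' b' : M} :
    nd k a b = nd k' a' b' ↔ k = k' ∧ a = a' ∧ b = b' := by
  simp [nd]

theorem left_lt_nd (k : ℕ) (a b : M) : a < nd k a b :=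
  pa_lt_succ_iff.2 ((left_le_pr a b).trans (right_le_pr _ _))

theorem right_lt_nd (k : ℕ) (a b : M) : b < nd k a b :=
  pa_lt_succ_iff.2 ((right_le_pr a b).trans (right_le_pr _ _))

instance DfnT.nd {n k : ℕ} {f g : (ℕ → M → Prop) → (Fin n → M) → M} [DfnT f] [DfnT g] :
    DfnT fun Q xs => nd k (f Q xs) (g Q xs) := by
  unfold TruthTheories.nd; infer_instance

/-- The pair `⟨x, y⟩`, as a function of an element of the product. -/
noncomputable def prod (p : M × M) : M := pr p.1 p.2

theorem prod_injective : Function.Injective (prod : M × M → M) := by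
  rintro ⟨a, b⟩ ⟨a', b'⟩ h
  simpa [prod] using h

/-- In this and the following clauses, `X` stands for membership in the witness. Order and
bracketing follow the formulas of the arithmetization, so that `simp` can match their realizations
with `Gen`. -/
def clTermC (X : M → Prop) (x : M) : Prop :=
  x = nd 1 0 0 ∨ x = nd 2 0 0 ∨ (∃ a, X a ∧ x = nd 3 a 0) ∨
    ∃ a b, (X a ∧ X b) ∧ (x = nd 4 a b ∨ x = nd 5 a b)

def termC (X : M → Prop) (x : M) : Prop :=
  (∃ i, x = nd 0 i 0) ∨ x = nd 1 0 0 ∨ x = nd 2 0 0 ∨ (∃ a, X a ∧ x = nd 3 a 0) ∨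
    ∃ a b, (X a ∧ X b) ∧ (x = nd 4 a b ∨ x = nd 5 a b)

def valC (X : M × M → Prop) (p : M × M) : Prop :=
  (p.1 = nd 1 0 0 ∧ p.2 = 0) ∨ (p.1 = nd 2 0 0 ∧ p.2 = 1) ∨
    (∃ a a', (X (a, a') ∧ p.1 = nd 3 a 0) ∧ p.2 = a' + 1) ∨
    ∃ a a' b b', (X (a, a') ∧ X (b, b')) ∧
      ((p.1 = nd 4 a b ∧ p.2 = a' + b') ∨ (p.1 = nd 5 a b ∧ p.2 = a' * b'))

def occursC (i : M) (X : M → Prop) (x : M) : Prop :=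
  x = nd 0 i 0 ∨ (∃ a, X a ∧ x = nd 3 a 0) ∨
    ∃ a b, (X a ∨ X b) ∧ (x = nd 4 a b ∨ x = nd 5 a b)

def termSubstC (i t : M) (X : M × M → Prop) (p : M × M) : Prop :=
  (p.1 = nd 0 i 0 ∧ p.2 = t) ∨ (∃ j, (j ≠ i ∧ p.1 = nd 0 j 0) ∧ p.2 = p.1) ∨
    (p.1 = nd 1 0 0 ∧ p.2 = p.1) ∨ (p.1 = nd 2 0 0 ∧ p.2 = p.1) ∨
    (∃ a a', (X (a, a') ∧ p.1 = nd 3 a 0) ∧ p.2 = nd 3 a' 0) ∨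
    ∃ a a' b b', (X (a, a') ∧ X (b, b')) ∧
      ((p.1 = nd 4 a b ∧ p.2 = nd 4 a' b') ∨ (p.1 = nd 5 a b ∧ p.2 = nd 5 a' b'))

/-- `x` is a closed term. -/
def ClTerm : M → Prop := Gen id clTermC
/-- `x` is a term. -/
def IsTerm : M → Prop := Gen id termC
/-- The closed term `x` has the value `y`. -/
def Val (x y : M) : Prop := Gen prod valC (x, y)
/-- The variable `v_i` occurs in the term `x`. -/
def Occurs (i : M) : M → Prop := Gen id (occursC i)
/-- The result of replacing `v_i` by `t` in the term `x` is `y`. -/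
def TermSubst (x i t y : M) : Prop := Gen prod (termSubstC i t) (x, y)

def formC (X : M → Prop) (x : M) : Prop :=
  (∃ a b, (IsTerm a ∧ IsTerm b) ∧ (x = nd 6 a b ∨ x = nd 7 a b)) ∨
    (∃ a, X a ∧ x = nd 8 a 0) ∨ (∃ a b, (X a ∧ X b) ∧ (x = nd 9 a b ∨ x = nd 10 a b)) ∨
    ∃ i a, X a ∧ (x = nd 11 i a ∨ x = nd 12 i a)

def freeC (i : M) (X : M → Prop) (x : M) : Prop :=
  (∃ a b, (Occurs i a ∨ Occurs i b) ∧ (x = nd 6 a b ∨ x = nd 7 a b)) ∨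
    (∃ a, X a ∧ x = nd 8 a 0) ∨ (∃ a b, (X a ∨ X b) ∧ (x = nd 9 a b ∨ x = nd 10 a b)) ∨
    ∃ j a, (j ≠ i ∧ X a) ∧ (x = nd 11 j a ∨ x = nd 12 j a)

def substC (i t : M) (X : M × M → Prop) (p : M × M) : Prop :=
  (∃ a a' b b', (TermSubst a i t a' ∧ TermSubst b i t b') ∧
      ((p.1 = nd 6 a b ∧ p.2 = nd 6 a' b') ∨ (p.1 = nd 7 a b ∧ p.2 = nd 7 a' b'))) ∨
    (∃ a a', (X (a, a') ∧ p.1 = nd 8 a 0) ∧ p.2 = nd 8 a' 0) ∨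
    (∃ a a' b b', (X (a, a') ∧ X (b, b')) ∧
      ((p.1 = nd 9 a b ∧ p.2 = nd 9 a' b') ∨ (p.1 = nd 10 a b ∧ p.2 = nd 10 a' b'))) ∨
    (∃ a, (p.1 = nd 11 i a ∨ p.1 = nd 12 i a) ∧ p.2 = p.1) ∨
    ∃ j a a', (j ≠ i ∧ X (a, a')) ∧
      ((p.1 = nd 11 j a ∧ p.2 = nd 11 j a') ∨ (p.1 = nd 12 j a ∧ p.2 = nd 12 j a'))

/-- `x` is a formula. -/
def IsForm : M → Prop := Gen id formC
/-- The variable `v_i` occurs free in the formula `x`. -/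
def Free (i : M) : M → Prop := Gen id (freeC i)
/-- The result of replacing the free occurrences of `v_i` by `t` in the formula `x` is `y`. -/
def Subst (x i t y : M) : Prop := Gen prod (substC i t) (x, y)
/-- `x` is a sentence. -/
def Sent (x : M) : Prop := IsForm x ∧ ∀ i, ¬ Free i x

/-! #### The formulas of the arithmetization define these notions -/

@[simp] theorem realize_pairF (v : Fin 3 → M) : pairF.Realize v ↔ v 2 = pr (v 0) (v 1) := by
  rw [Formula.Realize, pairF]
  simp only [BoundedFormula.realize_sup, BoundedFormula.realize_inf, ltF, realize_leF,
    BoundedFormula.realize_bdEqual, realize_addT, realize_mulT, realize_succT, suc_eq,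
    Term.realize_var, Sum.elim_inl, ← pa_lt_iff]
  unfold pr
  split_ifs with h <;> simp [h, ← not_lt]

@[simp] theorem realize_memF (v : Fin 2 → M) : memF.Realize v ↔ Mem (v 0) (v 1) := by
  rw [Formula.Realize, memF]
  simp [realize_plug, ltF, Fin.snoc, suc_eq, pa_lt_iff, Mem, dvd_def, modulus, mul_comm,
    add_comm]

@[simp] theorem realize_pairMemF (v : Fin 3 → M) :
    pairMemF.Realize v ↔ Mem (pr (v 0) (v 1)) (v 2) := by
  rw [Formula.Realize, pairMemF]
  simp [realize_plug, Fin.snoc]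

@[simp] theorem realize_nodeF (k : ℕ) (v : Fin 3 → M) :
    (nodeF k).Realize v ↔ v 2 = nd k (v 0) (v 1) := by
  rw [Formula.Realize, nodeF]
  simp [realize_plug, Fin.snoc, suc_eq, natVal_eq, nd]

@[simp] theorem realize_clTermF (v : Fin 1 → M) : clTermF.Realize v ↔ ClTerm (v 0) := by
  rw [Formula.Realize, clTermF]
  simp [realize_plug, Fin.snoc, ClTerm, Gen, clTermC, or_assoc]

@[simp] theorem realize_termF (v : Fin 1 → M) : termF.Realize v ↔ IsTerm (v 0) := by
  rw [Formula.Realize, termF]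
  simp [realize_plug, Fin.snoc, IsTerm, Gen, termC, or_assoc]

@[simp] theorem realize_valF (v : Fin 2 → M) : valF.Realize v ↔ Val (v 0) (v 1) := by
  rw [Formula.Realize, valF]
  simp [realize_plug, Fin.snoc, Val, Gen, valC, or_assoc, prod, suc_eq]

@[simp] theorem realize_occursF (v : Fin 2 → M) : occursF.Realize v ↔ Occurs (v 0) (v 1) := by
  rw [Formula.Realize, occursF]
  simp [realize_plug, Fin.snoc, Occurs, Gen, occursC, or_assoc]

@[simp] theorem realize_termSubstF (v : Fin 4 → M) :
    termSubstF.Realize v ↔ TermSubst (v 0) (v 1) (v 2) (v 3) := by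
  rw [Formula.Realize, termSubstF]
  simp [realize_plug, Fin.snoc, TermSubst, Gen, termSubstC, or_assoc, prod]

@[simp] theorem realize_formF (v : Fin 1 → M) : formF.Realize v ↔ IsForm (v 0) := by
  rw [Formula.Realize, formF]
  simp [realize_plug, Fin.snoc, IsForm, Gen, formC, or_assoc]

@[simp] theorem realize_freeF (v : Fin 2 → M) : freeF.Realize v ↔ Free (v 0) (v 1) := by
  rw [Formula.Realize, freeF]
  simp [realize_plug, Fin.snoc, Free, Gen, freeC, or_assoc]

@[simp] theorem realize_sentF (v : Fin 1 → M) : sentF.Realize v ↔ Sent (v 0) := by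
  rw [Formula.Realize, sentF]
  simp [realize_plug, Fin.snoc, Sent]

@[simp] theorem realize_substF (v : Fin 4 → M) :
    substF.Realize v ↔ Subst (v 0) (v 1) (v 2) (v 3) := by
  rw [Formula.Realize, substF]
  simp [realize_plug, Fin.snoc, Subst, Gen, substC, or_assoc, prod]

end Syntactic

section SyntacticLemmas

variable {M : Type u} [LPA.Structure M] [PA.Model M]

/-! #### First-order formulas define definable predicates -/

theorem dfnT_realize_term {α : Type*} {m : ℕ} (t : LPAT.Term α)
    (f : α → (ℕ → M → Prop) → (Fin m → M) → M) (hf : ∀ i, DfnT (f i)) :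
    DfnT fun (Q : ℕ → M → Prop) (xs : Fin m → M) =>
      letI := truthStructure {x | Q 0 x}
      t.realize fun i => f i Q xs := by
  induction t with
  | var i => exact hf i
  | @func l f ts ih =>
    rcases f with f | f
    · cases f with
      | zero =>
        refine cast (congrArg DfnT ?_) (DfnT.const (n := m) (0 : M))
        funext Q xs
        exact congrArg (Structure.funMap (L := LPA) PAFunc.zero) (Subsingleton.elim _ _)
      | one =>
        refine cast (congrArg DfnT ?_) (DfnT.const (n := m) (1 : M))
        funext Q xs
        exact congrArg (Structure.funMap (L := LPA) PAFunc.one) (Subsingleton.elim _ _)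
      | succ =>
        refine cast (congrArg DfnT ?_) (@DfnT.suc M _ _ m _ (ih 0))
        funext Q xs
        refine congrArg (Structure.funMap (L := LPA) PAFunc.succ) (funext fun i => ?_)
        fin_cases i; rfl
      | add =>
        refine cast (congrArg DfnT ?_) (@DfnT.add M _ m _ _ (ih 0) (ih 1))
        funext Q xs
        refine congrArg (Structure.funMap (L := LPA) PAFunc.add) (funext fun i => ?_)
        fin_cases i <;> rfl
      | mul =>
        refine cast (congrArg DfnT ?_) (@DfnT.mul M _ m _ _ (ih 0) (ih 1))
        funext Q xs
        refine congrArg (Structure.funMap (L := LPA) PAFunc.mul) (funext fun i => ?_)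
        fin_cases i <;> rfl
    · exact f.elim

/-- Formulas with a truth predicate define definable predicates. -/
theorem dfn_realize {α : Type*} {n : ℕ} (φ : LPAT.BoundedFormula α n) :
    ∀ {m : ℕ} (f : α ⊕ Fin n → (ℕ → M → Prop) → (Fin m → M) → M), (∀ i, DfnT (f i)) →
    Dfn fun (Q : ℕ → M → Prop) (xs : Fin m → M) =>
      letI := truthStructure {x | Q 0 x}
      φ.Realize (fun i => f (.inl i) Q xs) fun i => f (.inr i) Q xs := by
  have elim {n m : ℕ} (f : α ⊕ Fin n → (ℕ → M → Prop) → (Fin m → M) → M) (Q xs) :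
      (Sum.elim (fun i => f (.inl i) Q xs) fun i => f (.inr i) Q xs) = fun i => f i Q xs := by
    funext i; cases i <;> rfl
  induction φ with
  | falsum => exact fun f hf => Dfn.false
  | equal s t =>
    intro m f hf
    have := dfnT_realize_term (M := M) s f hf
    have := dfnT_realize_term (M := M) t f hf
    simp only [BoundedFormula.Realize, elim]
    exact Dfn.equal
  | @rel n l R ts =>
    intro m f hf
    have hts := fun i => dfnT_realize_term (M := M) (ts i) f hf
    simp only [BoundedFormula.Realize, elim]
    rcases R with R | R
    · cases R with
      | le =>
        refine Dfn.of_iff (@Dfn.le M _ _ m _ _ (hts 0) (hts 1)) fun Q xs => ?_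
        refine iff_of_eq (congrArg (Structure.RelMap (L := LPA) PARel.le) (funext fun i => ?_))
        fin_cases i <;> rfl
    · cases R with
      | truth =>
        have := hts 0
        exact Dfn.hole 0
  | imp _ _ ih ih' =>
    intro m f hf
    have := ih f hf
    have := ih' f hf
    exact Dfn.imp
  | @all n φ ih =>
    intro m f hf
    have := ih (Sum.elim (fun i Q ys => f (.inl i) Q fun j => ys j.castSucc)
      (Fin.snoc (α := fun _ => (ℕ → M → Prop) → (Fin (m + 1) → M) → M)
        (fun i Q ys => f (.inr i) Q fun j => ys j.castSucc) fun Q ys => ys (Fin.last m))) ?_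
    · refine Dfn.of_iff (Dfn.forall (P := fun Q xs y =>
        letI := truthStructure {x | Q 0 x}
        φ.Realize (fun i => f (.inl i) Q xs) (Fin.snoc (fun i => f (.inr i) Q xs) y)) (h := ?_))
        fun Q xs => ?_
      · refine Dfn.of_iff this fun Q ys => ?_
        let _ := truthStructure {x | Q 0 x}
        refine iff_of_eq (congrArg (φ.Realize fun i => f (.inl i) Q fun j => ys j.castSucc)
          (funext fun i => ?_))
        refine Fin.lastCases ?_ (fun i => ?_) i <;> simp
      · let _ := truthStructure {x | Q 0 x}
        exact BoundedFormula.realize_all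
    · rintro (i | i)
      · exact (hf (.inl i)).weaken
      · refine Fin.lastCases ?_ (fun i => ?_) i
        · simpa using DfnT.var (M := M) (Fin.last m)
        · simpa using (hf (.inr i)).weaken

/-- Reading the formula in the language with `T` does not change its meaning. All arithmetized
notions become definable predicates in this way, via the formulas that realize them. -/
theorem dfn_formula {k : ℕ} (φ : LPA.Formula (Fin k)) :
    Dfn fun (_ : ℕ → M → Prop) xs => φ.Realize xs := by
  refine Dfn.of_iff (dfn_realize (M := M) (incl.onFormula φ)
    (Sum.elim (fun i _ xs => xs i) fun i => i.elim0)
    (by rintro (i | i); exacts [DfnT.var i, i.elim0])) fun Q xs => ?_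
  let _ := truthStructure {x | Q 0 x}
  rw [← LHom.realize_onFormula (φ := incl) φ]
  exact iff_of_eq (congrArg (BoundedFormula.Realize _ xs) (Subsingleton.elim _ _))

variable {n : ℕ} {f g k l : (ℕ → M → Prop) → (Fin n → M) → M} [DfnT f] [DfnT g] [DfnT k] [DfnT l]

instance Dfn.clTerm : Dfn fun Q xs => ClTerm (f Q xs) :=
  Dfn.comp₁ (Dfn.of_iff (dfn_formula clTermF) fun _ _ => by simp)

instance Dfn.isTerm : Dfn fun Q xs => IsTerm (f Q xs) :=
  Dfn.comp₁ (Dfn.of_iff (dfn_formula termF) fun _ _ => by simp)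

instance Dfn.isForm : Dfn fun Q xs => IsForm (f Q xs) :=
  Dfn.comp₁ (Dfn.of_iff (dfn_formula formF) fun _ _ => by simp)

instance Dfn.sent : Dfn fun Q xs => Sent (f Q xs) :=
  Dfn.comp₁ (Dfn.of_iff (dfn_formula sentF) fun _ _ => by simp)

instance Dfn.val : Dfn fun Q xs => Val (f Q xs) (g Q xs) :=
  Dfn.comp₂ (Dfn.of_iff (dfn_formula valF) fun _ _ => by simp)

instance Dfn.occurs : Dfn fun Q xs => Occurs (f Q xs) (g Q xs) :=
  Dfn.comp₂ (Dfn.of_iff (dfn_formula occursF) fun _ _ => by simp)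

instance Dfn.free : Dfn fun Q xs => Free (f Q xs) (g Q xs) :=
  Dfn.comp₂ (Dfn.of_iff (dfn_formula freeF) fun _ _ => by simp)

instance Dfn.termSubst : Dfn fun Q xs => TermSubst (f Q xs) (g Q xs) (k Q xs) (l Q xs) :=
  Dfn.comp₄ (Dfn.of_iff (dfn_formula termSubstF) fun _ _ => by simp)

instance Dfn.subst : Dfn fun Q xs => Subst (f Q xs) (g Q xs) (k Q xs) (l Q xs) :=
  Dfn.comp₄ (Dfn.of_iff (dfn_formula substF) fun _ _ => by simp)

/-! #### Recursive clauses -/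

/-- A clause is finitary if it is monotone and each of its instances depends on at most two
elements. -/
structure Finitary {ι : Type*} (C : (ι → Prop) → ι → Prop) : Prop where
  mono : ∀ X Y : ι → Prop, (∀ i, X i → Y i) → ∀ i, C X i → C Y i
  fin : ∀ (X : ι → Prop) (i : ι), C X i →
    C (fun _ => False) i ∨ ∃ a b, X a ∧ X b ∧ C (fun k => k = a ∨ k = b) i

/-- Unfolding needs monotonicity only. Conversely, an instance of the clause depends on at most two
elements, so that only two witnesses have to be united. -/
theorem Finitary.gen_iff {ι : Type*} {enc : ι → M} (inj : Function.Injective enc)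
    {C : (ι → Prop) → ι → Prop} (hC : Finitary C) (i : ι) : Gen enc C i ↔ C (Gen enc C) i := by
  refine ⟨Gen.cases hC.mono, fun h => ?_⟩
  rcases hC.fin _ _ h with h | ⟨a, b, ha, hb, h⟩
  exacts [Gen.intro₀ inj hC.mono h, Gen.intro₂ inj hC.mono ha hb h]

theorem finitary_clTermC : Finitary (clTermC (M := M)) where
  mono X Y h i := by unfold clTermC; grind
  fin X i := by unfold clTermC; grind

theorem finitary_termC : Finitary (termC (M := M)) where
  mono X Y h i := by unfold termC; grind
  fin X i := by unfold termC; grind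

theorem finitary_valC : Finitary (valC (M := M)) where
  mono X Y h i := by unfold valC; grind
  fin X i := by unfold valC; grind

theorem finitary_occursC (i : M) : Finitary (occursC i) where
  mono X Y h i := by unfold occursC; grind
  fin X i := by unfold occursC; grind

theorem finitary_termSubstC (i t : M) : Finitary (termSubstC i t) where
  mono X Y h i := by unfold termSubstC; grind
  fin X i := by unfold termSubstC; grind

theorem finitary_formC : Finitary (formC (M := M)) where
  mono X Y h i := by unfold formC; grind
  fin X i := by unfold formC; grind

theorem finitary_freeC (i : M) : Finitary (freeC i) where
  mono X Y h x := by
    rintro (h1 | ⟨a, ha, e⟩ | ⟨a, b, ha, e⟩ | ⟨j, a, ⟨hj, ha⟩, e⟩)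
    exacts [.inl h1, .inr (.inl ⟨a, h _ ha, e⟩),
      .inr (.inr (.inl ⟨a, b, ha.imp (h _) (h _), e⟩)),
      .inr (.inr (.inr ⟨j, a, ⟨hj, h _ ha⟩, e⟩))]
  fin X x := by
    rintro (h1 | ⟨a, ha, e⟩ | ⟨a, b, ha | ha, e⟩ | ⟨j, a, ⟨hj, ha⟩, e⟩)
    exacts [.inl (.inl h1), .inr ⟨a, a, ha, ha, .inr (.inl ⟨a, .inl rfl, e⟩)⟩,
      .inr ⟨a, a, ha, ha, .inr (.inr (.inl ⟨a, b, .inl (.inl rfl), e⟩))⟩,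
      .inr ⟨b, b, ha, ha, .inr (.inr (.inl ⟨a, b, .inr (.inl rfl), e⟩))⟩,
      .inr ⟨a, a, ha, ha, .inr (.inr (.inr ⟨j, a, ⟨hj, .inl rfl⟩, e⟩))⟩]

theorem finitary_substC (i t : M) : Finitary (substC i t) where
  mono X Y h x := by
    rintro (h1 | ⟨a, a', ⟨ha, e⟩, e'⟩ | ⟨a, a', b, b', ⟨ha, hb⟩, e⟩ | h1 |
      ⟨j, a, a', ⟨hj, ha⟩, e⟩)
    exacts [.inl h1, .inr (.inl ⟨a, a', ⟨h _ ha, e⟩, e'⟩),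
      .inr (.inr (.inl ⟨a, a', b, b', ⟨h _ ha, h _ hb⟩, e⟩)), .inr (.inr (.inr (.inl h1))),
      .inr (.inr (.inr (.inr ⟨j, a, a', ⟨hj, h _ ha⟩, e⟩)))]
  fin X x := by
    rintro (h1 | ⟨a, a', ⟨ha, e⟩, e'⟩ | ⟨a, a', b, b', ⟨ha, hb⟩, e⟩ | h1 |
      ⟨j, a, a', ⟨hj, ha⟩, e⟩)
    exacts [.inl (.inl h1), .inr ⟨_, _, ha, ha, .inr (.inl ⟨a, a', ⟨.inl rfl, e⟩, e'⟩)⟩,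
      .inr ⟨_, _, ha, hb, .inr (.inr (.inl ⟨a, a', b, b', ⟨.inl rfl, .inr rfl⟩, e⟩))⟩,
      .inl (.inr (.inr (.inr (.inl h1)))),
      .inr ⟨_, _, ha, ha, .inr (.inr (.inr (.inr ⟨j, a, a', ⟨hj, .inl rfl⟩, e⟩)))⟩]

theorem clTerm_iff {x : M} : ClTerm x ↔ clTermC ClTerm x :=
  finitary_clTermC.gen_iff Function.injective_id x
theorem isTerm_iff {x : M} : IsTerm x ↔ termC IsTerm x :=
  finitary_termC.gen_iff Function.injective_id x
theorem val_iff {x y : M} : Val x y ↔ valC (fun p => Val p.1 p.2) (x, y) :=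
  finitary_valC.gen_iff prod_injective (x, y)
theorem occurs_iff {i x : M} : Occurs i x ↔ occursC i (Occurs i) x :=
  (finitary_occursC i).gen_iff Function.injective_id x
theorem termSubst_iff {i t x y : M} :
    TermSubst x i t y ↔ termSubstC i t (fun p => TermSubst p.1 i t p.2) (x, y) :=
  (finitary_termSubstC i t).gen_iff prod_injective (x, y)
theorem isForm_iff {x : M} : IsForm x ↔ formC IsForm x :=
  finitary_formC.gen_iff Function.injective_id x
theorem free_iff {i x : M} : Free i x ↔ freeC i (Free i) x :=
  (finitary_freeC i).gen_iff Function.injective_id x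
theorem subst_iff {i t x y : M} :
    Subst x i t y ↔ substC i t (fun p => Subst p.1 i t p.2) (x, y) :=
  (finitary_substC i t).gen_iff prod_injective (x, y)

section Nodes

variable {a b i j t y : M}

@[simp] theorem clTerm_zero : ClTerm (nd 1 0 0 : M) := by rw [clTerm_iff]; simp [clTermC]
@[simp] theorem clTerm_one : ClTerm (nd 2 0 0 : M) := by rw [clTerm_iff]; simp [clTermC]
@[simp] theorem clTerm_suc : ClTerm (nd 3 a 0) ↔ ClTerm a := by rw [clTerm_iff]; simp [clTermC]
@[simp] theorem clTerm_add : ClTerm (nd 4 a b) ↔ ClTerm a ∧ ClTerm b := by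
  rw [clTerm_iff]; simp [clTermC]
@[simp] theorem clTerm_mul : ClTerm (nd 5 a b) ↔ ClTerm a ∧ ClTerm b := by
  rw [clTerm_iff]; simp [clTermC]

@[simp] theorem isTerm_var : IsTerm (nd 0 i 0 : M) := by rw [isTerm_iff]; simp [termC]
@[simp] theorem isTerm_zero : IsTerm (nd 1 0 0 : M) := by rw [isTerm_iff]; simp [termC]
@[simp] theorem isTerm_one : IsTerm (nd 2 0 0 : M) := by rw [isTerm_iff]; simp [termC]
@[simp] theorem isTerm_suc : IsTerm (nd 3 a 0) ↔ IsTerm a := by rw [isTerm_iff]; simp [termC]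
@[simp] theorem isTerm_add : IsTerm (nd 4 a b) ↔ IsTerm a ∧ IsTerm b := by
  rw [isTerm_iff]; simp [termC]
@[simp] theorem isTerm_mul : IsTerm (nd 5 a b) ↔ IsTerm a ∧ IsTerm b := by
  rw [isTerm_iff]; simp [termC]

@[simp] theorem val_zero : Val (nd 1 0 0) y ↔ y = 0 := by rw [val_iff]; simp [valC]
@[simp] theorem val_one : Val (nd 2 0 0) y ↔ y = 1 := by rw [val_iff]; simp [valC]
@[simp] theorem val_suc : Val (nd 3 a 0) y ↔ ∃ a', Val a a' ∧ y = a' + 1 := by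
  rw [val_iff]; simp [valC]
@[simp] theorem val_add : Val (nd 4 a b) y ↔ ∃ a' b', Val a a' ∧ Val b b' ∧ y = a' + b' := by
  rw [val_iff]; simp [valC, and_assoc]
@[simp] theorem val_mul : Val (nd 5 a b) y ↔ ∃ a' b', Val a a' ∧ Val b b' ∧ y = a' * b' := by
  rw [val_iff]; simp [valC, and_assoc]

@[simp] theorem occurs_var : Occurs i (nd 0 j 0) ↔ j = i := by rw [occurs_iff]; simp [occursC]
@[simp] theorem occurs_zero : ¬ Occurs i (nd 1 0 0 : M) := by rw [occurs_iff]; simp [occursC]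
@[simp] theorem occurs_one : ¬ Occurs i (nd 2 0 0 : M) := by rw [occurs_iff]; simp [occursC]
@[simp] theorem occurs_suc : Occurs i (nd 3 a 0) ↔ Occurs i a := by
  rw [occurs_iff]; simp [occursC]
@[simp] theorem occurs_add : Occurs i (nd 4 a b) ↔ Occurs i a ∨ Occurs i b := by
  rw [occurs_iff]; simp [occursC]
@[simp] theorem occurs_mul : Occurs i (nd 5 a b) ↔ Occurs i a ∨ Occurs i b := by
  rw [occurs_iff]; simp [occursC]

@[simp] theorem termSubst_var : TermSubst (nd 0 j 0) i t y ↔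
    (j = i ∧ y = t) ∨ (j ≠ i ∧ y = nd 0 j 0) := by
  rw [termSubst_iff]; simp [termSubstC]
@[simp] theorem termSubst_zero : TermSubst (nd 1 0 0) i t y ↔ y = nd 1 0 0 := by
  rw [termSubst_iff]; simp [termSubstC]
@[simp] theorem termSubst_one : TermSubst (nd 2 0 0) i t y ↔ y = nd 2 0 0 := by
  rw [termSubst_iff]; simp [termSubstC]
@[simp] theorem termSubst_suc : TermSubst (nd 3 a 0) i t y ↔
    ∃ a', TermSubst a i t a' ∧ y = nd 3 a' 0 := by
  rw [termSubst_iff]; simp [termSubstC]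
@[simp] theorem termSubst_add : TermSubst (nd 4 a b) i t y ↔
    ∃ a' b', TermSubst a i t a' ∧ TermSubst b i t b' ∧ y = nd 4 a' b' := by
  rw [termSubst_iff]; simp [termSubstC, and_assoc]
@[simp] theorem termSubst_mul : TermSubst (nd 5 a b) i t y ↔
    ∃ a' b', TermSubst a i t a' ∧ TermSubst b i t b' ∧ y = nd 5 a' b' := by
  rw [termSubst_iff]; simp [termSubstC, and_assoc]

@[simp] theorem isForm_eq : IsForm (nd 6 a b) ↔ IsTerm a ∧ IsTerm b := by
  rw [isForm_iff]; simp [formC]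
@[simp] theorem isForm_le : IsForm (nd 7 a b) ↔ IsTerm a ∧ IsTerm b := by
  rw [isForm_iff]; simp [formC]
@[simp] theorem isForm_neg : IsForm (nd 8 a 0) ↔ IsForm a := by rw [isForm_iff]; simp [formC]
@[simp] theorem isForm_and : IsForm (nd 9 a b) ↔ IsForm a ∧ IsForm b := by
  rw [isForm_iff]; simp [formC]
@[simp] theorem isForm_or : IsForm (nd 10 a b) ↔ IsForm a ∧ IsForm b := by
  rw [isForm_iff]; simp [formC]
@[simp] theorem isForm_all : IsForm (nd 11 i a) ↔ IsForm a := by rw [isForm_iff]; simp [formC]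
@[simp] theorem isForm_ex : IsForm (nd 12 i a) ↔ IsForm a := by rw [isForm_iff]; simp [formC]

@[simp] theorem free_eq : Free i (nd 6 a b) ↔ Occurs i a ∨ Occurs i b := by
  rw [free_iff]; simp [freeC]
@[simp] theorem free_le : Free i (nd 7 a b) ↔ Occurs i a ∨ Occurs i b := by
  rw [free_iff]; simp [freeC]
@[simp] theorem free_neg : Free i (nd 8 a 0) ↔ Free i a := by rw [free_iff]; simp [freeC]
@[simp] theorem free_and : Free i (nd 9 a b) ↔ Free i a ∨ Free i b := by
  rw [free_iff]; simp [freeC]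
@[simp] theorem free_or : Free i (nd 10 a b) ↔ Free i a ∨ Free i b := by
  rw [free_iff]; simp [freeC]
@[simp] theorem free_all : Free i (nd 11 j a) ↔ j ≠ i ∧ Free i a := by
  rw [free_iff]; simp [freeC]
@[simp] theorem free_ex : Free i (nd 12 j a) ↔ j ≠ i ∧ Free i a := by
  rw [free_iff]; simp [freeC]

@[simp] theorem subst_eq : Subst (nd 6 a b) i t y ↔
    ∃ a' b', TermSubst a i t a' ∧ TermSubst b i t b' ∧ y = nd 6 a' b' := by
  rw [subst_iff]; simp [substC, and_assoc]
@[simp] theorem subst_le : Subst (nd 7 a b) i t y ↔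
    ∃ a' b', TermSubst a i t a' ∧ TermSubst b i t b' ∧ y = nd 7 a' b' := by
  rw [subst_iff]; simp [substC, and_assoc]
@[simp] theorem subst_neg : Subst (nd 8 a 0) i t y ↔
    ∃ a', Subst a i t a' ∧ y = nd 8 a' 0 := by
  rw [subst_iff]; simp [substC]
@[simp] theorem subst_and : Subst (nd 9 a b) i t y ↔
    ∃ a' b', Subst a i t a' ∧ Subst b i t b' ∧ y = nd 9 a' b' := by
  rw [subst_iff]; simp [substC, and_assoc]
@[simp] theorem subst_or : Subst (nd 10 a b) i t y ↔
    ∃ a' b', Subst a i t a' ∧ Subst b i t b' ∧ y = nd 10 a' b' := by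
  rw [subst_iff]; simp [substC, and_assoc]
@[simp] theorem subst_all : Subst (nd 11 j a) i t y ↔
    (j = i ∧ y = nd 11 j a) ∨ (j ≠ i ∧ ∃ a', Subst a i t a' ∧ y = nd 11 j a') := by
  rw [subst_iff]; simp [substC, and_assoc]
@[simp] theorem subst_ex : Subst (nd 12 j a) i t y ↔
    (j = i ∧ y = nd 12 j a) ∨ (j ≠ i ∧ ∃ a', Subst a i t a' ∧ y = nd 12 j a') := by
  rw [subst_iff]; simp [substC, and_assoc]

end Nodes

end SyntacticLemmas

section Codes

variable {M : Type u} [LPA.Structure M] [PA.Model M]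

/-! ### Closed terms -/

/-- Constituents have smaller codes, so strong induction in the model covers terms of nonstandard
size as well. -/
theorem clTerm_induction (P : M → Prop) [Dfn (n := 1) fun _ xs => P (xs 0)]
    (h0 : P (nd 1 0 0)) (h1 : P (nd 2 0 0)) (hs : ∀ a, ClTerm a → P a → P (nd 3 a 0))
    (ha : ∀ a b, ClTerm a → ClTerm b → P a → P b → P (nd 4 a b))
    (hm : ∀ a b, ClTerm a → ClTerm b → P a → P b → P (nd 5 a b)) {t : M} (ht : ClTerm t) :
    P t := by
  revert ht
  refine pa_strong_induction (fun t : M => ClTerm t → P t) (fun t ih ht => ?_) t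
  rw [clTerm_iff] at ht
  rcases ht with rfl | rfl | ⟨a, h, rfl⟩ | ⟨a, b, ⟨h, h'⟩, rfl | rfl⟩
  · exact h0
  · exact h1
  · exact hs a h (ih a (left_lt_nd _ _ _) h)
  · exact ha a b h h' (ih a (left_lt_nd _ _ _) h) (ih b (right_lt_nd _ _ _) h')
  · exact hm a b h h' (ih a (left_lt_nd _ _ _) h) (ih b (right_lt_nd _ _ _) h')

theorem ClTerm.isTerm {t : M} (h : ClTerm t) : IsTerm t :=
  clTerm_induction IsTerm (by simp) (by simp) (by simp) (fun _ _ _ _ h h' => by simp [h, h'])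
    (fun _ _ _ _ h h' => by simp [h, h']) h

theorem ClTerm.not_occurs {t : M} (h : ClTerm t) (i : M) : ¬ Occurs i t :=
  clTerm_induction (fun t : M => ¬ Occurs i t) (by simp) (by simp) (by simp)
    (fun _ _ _ _ h h' => by simp [h, h']) (fun _ _ _ _ h h' => by simp [h, h']) h

theorem ClTerm.termSubst_iff {t : M} (h : ClTerm t) (i u y : M) : TermSubst t i u y ↔ y = t := by
  revert y
  exact clTerm_induction (fun t : M => ∀ y, TermSubst t i u y ↔ y = t) (by simp) (by simp)
    (fun _ _ h => by simp [h]) (fun _ _ _ _ h h' => by simp [h, h'])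
    (fun _ _ _ _ h h' => by simp [h, h']) h

theorem ClTerm.exists_val {t : M} (h : ClTerm t) : ∃ y, Val t y :=
  clTerm_induction (fun t : M => ∃ y, Val t y) (by simp) (by simp)
    (fun _ _ ⟨y, h⟩ => ⟨y + 1, by simp [h]⟩)
    (fun _ _ _ _ ⟨y, h⟩ ⟨y', h'⟩ => ⟨y + y', by simpa using ⟨y, h, y', h', rfl⟩⟩)
    (fun _ _ _ _ ⟨y, h⟩ ⟨y', h'⟩ => ⟨y * y', by simpa using ⟨y, h, y', h', rfl⟩⟩) h

theorem ClTerm.val_unique {t : M} (h : ClTerm t) {y z : M} (hy : Val t y) (hz : Val t z) :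
    y = z := by
  revert y z
  refine fun {y z} => clTerm_induction (fun t : M => ∀ y z, Val t y → Val t z → y = z)
    (by simp) (by simp) ?_ ?_ ?_ h y z
  · simp only [val_suc]
    rintro a _ ih _ _ ⟨y, h, rfl⟩ ⟨z, h', rfl⟩
    rw [ih _ _ h h']
  · simp only [val_add]
    rintro a b _ _ ih ih' _ _ ⟨y, y', h, h', rfl⟩ ⟨z, z', k, k', rfl⟩
    rw [ih _ _ h k, ih' _ _ h' k']
  · simp only [val_mul]
    rintro a b _ _ ih ih' _ _ ⟨y, y', h, h', rfl⟩ ⟨z, z', k, k', rfl⟩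
    rw [ih _ _ h k, ih' _ _ h' k']

/-- Numerals exist in the model for nonstandard `y` too. Quantification over closed terms therefore
amounts to quantification over all elements. -/
theorem exists_clTerm_val (y : M) : ∃ t, ClTerm t ∧ Val t y :=
  pa_induction (fun y : M => ∃ t, ClTerm t ∧ Val t y) ⟨nd 1 0 0, by simp⟩
    (fun _ ⟨t, h, h'⟩ => ⟨nd 3 t 0, by simp [h, h']⟩) y

/-! ### Codes of standard terms and formulas with closed terms in place of variables -/

/-- A finite or infinite assignment of (codes of) terms to variables. -/
abbrev Env (M : Type u) := ℕ → Option M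

/-- All assigned terms are closed. -/
def ClEnv (ρ : Env M) : Prop := ∀ i t, ρ i = some t → ClTerm t

open Classical in
/-- The assignment `ρ`, with `u` assigned to `v_j` unless `ρ` assigns a term to it. -/
noncomputable def Env.fill (ρ : Env M) (j u : M) : Env M :=
  fun k => (ρ k).or (if (k : M) = j then some u else none)

/-- The assignment `ρ` without its value at `i`. -/
def Env.erase (ρ : Env M) (i : ℕ) : Env M := Function.update ρ i none

theorem ClEnv.fill {ρ : Env M} (h : ClEnv ρ) {j u : M} (hu : ClTerm u) : ClEnv (ρ.fill j u) := by
  intro i t hit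
  unfold Env.fill at hit
  cases hi : ρ i with
  | some t' => rw [hi] at hit; simp at hit; exact hit ▸ h i t' hi
  | none => rw [hi] at hit; simp at hit; exact hit.2 ▸ hu

theorem ClEnv.erase {ρ : Env M} (h : ClEnv ρ) (i : ℕ) : ClEnv (ρ.erase i) := by
  intro j t hjt
  by_cases hji : j = i
  · simp [Env.erase, hji] at hjt
  · exact h j t (by simpa [Env.erase, hji] using hjt)

theorem Env.erase_fill_self (ρ : Env M) (i : ℕ) (u : M) :
    (ρ.fill i u).erase i = ρ.erase i := by
  funext k
  by_cases h : k = i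
  · simp [Env.erase, h]
  · simp [Env.erase, Env.fill, h]

theorem Env.erase_fill_of_ne (ρ : Env M) {i : ℕ} {j : M} (h : (i : M) ≠ j) (u : M) :
    (ρ.fill j u).erase i = (ρ.erase i).fill j u := by
  funext k
  by_cases hk : k = i
  · subst hk; simp [Env.erase, Env.fill, h]
  · simp [Env.erase, Env.fill, hk]

/-- The code of a standard term, with the terms assigned by `ρ` in place of variables. -/
noncomputable def tcode : LPA.Term ℕ → Env M → M
  | Term.var i, ρ => (ρ i).getD (nd 0 (i : M) 0)
  | Term.func PAFunc.zero _, _ => nd 1 0 0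
  | Term.func PAFunc.one _, _ => nd 2 0 0
  | Term.func PAFunc.succ ts, ρ => nd 3 (tcode (ts 0) ρ) 0
  | Term.func PAFunc.add ts, ρ => nd 4 (tcode (ts 0) ρ) (tcode (ts 1) ρ)
  | Term.func PAFunc.mul ts, ρ => nd 5 (tcode (ts 0) ρ) (tcode (ts 1) ρ)

theorem term_cases {p : LPA.Term ℕ → Prop} (var : ∀ i, p (Term.var i))
    (zero : ∀ ts, p (Term.func PAFunc.zero ts)) (one : ∀ ts, p (Term.func PAFunc.one ts))
    (succ : ∀ ts, p (ts 0) → p (Term.func PAFunc.succ ts))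
    (add : ∀ ts, p (ts 0) → p (ts 1) → p (Term.func PAFunc.add ts))
    (mul : ∀ ts, p (ts 0) → p (ts 1) → p (Term.func PAFunc.mul ts)) (t : LPA.Term ℕ) : p t := by
  induction t with
  | var i => exact var i
  | func f ts ih =>
    cases f
    exacts [zero ts, one ts, succ ts (ih 0), add ts (ih 0) (ih 1), mul ts (ih 0) (ih 1)]

theorem isTerm_tcode {ρ : Env M} (hρ : ClEnv ρ) (s : LPA.Term ℕ) : IsTerm (tcode s ρ) := by
  induction s using term_cases with
  | var i =>
    cases h : ρ i with
    | none => simp [tcode, h]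
    | some t => simpa [tcode, h] using (hρ i t h).isTerm
  | _ => simp_all [tcode]

theorem occurs_tcode {ρ : Env M} (hρ : ClEnv ρ) (s : LPA.Term ℕ) {i : M}
    (hi : Occurs i (tcode s ρ)) : ∃ j ∈ s.varFinset, i = j ∧ ρ j = none := by
  induction s using term_cases with
  | var j =>
    cases h : ρ j with
    | none => exact ⟨j, by simp [Term.varFinset], by simpa [tcode, h, eq_comm] using hi, h⟩
    | some t => exact ((hρ j t h).not_occurs i (by simpa [tcode, h] using hi)).elim
  | zero => simp [tcode] at hi
  | one => simp [tcode] at hi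
  | succ ts ih =>
    obtain ⟨j, hj, h⟩ := ih (by simpa [tcode] using hi)
    exact ⟨j, by simpa [Term.varFinset] using hj, h⟩
  | add ts ih ih' =>
    rcases (by simpa [tcode] using hi : _ ∨ _) with h | h
    · obtain ⟨j, hj, h⟩ := ih h
      exact ⟨j, by simpa [Term.varFinset, Fin.exists_fin_two] using .inl hj, h⟩
    · obtain ⟨j, hj, h⟩ := ih' h
      exact ⟨j, by simpa [Term.varFinset, Fin.exists_fin_two] using .inr hj, h⟩
  | mul ts ih ih' =>
    rcases (by simpa [tcode] using hi : _ ∨ _) with h | h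
    · obtain ⟨j, hj, h⟩ := ih h
      exact ⟨j, by simpa [Term.varFinset, Fin.exists_fin_two] using .inl hj, h⟩
    · obtain ⟨j, hj, h⟩ := ih' h
      exact ⟨j, by simpa [Term.varFinset, Fin.exists_fin_two] using .inr hj, h⟩

/-- Substitution becomes an operation on assignments. Variables with an assigned term no longer
occur, since that term is closed; this is why `fill` leaves them alone. If `i` is nonstandard,
nothing changes. -/
theorem termSubst_tcode {ρ : Env M} (hρ : ClEnv ρ) (s : LPA.Term ℕ) (i u y : M) :
    TermSubst (tcode s ρ) i u y ↔ y = tcode s (ρ.fill i u) := by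
  induction s using term_cases generalizing y with
  | var j =>
    cases h : ρ j with
    | none => by_cases hji : (j : M) = i <;> simp [tcode, h, Env.fill, hji]
    | some t => simp [tcode, h, Env.fill, (hρ j t h).termSubst_iff]
  | zero => simp [tcode]
  | one => simp [tcode]
  | succ ts ih => simp [tcode, ih]
  | add ts ih ih' => simp [tcode, ih, ih']
  | mul ts ih ih' => simp [tcode, ih, ih']

/-- The terms assigned by `ρ` to the variables in `V` have the values given by `v`. -/
def HasValues (ρ : Env M) (v : ℕ → M) (V : Finset ℕ) : Prop :=
  ∀ i ∈ V, ∃ t, ρ i = some t ∧ Val t (v i)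

theorem HasValues.mono {ρ : Env M} {v : ℕ → M} {V W : Finset ℕ} (h : HasValues ρ v W)
    (hVW : V ⊆ W) : HasValues ρ v V := fun i hi => h i (hVW hi)

theorem tcode_closed {ρ : Env M} {v : ℕ → M} (hρ : ClEnv ρ) (s : LPA.Term ℕ)
    (h : HasValues ρ v s.varFinset) : ClTerm (tcode s ρ) ∧ Val (tcode s ρ) (s.realize v) := by
  induction s using term_cases with
  | var i =>
    obtain ⟨t, ht, hv⟩ := h i (by simp [Term.varFinset])
    simpa [tcode, ht, hv] using hρ i t ht
  | zero ts =>
    have : (Term.func PAFunc.zero ts : LPA.Term ℕ) = zeroT := by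
      unfold zeroT; congr 1; exact Subsingleton.elim _ _
    rw [this, realize_zeroT]; simp [tcode, zeroT]
  | one ts =>
    have : (Term.func PAFunc.one ts : LPA.Term ℕ) = oneT := by
      unfold oneT; congr 1; exact Subsingleton.elim _ _
    rw [this, realize_oneT]; simp [tcode, oneT]
  | succ ts ih =>
    have e : (Term.func PAFunc.succ ts : LPA.Term ℕ) = succT (ts 0) := by
      unfold succT; congr 1; funext i; fin_cases i; rfl
    have := ih (h.mono fun i hi => by simpa [Term.varFinset] using hi)
    rw [e, realize_succT, suc_eq]
    simp [tcode, succT, this]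
  | add ts ih ih' =>
    have e : (Term.func PAFunc.add ts : LPA.Term ℕ) = addT (ts 0) (ts 1) := by
      unfold addT; congr 1; funext i; fin_cases i <;> rfl
    rw [e] at h ⊢
    have h1 := ih (h.mono (by simp))
    have h2 := ih' (h.mono (by simp))
    rw [realize_addT]
    simpa [tcode, addT, h1.1, h2.1] using ⟨_, h1.2, _, h2.2, rfl⟩
  | mul ts ih ih' =>
    have e : (Term.func PAFunc.mul ts : LPA.Term ℕ) = mulT (ts 0) (ts 1) := by
      unfold mulT; congr 1; funext i; fin_cases i <;> rfl
    rw [e] at h ⊢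
    have h1 := ih (h.mono (by simp))
    have h2 := ih' (h.mono (by simp))
    rw [realize_mulT]
    simpa [tcode, mulT, h1.1, h2.1] using ⟨_, h1.2, _, h2.2, rfl⟩

open ArFormula in
/-- The code of a standard formula, with the terms assigned by `ρ` in place of free variables; the
atom `s ≤ t` is coded by `A s t ρ`. -/
noncomputable def fcode (A : LPA.Term ℕ → LPA.Term ℕ → Env M → M) : ArFormula → Env M → M
  | .eq s t, ρ => nd 6 (tcode s ρ) (tcode t ρ)
  | .le s t, ρ => A s t ρ
  | .neg φ, ρ => nd 8 (fcode A φ ρ) 0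
  | .and φ ψ, ρ => nd 9 (fcode A φ ρ) (fcode A ψ ρ)
  | .or φ ψ, ρ => nd 10 (fcode A φ ρ) (fcode A ψ ρ)
  | .all i φ, ρ => nd 11 (i : M) (fcode A φ (ρ.erase i))
  | .ex i φ, ρ => nd 12 (i : M) (fcode A φ (ρ.erase i))

/-- The syntactic properties of a coding of inequalities `s ≤ t` such that `ok s t`. -/
structure AtomLaws (ok : LPA.Term ℕ → LPA.Term ℕ → Prop)
    (A : LPA.Term ℕ → LPA.Term ℕ → Env M → M) : Prop where
  form {s t : LPA.Term ℕ} {ρ : Env M} : ok s t → ClEnv ρ → IsForm (A s t ρ)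
  free {s t : LPA.Term ℕ} {ρ : Env M} {i : M} : ok s t → ClEnv ρ → Free i (A s t ρ) →
    ∃ j ∈ s.varFinset ∪ t.varFinset, i = j ∧ ρ j = none
  subst {s t : LPA.Term ℕ} {ρ : Env M} {i u y : M} : ok s t → ClEnv ρ → ClTerm u →
    (Subst (A s t ρ) i u y ↔ y = A s t (ρ.fill i u))

section

variable {ok : LPA.Term ℕ → LPA.Term ℕ → Prop} {A : LPA.Term ℕ → LPA.Term ℕ → Env M → M}

theorem AtomLaws.isForm (hA : AtomLaws ok A) {F : ArFormula} (hF : F.AllLe ok) {ρ : Env M}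
    (hρ : ClEnv ρ) : IsForm (fcode A F ρ) := by
  induction F generalizing ρ with
  | eq s t => simp [fcode, isTerm_tcode hρ]
  | le s t => exact hA.form hF hρ
  | neg φ ih => simp [fcode, ih hF hρ]
  | and φ ψ ih ih' => simp [fcode, ih hF.1 hρ, ih' hF.2 hρ]
  | or φ ψ ih ih' => simp [fcode, ih hF.1 hρ, ih' hF.2 hρ]
  | all i φ ih => simp [fcode, ih hF (hρ.erase i)]
  | ex i φ ih => simp [fcode, ih hF (hρ.erase i)]

theorem exists_mem_erase_of_env_erase {ρ : Env M} {i : M} {k : ℕ} {V : Finset ℕ} (hk : (k : M) ≠ i)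
    (h : ∃ j ∈ V, i = j ∧ ρ.erase k j = none) : ∃ j ∈ V.erase k, i = j ∧ ρ j = none := by
  obtain ⟨j, hj, rfl, hn⟩ := h
  have hjk : j ≠ k := fun e => hk (e ▸ rfl)
  exact ⟨j, by simp [hj, hjk], rfl, by simpa [Env.erase, hjk] using hn⟩

theorem AtomLaws.free_fcode (hA : AtomLaws ok A) {F : ArFormula} (hF : F.AllLe ok) {ρ : Env M}
    (hρ : ClEnv ρ) {i : M} (h : Free i (fcode A F ρ)) : ∃ j ∈ F.freeVars, i = j ∧ ρ j = none := by
  induction F generalizing ρ with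
  | eq s t =>
    rcases (by simpa [fcode] using h : _ ∨ _) with h | h
    all_goals
      obtain ⟨j, hj, h⟩ := occurs_tcode hρ _ h
      exact ⟨j, by simp [ArFormula.freeVars, hj], h⟩
  | le s t => exact hA.free hF hρ h
  | neg φ ih => exact ih hF hρ (by simpa [fcode] using h)
  | and φ ψ ih ih' =>
    rcases (by simpa [fcode] using h : _ ∨ _) with h | h
    · obtain ⟨j, hj, h⟩ := ih hF.1 hρ h
      exact ⟨j, by simp [ArFormula.freeVars, hj], h⟩
    · obtain ⟨j, hj, h⟩ := ih' hF.2 hρ h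
      exact ⟨j, by simp [ArFormula.freeVars, hj], h⟩
  | or φ ψ ih ih' =>
    rcases (by simpa [fcode] using h : _ ∨ _) with h | h
    · obtain ⟨j, hj, h⟩ := ih hF.1 hρ h
      exact ⟨j, by simp [ArFormula.freeVars, hj], h⟩
    · obtain ⟨j, hj, h⟩ := ih' hF.2 hρ h
      exact ⟨j, by simp [ArFormula.freeVars, hj], h⟩
  | all k φ ih =>
    obtain ⟨hk, h⟩ : _ ∧ _ := by simpa [fcode] using h
    exact exists_mem_erase_of_env_erase hk (ih hF (hρ.erase k) h)
  | ex k φ ih =>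
    obtain ⟨hk, h⟩ : _ ∧ _ := by simpa [fcode] using h
    exact exists_mem_erase_of_env_erase hk (ih hF (hρ.erase k) h)

/-- Below a quantifier the bound variable is erased from the assignment. Substituting for that same
variable has no effect, and substituting for another one commutes with the erasure. -/
theorem AtomLaws.subst_fcode (hA : AtomLaws ok A) {F : ArFormula} (hF : F.AllLe ok) {ρ : Env M}
    (hρ : ClEnv ρ) {i u y : M} (hu : ClTerm u) :
    Subst (fcode A F ρ) i u y ↔ y = fcode A F (ρ.fill i u) := by
  induction F generalizing ρ y with
  | eq s t => simp [fcode, termSubst_tcode hρ]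
  | le s t => exact hA.subst hF hρ hu
  | neg φ ih => simp [fcode, ih hF hρ]
  | and φ ψ ih ih' => simp [fcode, ih hF.1 hρ, ih' hF.2 hρ]
  | or φ ψ ih ih' => simp [fcode, ih hF.1 hρ, ih' hF.2 hρ]
  | all k φ ih =>
    by_cases hk : (k : M) = i
    · subst hk; simp [fcode, Env.erase_fill_self]
    · simp [fcode, ih hF (hρ.erase k), hk, Env.erase_fill_of_ne ρ hk]
  | ex k φ ih =>
    by_cases hk : (k : M) = i
    · subst hk; simp [fcode, Env.erase_fill_self]
    · simp [fcode, ih hF (hρ.erase k), hk, Env.erase_fill_of_ne ρ hk]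

theorem AtomLaws.sent (hA : AtomLaws ok A) {F : ArFormula} (hF : F.AllLe ok) {ρ : Env M}
    (hρ : ClEnv ρ) {v : ℕ → M} (h : HasValues ρ v F.freeVars) : Sent (fcode A F ρ) := by
  refine ⟨hA.isForm hF hρ, fun i hi => ?_⟩
  obtain ⟨j, hj, -, hn⟩ := hA.free_fcode hF hρ hi
  obtain ⟨t, ht, -⟩ := h j hj
  simp [hn] at ht

end

/-- Connects the quantifier axioms, which substitute a closed term for `v_k`, with the quantifier
clauses of `Eval`, which update the assignment at `k`. -/
theorem HasValues.fill_erase {ρ : Env M} {v : ℕ → M} {V : Finset ℕ} {k : ℕ}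
    (h : HasValues ρ v (V.erase k)) {t x : M} (hx : Val t x) :
    HasValues ((ρ.erase k).fill k t) (Function.update v k x) V := by
  intro i hi
  by_cases hik : i = k
  · subst hik
    exact ⟨t, by simp [Env.erase, Env.fill], by simpa using hx⟩
  · obtain ⟨u, hu, hv⟩ := h i (by simp [hi, hik])
    exact ⟨u, by simp [Env.erase, Env.fill, hik, hu], by simpa [hik] using hv⟩

/-! ### Truth predicates -/

/-- The compositional axioms, for a set of codes in a model. -/
structure IsTruth (T : M → Prop) : Prop where
  eq {s t a b : M} : ClTerm s → ClTerm t → Val s a → Val t b → (T (nd 6 s t) ↔ a = b)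
  le {s t a b : M} : ClTerm s → ClTerm t → Val s a → Val t b → (T (nd 7 s t) ↔ a ≤ b)
  and {φ ψ : M} : Sent φ → Sent ψ → (T (nd 9 φ ψ) ↔ T φ ∧ T ψ)
  or {φ ψ : M} : Sent φ → Sent ψ → (T (nd 10 φ ψ) ↔ T φ ∨ T ψ)
  neg {φ : M} : Sent φ → (T (nd 8 φ 0) ↔ ¬ T φ)
  all {i φ : M} : IsForm φ → Sent (nd 11 i φ) →
    (T (nd 11 i φ) ↔ ∀ t y, ClTerm t → Subst φ i t y → T y)
  ex {i φ : M} : IsForm φ → Sent (nd 12 i φ) →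
    (T (nd 12 i φ) ↔ ∃ t y, ClTerm t ∧ Subst φ i t y ∧ T y)

/-- An induction outside the model, on the standard formula `F`, with one compositional axiom for
each step. The formulas in place of the inequalities may have nonstandard size, as `hR` supplies all
that has to be known about their truth. -/
theorem IsTruth.fcode_iff {T : M → Prop} (hT : IsTruth T)
    {ok : LPA.Term ℕ → LPA.Term ℕ → Prop} {A : LPA.Term ℕ → LPA.Term ℕ → Env M → M}
    (hA : AtomLaws ok A) {R : M → M → Prop}
    (hR : ∀ {s t : LPA.Term ℕ} {ρ : Env M} {v : ℕ → M}, ok s t → ClEnv ρ →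
      HasValues ρ v (s.varFinset ∪ t.varFinset) →
      (T (A s t ρ) ↔ R (s.realize v) (t.realize v)))
    {F : ArFormula} (hF : F.AllLe ok) {ρ : Env M} (hρ : ClEnv ρ) {v : ℕ → M}
    (h : HasValues ρ v F.freeVars) : T (fcode A F ρ) ↔ F.Eval R v := by
  induction F generalizing ρ v with
  | eq s t =>
    have hs := tcode_closed hρ s (h.mono (by simp [ArFormula.freeVars]))
    have ht := tcode_closed hρ t (h.mono (by simp [ArFormula.freeVars]))
    exact hT.eq hs.1 ht.1 hs.2 ht.2
  | le s t => exact hR hF hρ h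
  | neg φ ih =>
    rw [fcode, hT.neg (hA.sent (F := φ) hF hρ h), ih hF hρ h, ArFormula.Eval]
  | and φ ψ ih ih' =>
    have h1 := h.mono (V := φ.freeVars) (by simp [ArFormula.freeVars])
    have h2 := h.mono (V := ψ.freeVars) (by simp [ArFormula.freeVars])
    rw [fcode, hT.and (hA.sent hF.1 hρ h1) (hA.sent hF.2 hρ h2), ih hF.1 hρ h1, ih' hF.2 hρ h2,
      ArFormula.Eval]
  | or φ ψ ih ih' =>
    have h1 := h.mono (V := φ.freeVars) (by simp [ArFormula.freeVars])
    have h2 := h.mono (V := ψ.freeVars) (by simp [ArFormula.freeVars])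
    rw [fcode, hT.or (hA.sent hF.1 hρ h1) (hA.sent hF.2 hρ h2), ih hF.1 hρ h1, ih' hF.2 hρ h2,
      ArFormula.Eval]
  | all k φ ih =>
    have hs := hA.sent (F := .all k φ) hF hρ h
    rw [fcode] at hs
    rw [fcode, hT.all (hA.isForm (F := φ) hF (hρ.erase k)) hs, ArFormula.Eval]
    constructor
    · intro H x
      obtain ⟨t, ht, hx⟩ := exists_clTerm_val x
      exact (ih hF ((hρ.erase k).fill ht) (h.fill_erase hx)).1
        (H t _ ht ((hA.subst_fcode (F := φ) hF (hρ.erase k) ht).2 rfl))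
    · intro H t y ht hy
      rw [hA.subst_fcode (F := φ) hF (hρ.erase k) ht] at hy
      obtain ⟨x, hx⟩ := ht.exists_val
      rw [hy, ih hF ((hρ.erase k).fill ht) (h.fill_erase hx)]
      exact H x
  | ex k φ ih =>
    have hs := hA.sent (F := .ex k φ) hF hρ h
    rw [fcode] at hs
    rw [fcode, hT.ex (hA.isForm (F := φ) hF (hρ.erase k)) hs, ArFormula.Eval]
    constructor
    · rintro ⟨t, y, ht, hy, H⟩
      rw [hA.subst_fcode (F := φ) hF (hρ.erase k) ht] at hy
      obtain ⟨x, hx⟩ := ht.exists_val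
      exact ⟨x, (ih hF ((hρ.erase k).fill ht) (h.fill_erase hx)).1 (hy ▸ H)⟩
    · rintro ⟨x, H⟩
      obtain ⟨t, ht, hx⟩ := exists_clTerm_val x
      exact ⟨t, _, ht, (hA.subst_fcode (F := φ) hF (hρ.erase k) ht).2 rfl,
        (ih hF ((hρ.erase k).fill ht) (h.fill_erase hx)).2 H⟩

end Codes

section Operators

variable {M : Type u} [LPA.Structure M] [PA.Model M]

/-! ### Codings of inequalities -/

/-- The coding of `s ≤ t` as an inequality. -/
noncomputable def plainAtom (s t : LPA.Term ℕ) (ρ : Env M) : M := nd 7 (tcode s ρ) (tcode t ρ)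

theorem plainAtom_laws : AtomLaws (M := M) (fun _ _ => True) plainAtom where
  form _ hρ := by simp [plainAtom, isTerm_tcode hρ]
  free {s t ρ i} _ hρ h := by
    rcases (by simpa [plainAtom] using h : _ ∨ _) with h | h
    all_goals
      obtain ⟨j, hj, h⟩ := occurs_tcode hρ _ h
      exact ⟨j, by simp [hj], h⟩
  subst _ hρ _ := by simp [plainAtom, termSubst_tcode hρ]

theorem ArFormula.allLe_true (F : ArFormula) : F.AllLe fun _ _ => True := by
  induction F with
  | eq | le => trivial
  | neg _ ih | all _ _ ih | ex _ _ ih => exact ih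
  | and _ _ ih ih' | or _ _ ih ih' => exact ⟨ih, ih'⟩

theorem IsTruth.plain_iff {T : M → Prop} (hT : IsTruth T) (F : ArFormula) {ρ : Env M}
    (hρ : ClEnv ρ) {v : ℕ → M} (h : HasValues ρ v F.freeVars) :
    T (fcode plainAtom F ρ) ↔ F.Eval (fun a b => a ≤ b) v := by
  refine hT.fcode_iff plainAtom_laws (fun {s t ρ v} _ hρ h => ?_) F.allLe_true hρ h
  have hs := tcode_closed hρ s (h.mono (by simp))
  have ht := tcode_closed hρ t (h.mono (by simp))
  exact hT.le hs.1 ht.1 hs.2 ht.2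

/-- The number `h`, for the term `num h`. -/
def holeIndex : LPA.Term ℕ → ℕ
  | Term.func PAFunc.succ ts => holeIndex (ts 0) + 1
  | _ => 0

@[simp] theorem holeIndex_num (h : ℕ) : holeIndex (num h) = h := by
  induction h with
  | zero => rfl
  | succ h ih => simp [num, succT, holeIndex, ih]

/-- The coding of `num h ≤ t` as `∃ v_0 (v_0 = t ∧ g_h(v_0))`. -/
noncomputable def holeAtom (g : ℕ → M) (s t : LPA.Term ℕ) (ρ : Env M) : M :=
  nd 12 0 (nd 9 (nd 6 (nd 0 0 0) (tcode t ρ)) (g (holeIndex s)))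

/-- `g` is a formula with at most `v_0` free, and substitution of closed terms in it is
well-behaved. -/
def Good (g : M) : Prop :=
  IsForm g ∧ (∀ i, Free i g → i = 0) ∧
    (∀ i u, i ≠ 0 → ClTerm u → ∀ y, Subst g i u y ↔ y = g) ∧
    ∀ u, ClTerm u → ∃ y, Sent y ∧ ∀ y', Subst g 0 u y' ↔ y' = y

/-- `Good` does not mention truth. It can therefore be propagated by induction in the model along
recursions of nonstandard length, which spares a general theory of substitution in nonstandard
formulas. -/
instance Dfn.good {n : ℕ} {f : (ℕ → M → Prop) → (Fin n → M) → M} [DfnT f] :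
    Dfn fun Q xs => Good (f Q xs) :=
  Dfn.comp₁ (P := Good) (by unfold Good; infer_instance)

/-- The set defined by the formula `g` with respect to the truth predicate `T`. -/
def Ext (T : M → Prop) (g x : M) : Prop :=
  ∃ t y, ClTerm t ∧ Val t x ∧ Subst g 0 t y ∧ T y

/-- There is no capture: the only variable free in `g h` is `v_0`, which is bound here, and `t` is a
variable other than `v_0`. So substitution for `v_0` has no effect, and substitution for other
variables acts on `t` alone. -/
theorem holeAtom_laws {g : ℕ → M} (hg : ∀ h, Good (g h)) :
    AtomLaws (fun s t => ∃ h i, s = num h ∧ t = Term.var (i + 1)) (holeAtom g) where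
  form _ hρ := by simp [holeAtom, isTerm_tcode hρ, (hg _).1]
  free {s t ρ i} _ hρ h := by
    obtain ⟨h0, (h | h) | h⟩ : 0 ≠ i ∧ ((0 = i ∨ _) ∨ _) := by simpa [holeAtom] using h
    · exact (h0 h).elim
    · obtain ⟨j, hj, h⟩ := occurs_tcode hρ _ h
      exact ⟨j, by simp [hj], h⟩
    · exact (h0 ((hg _).2.1 i h).symm).elim
  subst {s t ρ i u y} hst hρ hu := by
    obtain ⟨h, k, rfl, rfl⟩ := hst
    by_cases hi : i = 0
    · subst hi
      have : tcode (Term.var (k + 1)) (ρ.fill 0 u) = tcode (Term.var (k + 1)) ρ := by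
        have : ((k + 1 : ℕ) : M) ≠ 0 := Nat.cast_ne_zero.2 (by simp)
        simp only [tcode, Env.fill, if_neg this, Option.or_none]
      simp [holeAtom, this]
    · simp [holeAtom, termSubst_tcode hρ, (hg h).2.2.1 i u hi hu, Ne.symm hi]

theorem ClTerm.sent_eq {s t : M} (hs : ClTerm s) (ht : ClTerm t) : Sent (nd 6 s t) := by
  simp [Sent, hs.isTerm, ht.isTerm, hs.not_occurs, ht.not_occurs]

/-- `Ext` asks for some closed term of the given value, just as the quantifier on `v_0` does. It is
thus not needed that `T` treats terms of equal value alike, which may be doubtful for nonstandard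
formulas. -/
theorem IsTruth.holeAtom_iff {T : M → Prop} (hT : IsTruth T) {g : ℕ → M}
    (hg : ∀ h, Good (g h)) {h i : ℕ} {ρ : Env M} {v : ℕ → M} (hρ : ClEnv ρ)
    (hv : HasValues ρ v {i + 1}) :
    T (holeAtom g (num h) (Term.var (i + 1)) ρ) ↔ Ext T (g h) (v (i + 1)) := by
  have hok : ∃ h' i', (num h : LPA.Term ℕ) = num h' ∧
    (Term.var (i + 1) : LPA.Term ℕ) = Term.var (i' + 1) := ⟨h, i, rfl, rfl⟩
  have hc := tcode_closed (v := v) hρ (Term.var (i + 1)) (hv.mono (by simp [Term.varFinset]))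
  have hform := (holeAtom_laws hg).form hok hρ
  have hsent : Sent (holeAtom g (num h) (Term.var (i + 1)) ρ) := by
    refine ⟨hform, fun k hk => ?_⟩
    obtain ⟨j, hj, -, hn⟩ := (holeAtom_laws hg).free hok hρ hk
    obtain ⟨t, ht, -⟩ := hv j (by simpa [Term.varFinset] using hj)
    simp [hn] at ht
  unfold holeAtom at hform hsent ⊢
  rw [isForm_ex] at hform
  rw [hT.ex hform hsent]
  simp only [holeIndex_num]
  constructor
  · rintro ⟨t, y, ht, hy, hTy⟩
    obtain ⟨y', hs, hy'⟩ := (hg h).2.2.2 t ht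
    simp [hc.1.termSubst_iff, hy'] at hy
    subst hy
    obtain ⟨a, ha⟩ := ht.exists_val
    rw [hT.and (ht.sent_eq hc.1) hs, hT.eq ht hc.1 ha hc.2] at hTy
    obtain ⟨rfl, hTy⟩ := hTy
    exact ⟨t, y', ht, ha, (hy' _).2 rfl, hTy⟩
  · rintro ⟨t, y, ht, ha, hy, hTy⟩
    obtain ⟨y', hs, hy'⟩ := (hg h).2.2.2 t ht
    rw [hy'] at hy
    subst hy
    refine ⟨t, nd 9 (nd 6 t (tcode (Term.var (i + 1)) ρ)) y, ht, ?_, ?_⟩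
    · simp [hc.1.termSubst_iff, hy']
    · rw [hT.and (ht.sent_eq hc.1) hs, hT.eq ht hc.1 ha hc.2]
      exact ⟨rfl, hTy⟩

/-! ### Operations on codes that correspond to definable predicates -/

/-- As `F` is standard, the code arises from the codes in the holes by finitely many applications of
`nd`; the terms assigned by `ρ` enter as parameters. -/
theorem dfnT_fcode (F : ArFormula) (ρ : Env M) {n : ℕ}
    {f : ℕ → (ℕ → M → Prop) → (Fin n → M) → M} (hf : ∀ h, DfnT (f h)) :
    DfnT fun Q xs => fcode (holeAtom fun h => f h Q xs) F ρ := by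
  induction F generalizing ρ with
  | eq s t => simp only [fcode]; infer_instance
  | le s t => simp only [fcode, holeAtom]; infer_instance
  | neg φ ih => have := ih ρ; simp only [fcode]; infer_instance
  | and φ ψ ih ih' => have := ih ρ; have := ih' ρ; simp only [fcode]; infer_instance
  | or φ ψ ih ih' => have := ih ρ; have := ih' ρ; simp only [fcode]; infer_instance
  | all i φ ih => have := ih (ρ.erase i); simp only [fcode]; infer_instance
  | ex i φ ih => have := ih (ρ.erase i); simp only [fcode]; infer_instance

/-- An operation on codes of formulas that expresses the predicate `P`. -/
structure IsOperation (P : (ℕ → M → Prop) → (Fin 1 → M) → Prop) (op : (ℕ → M) → M) : Prop where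
  dfnT {n : ℕ} {f : ℕ → (ℕ → M → Prop) → (Fin n → M) → M} :
    (∀ h, DfnT (f h)) → DfnT fun Q xs => op fun h => f h Q xs
  good {g : ℕ → M} : (∀ h, Good (g h)) → Good (op g)
  ext {T : M → Prop} (_ : IsTruth T) {g : ℕ → M} (_ : ∀ h, Good (g h)) (x : M) :
    Ext T (op g) x ↔ P (fun h => Ext T (g h)) fun _ => x

/-- An assignment of closed terms to all variables but `v_0`, with given values. -/
theorem exists_env (w : ℕ → M) : ∃ ρ : Env M, ClEnv ρ ∧ (∀ j, ρ j = none → j = 0) ∧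
    (∀ i u, i ≠ 0 → ρ.fill i u = ρ) ∧
    ∀ {u x : M}, Val u x → ∀ V, HasValues (ρ.fill 0 u) (Function.update w 0 x) V := by
  choose c hc hcv using fun i => exists_clTerm_val (w i)
  let ρ : Env M := fun i => if i = 0 then none else some (c i)
  refine ⟨ρ, fun i t h => ?_, fun j hj => ?_, fun i u hi => ?_, fun {u x} hx V i _ => ?_⟩
  · by_cases hi : i = 0
    · simp [ρ, hi] at h
    · simp only [ρ, if_neg hi, Option.some.injEq] at h
      exact h ▸ hc i
  · by_contra h
    simp [ρ, h] at hj
  · funext k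
    by_cases hk : k = 0
    · subst hk; simp [Env.fill, ρ, Ne.symm hi]
    · simp [Env.fill, ρ, hk]
  · by_cases hi : i = 0
    · subst hi; exact ⟨u, by simp [Env.fill, ρ], by simpa using hx⟩
    · exact ⟨c i, by simp [Env.fill, ρ, hi], by simpa [hi] using hcv i⟩

/-- The operation plugs the codes `g h` into the holes of an arithmetical formula for `P`, with
closed terms in place of its parameters. It is built from codes alone, so a single operation serves
all truth predicates. -/
theorem exists_isOperation (P : (ℕ → M → Prop) → (Fin 1 → M) → Prop) [hP : Dfn P] :
    ∃ op, IsOperation P op := by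
  obtain ⟨F, w, hF, hev⟩ := hP.exists_arFormula
  obtain ⟨ρ, hρ, hρ0, hfill, hval⟩ := exists_env w
  refine ⟨fun g => fcode (holeAtom g) F ρ, fun hf => dfnT_fcode F ρ hf, fun {g} hg => ?_,
    fun {T} hT {g} hg x => ?_⟩
  · have hA := holeAtom_laws hg
    refine ⟨hA.isForm hF hρ, fun i hi => ?_, fun i u hi hu y => ?_, fun u hu => ?_⟩
    · obtain ⟨j, -, rfl, hj⟩ := hA.free_fcode hF hρ hi
      simp [hρ0 j hj]
    · rw [hA.subst_fcode hF hρ hu, hfill i u hi]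
    · obtain ⟨x, hx⟩ := hu.exists_val
      exact ⟨_, hA.sent hF (hρ.fill hu) (hval hx _), fun y' => hA.subst_fcode hF hρ hu⟩
  · have hA := holeAtom_laws hg
    -- The left-hand side of an inequality tells the number of the hole; different numerals have
    -- different values.
    let R : M → M → Prop := fun a b => ∃ h : ℕ, a = natVal h ∧ Ext T (g h) b
    have hR (h : ℕ) (b : M) : R (natVal h) b ↔ Ext T (g h) b := by
      simp [R, natVal_eq]
    have key {u : M} (hu : ClTerm u) (hx : Val u x) :
        T (fcode (holeAtom g) F (ρ.fill 0 u)) ↔ P (fun h => Ext T (g h)) fun _ => x := by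
      rw [← hev R _ hR x]
      refine hT.fcode_iff hA ?_ hF (hρ.fill hu) (hval hx _)
      rintro _ _ ρ v ⟨h, i, rfl, rfl⟩ hρ hv
      rw [realize_num, hR, Term.realize_var]
      exact hT.holeAtom_iff hg hρ (hv.mono (by simp [Term.varFinset]))
    constructor
    · rintro ⟨u, y, hu, hx, hy, hTy⟩
      rw [hA.subst_fcode hF hρ hu] at hy
      exact (key hu hx).1 (hy ▸ hTy)
    · intro H
      obtain ⟨u, hu, hx⟩ := exists_clTerm_val x
      exact ⟨u, _, hu, hx, (hA.subst_fcode hF hρ hu).2 rfl, (key hu hx).2 H⟩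

/-! ### Definition by recursion in a model -/

/-- The recursive clause for the graph of a function defined by recursion. -/
def recC (a : M → M) (F : M → M → M → M) (p : M) (X : M × M → Prop) (z : M × M) : Prop :=
  (z.1 = 0 ∧ z.2 = a p) ∨ ∃ n y, X (n, y) ∧ z.1 = n + 1 ∧ z.2 = F p n y

theorem finitary_recC (a : M → M) (F : M → M → M → M) (p : M) : Finitary (recC a F p) where
  mono X Y h := by
    rintro z (h1 | ⟨n, y, hX, e⟩)
    exacts [.inl h1, .inr ⟨n, y, h _ hX, e⟩]
  fin X z := by
    rintro (h1 | ⟨n, y, hX, e⟩)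
    exacts [.inl (.inl h1), .inr ⟨_, _, hX, hX, .inr ⟨n, y, .inl rfl, e⟩⟩]

/-- Definable functions can be iterated in the model. -/
theorem exists_rec (a : M → M) (F : M → M → M → M) [ha : DfnT (n := 1) fun _ xs => a (xs 0)]
    [hF : DfnT (n := 3) fun _ xs => F (xs 0) (xs 1) (xs 2)] :
    ∃ G : M → M → M, (∀ p, G p 0 = a p) ∧ (∀ p n, G p (n + 1) = F p n (G p n)) ∧
      ∀ {n : ℕ} {f g : (ℕ → M → Prop) → (Fin n → M) → M} [DfnT f] [DfnT g],
        DfnT fun Q xs => G (f Q xs) (g Q xs) := by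
  have {n : ℕ} {f : (ℕ → M → Prop) → (Fin n → M) → M} [DfnT f] : DfnT fun Q xs => a (f Q xs) :=
    DfnT.comp₁ ⟨ha.out⟩
  have {n : ℕ} {f g h : (ℕ → M → Prop) → (Fin n → M) → M} [DfnT f] [DfnT g] [DfnT h] :
      DfnT fun Q xs => F (f Q xs) (g Q xs) (h Q xs) := DfnT.comp₃ ⟨hF.out⟩
  -- The graph is obtained from an existential statement, which keeps its definition from being
  -- unfolded.
  obtain ⟨Rec, hRec'⟩ : ∃ Rec : M → M → M → Prop,
      ∀ p n y, Rec p n y ↔ Gen prod (recC a F p) (n, y) := ⟨_, fun _ _ _ => Iff.rfl⟩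
  have hRec (p n y : M) : Rec p n y ↔ recC a F p (fun z => Rec p z.1 z.2) (n, y) :=
    by simpa only [hRec'] using (finitary_recC a F p).gen_iff prod_injective (n, y)
  have hdef {n : ℕ} {f g h : (ℕ → M → Prop) → (Fin n → M) → M} [DfnT f] [DfnT g] [DfnT h] :
      Dfn fun Q xs => Rec (f Q xs) (g Q xs) (h Q xs) := by
    refine Dfn.comp₃ (Dfn.of_iff (P := fun _ xs => ∃ w, Mem (pr (xs 1) (xs 2)) w ∧
      ∀ m z, Mem (pr m z) w → (m = 0 ∧ z = a (xs 0)) ∨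
        ∃ m' z', Mem (pr m' z') w ∧ m = m' + 1 ∧ z = F (xs 0) m' z') (by infer_instance)
        fun _ xs => ?_)
    simp [hRec', Gen, prod, recC]
  -- Existence and uniqueness of the value are a single arithmetical statement, proved by induction
  -- in the model.
  have hex (p n : M) : ∃ y, ∀ z, Rec p n z ↔ z = y := by
    refine pa_induction (fun n : M => ∃ y, ∀ z, Rec p n z ↔ z = y) ?_ ?_ n
    · exact ⟨a p, fun z => by rw [hRec]; simp [recC, eq_comm (a := (0 : M))]⟩
    · rintro n ⟨y, hy⟩
      exact ⟨F p n y, fun z => by rw [hRec]; simp [recC, hy]⟩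
  choose G hG using hex
  refine ⟨G, fun p => ?_, fun p n => ?_, fun {n f g} _ _ => ?_⟩
  · exact ((hG p 0 _).1 ((hRec _ _ _).2 (.inl ⟨rfl, rfl⟩))).symm
  · refine ((hG p (n + 1) _).1 ((hRec _ _ _).2 (.inr ⟨n, G p n, ?_, rfl, rfl⟩))).symm
    exact (hG p n _).2 rfl
  · exact DfnT.comp₂ (Dfn.of_iff (P := fun _ xs => Rec (xs 0) (xs 1) (xs 2)) (by infer_instance)
      fun _ xs => by rw [hG]; exact eq_comm)

end Operators

section Levels

variable {M : Type u} [LPA.Structure M] [PA.Model M]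

/-! ### Partial truth predicates -/

/-- One step of Tarski's definition of truth, where `s ≤ t` is read as `R s t` and `X` is used for
the immediate constituents. -/
def tarskiStep (R : M → M → Prop) (X : M → Prop) (x : M) : Prop :=
  (∃ s t a, x = nd 6 s t ∧ Val s a ∧ Val t a) ∨
    (∃ s t a b, x = nd 7 s t ∧ Val s a ∧ Val t b ∧ R a b) ∨
    (∃ φ, x = nd 8 φ 0 ∧ ¬ X φ) ∨
    (∃ φ ψ, x = nd 9 φ ψ ∧ X φ ∧ X ψ) ∨
    (∃ φ ψ, x = nd 10 φ ψ ∧ (X φ ∨ X ψ)) ∨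
    (∃ i φ, x = nd 11 i φ ∧ ∀ t y, ClTerm t → Subst φ i t y → X y) ∨
    ∃ i φ, x = nd 12 i φ ∧ ∃ t y, ClTerm t ∧ Subst φ i t y ∧ X y

/-- One step of the definition of the sets of sentences of bounded depth. -/
def depthStep (X : M → Prop) (x : M) : Prop :=
  (∃ s t, x = nd 6 s t) ∨ (∃ s t, x = nd 7 s t) ∨ (∃ φ, x = nd 8 φ 0 ∧ X φ) ∨
    (∃ φ ψ, x = nd 9 φ ψ ∧ X φ ∧ X ψ) ∨ (∃ φ ψ, x = nd 10 φ ψ ∧ X φ ∧ X ψ) ∨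
    (∃ i φ, x = nd 11 i φ ∧ ∀ t y, ClTerm t → Subst φ i t y → X y) ∨
    ∃ i φ, x = nd 12 i φ ∧ ∀ t y, ClTerm t → Subst φ i t y → X y

/-- Truth of sentences of depth at most `n`. -/
def tarskiLevel (R : M → M → Prop) : ℕ → M → Prop
  | 0 => fun _ => False
  | n + 1 => tarskiStep R (tarskiLevel R n)

/-- The sentences of depth at most `n`. -/
def depthLevel : ℕ → M → Prop
  | 0 => fun _ => False
  | n + 1 => depthStep (depthLevel n)

/-- The depth of a formula; atomic formulas have depth `1`. -/
def ArFormula.depth : ArFormula → ℕ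
  | eq _ _ => 1
  | le _ _ => 1
  | neg φ => φ.depth + 1
  | and φ ψ => max φ.depth ψ.depth + 1
  | or φ ψ => max φ.depth ψ.depth + 1
  | all _ φ => φ.depth + 1
  | ex _ φ => φ.depth + 1

/-- Both sides obey the same clauses, and each connective uses up one level. The relation `R` is
arbitrary: it is the order for ordinary truth, and membership of the right-hand side in G for truth
over (M, G). -/
theorem tarskiLevel_fcode (R : M → M → Prop) (F : ArFormula) {n : ℕ} (hn : F.depth ≤ n)
    {ρ : Env M} (hρ : ClEnv ρ) {v : ℕ → M} (h : HasValues ρ v F.freeVars) :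
    tarskiLevel R n (fcode plainAtom F ρ) ↔ F.Eval R v := by
  have hA := plainAtom_laws (M := M)
  induction F generalizing n ρ v with
  | eq s t =>
    obtain ⟨n, rfl⟩ := Nat.exists_eq_add_of_le' hn
    have hs := tcode_closed hρ s (h.mono (by simp [ArFormula.freeVars]))
    have ht := tcode_closed hρ t (h.mono (by simp [ArFormula.freeVars]))
    simp only [ArFormula.depth, tarskiLevel, fcode, ArFormula.Eval]
    simp only [tarskiStep, nd_inj]
    simp only [true_and, false_and, exists_false, or_false, and_assoc, Nat.reduceEqDiff]
    constructor
    · rintro ⟨_, _, a, rfl, rfl, h1, h2⟩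
      rw [hs.1.val_unique hs.2 h1, ht.1.val_unique ht.2 h2]
    · intro e
      exact ⟨_, _, _, rfl, rfl, hs.2, e ▸ ht.2⟩
  | le s t =>
    obtain ⟨n, rfl⟩ := Nat.exists_eq_add_of_le' hn
    have hs := tcode_closed hρ s (h.mono (by simp [ArFormula.freeVars]))
    have ht := tcode_closed hρ t (h.mono (by simp [ArFormula.freeVars]))
    simp only [ArFormula.depth, tarskiLevel, fcode, ArFormula.Eval, plainAtom]
    simp only [tarskiStep, nd_inj]
    simp only [true_and, false_and, exists_false, or_false, false_or, and_assoc,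
      Nat.reduceEqDiff]
    constructor
    · rintro ⟨_, _, a, b, rfl, rfl, h1, h2, hR⟩
      rwa [hs.1.val_unique hs.2 h1, ht.1.val_unique ht.2 h2]
    · intro e
      exact ⟨_, _, _, _, rfl, rfl, hs.2, ht.2, e⟩
  | neg φ ih =>
    obtain ⟨n, rfl⟩ := Nat.exists_eq_add_of_le' (le_trans (Nat.le_add_left 1 _) hn)
    simp only [ArFormula.depth, add_le_add_iff_right] at hn
    simp [tarskiLevel, fcode, ArFormula.Eval, tarskiStep, ih hn hρ h]
  | and φ ψ ih ih' =>
    obtain ⟨n, rfl⟩ := Nat.exists_eq_add_of_le' (le_trans (Nat.le_add_left 1 _) hn)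
    simp only [ArFormula.depth, add_le_add_iff_right, max_le_iff] at hn
    simp [tarskiLevel, fcode, ArFormula.Eval, tarskiStep,
      ih hn.1 hρ (h.mono (by simp [ArFormula.freeVars])),
      ih' hn.2 hρ (h.mono (by simp [ArFormula.freeVars]))]
  | or φ ψ ih ih' =>
    obtain ⟨n, rfl⟩ := Nat.exists_eq_add_of_le' (le_trans (Nat.le_add_left 1 _) hn)
    simp only [ArFormula.depth, add_le_add_iff_right, max_le_iff] at hn
    simp [tarskiLevel, fcode, ArFormula.Eval, tarskiStep,
      ih hn.1 hρ (h.mono (by simp [ArFormula.freeVars])),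
      ih' hn.2 hρ (h.mono (by simp [ArFormula.freeVars]))]
  | all k φ ih =>
    obtain ⟨n, rfl⟩ := Nat.exists_eq_add_of_le' (le_trans (Nat.le_add_left 1 _) hn)
    simp only [ArFormula.depth, add_le_add_iff_right] at hn
    have hsub {t y : M} (ht : ClTerm t) :=
      hA.subst_fcode (i := (k : M)) (y := y) φ.allLe_true (hρ.erase k) ht
    simp only [tarskiLevel, fcode, ArFormula.Eval, tarskiStep, nd_inj, true_and, false_and,
      exists_false, or_false, false_or, Nat.reduceEqDiff]
    constructor
    · rintro ⟨_, _, ⟨rfl, rfl⟩, H⟩ x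
      obtain ⟨t, ht, hx⟩ := exists_clTerm_val x
      exact (ih hn ((hρ.erase k).fill ht) (h.fill_erase hx)).1 (H t _ ht ((hsub ht).2 rfl))
    · intro H
      refine ⟨_, _, ⟨rfl, rfl⟩, fun t y ht hy => ?_⟩
      obtain ⟨x, hx⟩ := ht.exists_val
      rw [(hsub ht).1 hy]
      exact (ih hn ((hρ.erase k).fill ht) (h.fill_erase hx)).2 (H x)
  | ex k φ ih =>
    obtain ⟨n, rfl⟩ := Nat.exists_eq_add_of_le' (le_trans (Nat.le_add_left 1 _) hn)
    simp only [ArFormula.depth, add_le_add_iff_right] at hn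
    have hsub {t y : M} (ht : ClTerm t) :=
      hA.subst_fcode (i := (k : M)) (y := y) φ.allLe_true (hρ.erase k) ht
    simp only [tarskiLevel, fcode, ArFormula.Eval, tarskiStep, nd_inj, true_and, false_and,
      exists_false, false_or, Nat.reduceEqDiff]
    constructor
    · rintro ⟨_, _, ⟨rfl, rfl⟩, t, y, ht, hy, H⟩
      obtain ⟨x, hx⟩ := ht.exists_val
      rw [(hsub ht).1 hy] at H
      exact ⟨x, (ih hn ((hρ.erase k).fill ht) (h.fill_erase hx)).1 H⟩
    · rintro ⟨x, H⟩
      obtain ⟨t, ht, hx⟩ := exists_clTerm_val x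
      exact ⟨_, _, ⟨rfl, rfl⟩, t, _, ht, (hsub ht).2 rfl,
        (ih hn ((hρ.erase k).fill ht) (h.fill_erase hx)).2 H⟩

theorem depthLevel_fcode (F : ArFormula) {n : ℕ} (hn : F.depth ≤ n) {ρ : Env M} (hρ : ClEnv ρ) :
    depthLevel n (fcode plainAtom F ρ) := by
  have hA := plainAtom_laws (M := M)
  induction F generalizing n ρ with
  | eq s t =>
    obtain ⟨n, rfl⟩ := Nat.exists_eq_add_of_le' hn
    exact .inl ⟨_, _, rfl⟩
  | le s t =>
    obtain ⟨n, rfl⟩ := Nat.exists_eq_add_of_le' hn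
    exact .inr (.inl ⟨_, _, rfl⟩)
  | neg φ ih =>
    obtain ⟨n, rfl⟩ := Nat.exists_eq_add_of_le' (le_trans (Nat.le_add_left 1 _) hn)
    simp only [ArFormula.depth, add_le_add_iff_right] at hn
    exact .inr (.inr (.inl ⟨_, rfl, ih hn hρ⟩))
  | and φ ψ ih ih' =>
    obtain ⟨n, rfl⟩ := Nat.exists_eq_add_of_le' (le_trans (Nat.le_add_left 1 _) hn)
    simp only [ArFormula.depth, add_le_add_iff_right, max_le_iff] at hn
    exact .inr (.inr (.inr (.inl ⟨_, _, rfl, ih hn.1 hρ, ih' hn.2 hρ⟩)))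
  | or φ ψ ih ih' =>
    obtain ⟨n, rfl⟩ := Nat.exists_eq_add_of_le' (le_trans (Nat.le_add_left 1 _) hn)
    simp only [ArFormula.depth, add_le_add_iff_right, max_le_iff] at hn
    exact .inr (.inr (.inr (.inr (.inl ⟨_, _, rfl, ih hn.1 hρ, ih' hn.2 hρ⟩))))
  | all k φ ih =>
    obtain ⟨n, rfl⟩ := Nat.exists_eq_add_of_le' (le_trans (Nat.le_add_left 1 _) hn)
    simp only [ArFormula.depth, add_le_add_iff_right] at hn
    refine .inr (.inr (.inr (.inr (.inr (.inl ⟨_, _, rfl, fun t y ht hy => ?_⟩)))))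
    rw [hA.subst_fcode φ.allLe_true (hρ.erase k) ht] at hy
    exact hy ▸ ih hn ((hρ.erase k).fill ht)
  | ex k φ ih =>
    obtain ⟨n, rfl⟩ := Nat.exists_eq_add_of_le' (le_trans (Nat.le_add_left 1 _) hn)
    simp only [ArFormula.depth, add_le_add_iff_right] at hn
    refine .inr (.inr (.inr (.inr (.inr (.inr ⟨_, _, rfl, fun t y ht hy => ?_⟩)))))
    rw [hA.subst_fcode φ.allLe_true (hρ.erase k) ht] at hy
    exact hy ▸ ih hn ((hρ.erase k).fill ht)

/-- `depthStep` requires of a quantified formula that its instances, rather than its matrix, belong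
to `D`. These are exactly the codes that `tarskiStep` consults, so no lemma about the depth of
instances is called for. -/
theorem tarskiStep_congr (R : M → M → Prop) {D X Y : M → Prop} (h : ∀ x, D x → (X x ↔ Y x)) {x : M}
    (hx : depthStep D x) : tarskiStep R X x ↔ tarskiStep R Y x := by
  rcases hx with ⟨s, t, rfl⟩ | ⟨s, t, rfl⟩ | ⟨φ, rfl, hφ⟩ | ⟨φ, ψ, rfl, hφ, hψ⟩ |
    ⟨φ, ψ, rfl, hφ, hψ⟩ | ⟨i, φ, rfl, hφ⟩ | ⟨i, φ, rfl, hφ⟩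
  · simp [tarskiStep]
  · simp [tarskiStep]
  · simp [tarskiStep, h φ hφ]
  · simp [tarskiStep, h φ hφ, h ψ hψ]
  · simp [tarskiStep, h φ hφ, h ψ hψ]
  · have (t y : M) : (ClTerm t → Subst φ i t y → X y) ↔ (ClTerm t → Subst φ i t y → Y y) :=
      forall_congr' fun ht => forall_congr' fun hy => h y (hφ t y ht hy)
    simp [tarskiStep, and_assoc, this]
  · simp only [tarskiStep, nd_inj, false_and, exists_false, false_or, true_and, Nat.reduceEqDiff]
    refine exists_congr fun j => exists_congr fun ψ => and_congr_right ?_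
    rintro ⟨rfl, rfl⟩
    exact exists_congr fun t => exists_congr fun y => and_congr_right fun ht =>
      and_congr_right fun hy => h y (hφ t y ht hy)

theorem tarskiLevel_agree (R : M → M → Prop) {m n : ℕ} (hmn : m ≤ n) {x : M}
    (hx : depthLevel m x) : tarskiLevel R n x ↔ tarskiLevel R m x := by
  induction m generalizing n x with
  | zero => exact hx.elim
  | succ m ih =>
    obtain ⟨n, rfl⟩ := Nat.exists_eq_add_of_le' (le_trans (Nat.le_add_left 1 _) hmn)
    exact tarskiStep_congr R (fun y hy => ih (Nat.le_of_succ_le_succ hmn) hy) hx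

/-- Induction outside the model: each standard level has its own definition. -/
theorem dfn_tarskiLevel (R : M → M → Prop) [hR : Dfn (n := 2) fun _ xs => R (xs 0) (xs 1)] (n : ℕ) :
    Dfn (n := 1) fun _ xs => tarskiLevel R n (xs 0) := by
  have {n : ℕ} {f g : (ℕ → M → Prop) → (Fin n → M) → M} [DfnT f] [DfnT g] :
    Dfn fun Q xs => R (f Q xs) (g Q xs) := Dfn.comp₂ ‹_›
  induction n with
  | zero => exact Dfn.false
  | succ n ih =>
    have {m : ℕ} {f : (ℕ → M → Prop) → (Fin m → M) → M} [DfnT f] :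
      Dfn fun Q xs => tarskiLevel R n (f Q xs) := Dfn.comp₁ ih
    simp only [tarskiLevel, tarskiStep]
    infer_instance

/-- Induction for the sets defined, by way of the truth predicate `X`, by formulas in the sense of
the model. -/
def InductionFor (X : M → Prop) : Prop :=
  ∀ e, Ext X e 0 → (∀ x, Ext X e x → Ext X e (x + 1)) → ∀ x, Ext X e x

/-- `Ext X e` is definable with `e` as a parameter, so nonstandard codes `e` are covered as well. -/
theorem inductionFor_of_dfn (X : M → Prop) (hX : Dfn (n := 1) fun _ xs => X (xs 0)) :
    InductionFor X := by
  have {n : ℕ} {f : (ℕ → M → Prop) → (Fin n → M) → M} [DfnT f] : Dfn fun Q xs => X (f Q xs) :=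
    Dfn.comp₁ ‹_›
  intro e h0 hs x
  refine @pa_induction M _ _ (fun x => Ext X e x) ?_ h0 hs x
  unfold Ext
  infer_instance

end Levels

section Chain

variable {M : Type u} [LPA.Structure M]

/-! ### The chain of approximations to a model of `UTB` -/

/-- The sequence that starts with the five given entries. -/
def entries {α : Type*} (a b c d e : α) : ℕ → α
  | 0 => a
  | 1 => b
  | 2 => c
  | 3 => d
  | _ => e

theorem forall_entries {α : Type*} {p : α → Prop} {a b c d e : α} (ha : p a) (hb : p b) (hc : p c)
    (hd : p d) (he : p e) : ∀ h, p (entries a b c d e h)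
  | 0 => ha
  | 1 => hb
  | 2 => hc
  | 3 => hd
  | _ + 4 => he

theorem dfnT_entries {n : ℕ} {a b c d e : (ℕ → M → Prop) → (Fin n → M) → M} [ha : DfnT a]
    [hb : DfnT b] [hc : DfnT c] [hd : DfnT d] [he : DfnT e] :
    ∀ h, DfnT fun Q xs => entries (a Q xs) (b Q xs) (c Q xs) (d Q xs) (e Q xs) h
  | 0 => ha
  | 1 => hb
  | 2 => hc
  | 3 => hd
  | _ + 4 => he

variable [PA.Model M]

/-- The truth predicate `J` over `(M, G)` satisfies induction, and `G` agrees with `V` on `D`. -/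
def Fine (J G V D : M → Prop) : Prop :=
  InductionFor J ∧ ∀ x, D x → (G x ↔ V x)

/-- The code of `0 = 1`. -/
noncomputable def bot : M := nd 6 (nd 1 0 0) (nd 2 0 0)

theorem good_bot : Good (bot : M) := by
  have h0 : ClTerm (nd 1 0 0 : M) := by simp
  have h1 : ClTerm (nd 2 0 0 : M) := by simp
  have hs : Sent (bot : M) := h0.sent_eq h1
  have hsub (i u y : M) : Subst bot i u y ↔ y = bot := by
    simp [bot, h0.termSubst_iff, h1.termSubst_iff]
  exact ⟨hs.1, fun i hi => (hs.2 i hi).elim, fun i u _ _ y => hsub i u y,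
    fun u _ => ⟨bot, hs, hsub 0 u⟩⟩

theorem not_ext_bot {T : M → Prop} (hT : IsTruth T) (x : M) : ¬ Ext T bot x := by
  have h0 : ClTerm (nd 1 0 0 : M) := by simp
  have h1 : ClTerm (nd 2 0 0 : M) := by simp
  rintro ⟨t, y, -, -, hy, hTy⟩
  have : y = bot := by simpa [bot, h0.termSubst_iff, h1.termSubst_iff] using hy
  rw [this] at hTy
  exact zero_ne_one ((hT.eq (a := 0) (b := 1) h0 h1 (by simp) (by simp)).1 hTy)

/-- `E k c` is the case distinction that is meant to select `V n` for the first level `n` at which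
`G k` is not fine. All these predicates are `T`-extensions of codes given by recursion in the model.
The equations hold at nonstandard indices too, because each of them is one application of
`IsOperation.ext`, not the outcome of an induction. -/
theorem exists_chain {T : M → Prop} (hT : IsTruth T) (c : M) :
    ∃ (V D G : M → M → Prop) (J E : M → M → M → Prop),
      (∀ x, ¬ V 0 x) ∧ (∀ n, V (n + 1) = tarskiStep (fun a b => a ≤ b) (V n)) ∧
      (∀ x, ¬ D 0 x) ∧ (∀ n, D (n + 1) = depthStep (D n)) ∧
      (∀ k x, ¬ J k 0 x) ∧ (∀ k n, J k (n + 1) = tarskiStep (fun _ b => G k b) (J k n)) ∧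
      (∀ k, G (k + 1) = E k c) ∧
      ∀ k j n, j + 1 + n = c → ∀ x, E k (j + 1) x ↔
        (¬ Fine (J k n) (G k) (V n) (D n) ∧ V n x) ∨
          (Fine (J k n) (G k) (V n) (D n) ∧ E k j x) := by
  obtain ⟨opV, hV⟩ := exists_isOperation (M := M)
    (fun Q xs => tarskiStep (fun a b => a ≤ b) (Q 0) (xs 0))
    (hP := by unfold tarskiStep; infer_instance)
  obtain ⟨opD, hD⟩ := exists_isOperation (M := M) (fun Q xs => depthStep (Q 0) (xs 0))
    (hP := by unfold depthStep; infer_instance)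
  obtain ⟨opJ, hJ⟩ := exists_isOperation (M := M)
    (fun Q xs => tarskiStep (fun _ b => Q 1 b) (Q 0) (xs 0))
    (hP := by unfold tarskiStep; infer_instance)
  -- Fineness is a single statement about the first four holes; the fifth contains the remaining
  -- cases.
  obtain ⟨opE, hE⟩ := exists_isOperation (M := M)
    (fun Q xs => (¬ Fine (Q 0) (Q 1) (Q 2) (Q 3) ∧ Q 2 (xs 0)) ∨
      (Fine (Q 0) (Q 1) (Q 2) (Q 3) ∧ Q 4 (xs 0)))
    (hP := by
      have : Dfn (n := 1) fun Q (_ : Fin 1 → M) => Fine (Q 0) (Q 1) (Q 2) (Q 3) := by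
        unfold Fine InductionFor Ext
        infer_instance
      infer_instance)
  -- The index is the truncated difference `c - (j + 1)`. Stage `j + 1` tests this level, so the
  -- outermost stage `c` tests level `0`.
  have hidx (j : M) : ∃ n, ∀ m, m = n ↔ j + 1 + m = c ∨ (¬ j + 1 ≤ c ∧ m = 0) := by
    by_cases h : j + 1 ≤ c
    · obtain ⟨n, rfl⟩ := exists_add_of_le h
      exact ⟨n, fun m => by simp⟩
    · refine ⟨0, fun m => ⟨fun e => .inr ⟨h, e⟩, ?_⟩⟩
      rintro (e | e)
      · exact (h (e ▸ le_self_add)).elim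
      · exact e.2
  choose idx hidx using hidx
  have {n : ℕ} {f : (ℕ → M → Prop) → (Fin n → M) → M} [DfnT f] : DfnT fun Q xs => idx (f Q xs) :=
    DfnT.comp₁ (F := idx) (Dfn.of_iff
      (P := fun _ xs => xs 0 + 1 + xs 1 = c ∨ (¬ xs 0 + 1 ≤ c ∧ xs 1 = 0)) (by infer_instance)
      fun _ xs => eq_comm.trans (hidx _ _))
  obtain ⟨vr, v0, vs, vd⟩ := exists_rec (M := M) (fun _ => bot) (fun _ _ y => opV fun _ => y)
    (hF := hV.dfnT fun _ => by infer_instance)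
  obtain ⟨dr, d0, ds, dd⟩ := exists_rec (M := M) (fun _ => bot) (fun _ _ y => opD fun _ => y)
    (hF := hD.dfnT fun _ => by infer_instance)
  -- The parameter `γ` is the code of `G k`; it is fixed in the recursions for `J` and `E`, and
  -- advanced by the outer recursion `gr`.
  obtain ⟨jr, j0, js, jd⟩ := exists_rec (M := M) (fun _ => bot)
    (fun γ _ y => opJ (entries y γ γ γ γ)) (hF := hJ.dfnT dfnT_entries)
  obtain ⟨er, e0, es, ed⟩ := exists_rec (M := M) (fun _ => bot)
    (fun γ j y => opE (entries (jr γ (idx j)) γ (vr 0 (idx j)) (dr 0 (idx j)) y))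
    (hF := hE.dfnT dfnT_entries)
  obtain ⟨gr, g0, gs, gd⟩ := exists_rec (M := M) (fun _ => bot) (fun _ _ y => er y c)
  have hv (n : M) : Good (vr 0 n) := by
    refine pa_induction (fun n => Good (vr 0 n)) (v0 0 ▸ good_bot) (fun n ih => ?_) n
    rw [vs]; exact hV.good fun _ => ih
  have hd (n : M) : Good (dr 0 n) := by
    refine pa_induction (fun n => Good (dr 0 n)) (d0 0 ▸ good_bot) (fun n ih => ?_) n
    rw [ds]; exact hD.good fun _ => ih
  have hj {γ : M} (hγ : Good γ) (n : M) : Good (jr γ n) := by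
    refine pa_induction (fun n => Good (jr γ n)) (j0 γ ▸ good_bot) (fun n ih => ?_) n
    rw [js]; exact hJ.good (forall_entries ih hγ hγ hγ hγ)
  have he {γ : M} (hγ : Good γ) (n : M) : Good (er γ n) := by
    refine pa_induction (fun n => Good (er γ n)) (e0 γ ▸ good_bot) (fun n ih => ?_) n
    rw [es]; exact hE.good (forall_entries (hj hγ _) hγ (hv _) (hd _) ih)
  have hg (k : M) : Good (gr 0 k) := by
    refine pa_induction (fun k => Good (gr 0 k)) (g0 0 ▸ good_bot) (fun n ih => ?_) k
    rw [gs]; exact he ih c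
  refine ⟨fun n => Ext T (vr 0 n), fun n => Ext T (dr 0 n), fun k => Ext T (gr 0 k),
    fun k n => Ext T (jr (gr 0 k) n), fun k n => Ext T (er (gr 0 k) n), ?_, fun n => ?_, ?_,
    fun n => ?_, fun k => ?_, fun k n => ?_, fun k => ?_, fun k j n hn x => ?_⟩
  · simp only [v0]; exact not_ext_bot hT
  · funext x
    simp only [vs]; exact propext (hV.ext hT (fun _ => hv n) x)
  · simp only [d0]; exact not_ext_bot hT
  · funext x
    simp only [ds]; exact propext (hD.ext hT (fun _ => hd n) x)
  · simp only [j0]; exact not_ext_bot hT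
  · funext x
    simp only [js]
    exact propext (hJ.ext hT (forall_entries (hj (hg k) n) (hg k) (hg k) (hg k) (hg k)) x)
  · simp only [gs]
  · obtain rfl := (hidx j n).2 (.inl hn)
    simp only [es]
    exact hE.ext hT (forall_entries (hj (hg k) _) (hg k) (hv _) (hd _) (he (hg k) j)) x

/-- In a nonstandard model with a truth predicate there is a set that is fine at all standard
levels. -/
theorem exists_fine {T : M → Prop} (hT : IsTruth T) {c : M} (hc : ∀ n : ℕ, c ≠ n) :
    ∃ G : M → Prop, ∀ n : ℕ, Fine (tarskiLevel (fun _ b => G b) n) G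
      (tarskiLevel (fun a b => a ≤ b) n) (depthLevel n) := by
  obtain ⟨V, D, G, J, E, hV0, hV, hD0, hD, hJ0, hJ, hG, hE⟩ := exists_chain hT c
  have hVn (n : ℕ) : V n = tarskiLevel (fun a b => a ≤ b) n := by
    induction n with
    | zero => funext x; simpa [tarskiLevel] using hV0 x
    | succ n ih => rw [Nat.cast_succ, hV, ih]; rfl
  have hDn (n : ℕ) : D n = depthLevel n := by
    induction n with
    | zero => funext x; simpa [depthLevel] using hD0 x
    | succ n ih => rw [Nat.cast_succ, hD, ih]; rfl
  have hJn (k : M) (n : ℕ) : J k n = tarskiLevel (fun _ b => G k b) n := by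
    induction n with
    | zero => funext x; simpa [tarskiLevel] using hJ0 k x
    | succ n ih => rw [Nat.cast_succ, hJ, ih]; rfl
  have hlt (n : ℕ) : (n : M) < c := by
    induction n with
    | zero => exact pos_iff_ne_zero.2 (by simpa using hc 0)
    | succ n ih => exact lt_of_le_of_ne (by simpa [pa_lt_iff] using ih) (hc (n + 1)).symm
  -- Here `d n` is `c - n`, for standard `n`.
  choose d hd using fun n => exists_add_of_le (hlt n).le
  have hd1 (n : ℕ) : d n = d (n + 1) + 1 := by
    have h1 := hd n
    rw [hd (n + 1), Nat.cast_succ, add_assoc, add_left_cancel_iff, add_comm] at h1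
    exact h1.symm
  by_contra! H
  have H (k : M) := H (G k)
  have hE' (k : M) (n : ℕ) (x : M) : E k (d n) x ↔
      (¬ Fine (tarskiLevel (fun _ b => G k b) n) (G k) (tarskiLevel (fun a b => a ≤ b) n)
          (depthLevel n) ∧ tarskiLevel (fun a b => a ≤ b) n x) ∨
        (Fine (tarskiLevel (fun _ b => G k b) n) (G k) (tarskiLevel (fun a b => a ≤ b) n)
          (depthLevel n) ∧ E k (d (n + 1)) x) := by
    rw [← hVn, ← hDn, ← hJn, hd1]
    exact hE k _ _ (by rw [← hd1, add_comm]; exact (hd n).symm) x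
  classical
  -- By the assumption `H`, the first level at which `G k` is not fine exists and is standard, for
  -- all `k` in the model.
  let r (k : M) : ℕ := Nat.find (H k)
  have hr (k : M) {n : ℕ} (hn : n < r k) := not_not.1 (Nat.find_min (H k) hn)
  have hspec (k : M) : ¬ Fine (tarskiLevel (fun _ b => G k b) (r k)) (G k)
      (tarskiLevel (fun a b => a ≤ b) (r k)) (depthLevel (r k)) := Nat.find_spec (H k)
  have hGr (k : M) : G (k + 1) = tarskiLevel (fun a b => a ≤ b) (r k) := by
    -- The case distinction is unwound from level `r k`, where its first alternative holds, back to
    -- level `0`: a standard number of steps.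
    have key (n : ℕ) (hn : n ≤ r k) : E k (d n) = tarskiLevel (fun a b => a ≤ b) (r k) := by
      induction hn using Nat.decreasingInduction with
      | self => funext x; rw [hE']; simp [hspec k]
      | of_succ n hn ih => funext x; rw [hE']; simp [hr k hn, ih]
    have h0 : d 0 = c := by simpa using (hd 0).symm
    rw [hG, ← key 0 (Nat.zero_le _), h0]
  -- `G (k + 1)` is a standard level of arithmetical truth. Partial truth over it is definable and
  -- so satisfies induction, and it agrees with all lower levels; hence it is fine up to `r k`.
  have hlt (k : M) : r k < r (k + 1) := by
    rw [Nat.lt_find_iff]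
    intro m hm
    rw [not_not, hGr k]
    have hdef := dfn_tarskiLevel (M := M) (fun a b => a ≤ b) (r k)
    refine ⟨inductionFor_of_dfn _ (dfn_tarskiLevel _ (hR := ?_) m), fun x hx =>
      tarskiLevel_agree _ hm hx⟩
    exact Dfn.comp₁ hdef
  -- Along `c, c - 1, c - 2, …` the levels `r` decrease strictly; for large `n` this contradicts the
  -- bound `r (d 0)`.
  have hle (n : ℕ) : n + r (d n) ≤ r (d 0) := by
    induction n with
    | zero => simp
    | succ n ih =>
      have := hlt (d (n + 1))
      rw [← hd1] at this
      omega
  have := hle (r (d 0) + 1)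
  omega

end Chain

section Expansions

variable {M : Type u} [LPA.Structure M]

/-! ### From the theories to their models -/

theorem realize_trF (T : Set M) {α : Type*} {n : ℕ} (t : LPAT.Term (α ⊕ Fin n)) (v : α → M)
    (xs : Fin n → M) :
    letI := truthStructure T
    (trF t).Realize v xs ↔ t.realize (Sum.elim v xs) ∈ T := by
  simp only [trF, BoundedFormula.Realize]
  exact Iff.rfl

theorem realize_plugT [LT.Structure M] {α : Type*} {k n : ℕ} (φ : LPA.Formula (Fin k))
    (ts : Fin k → LPAT.Term (α ⊕ Fin n)) (v : α → M) (xs : Fin n → M) :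
    (plugT φ ts).Realize v xs ↔ φ.Realize fun i => (ts i).realize (Sum.elim v xs) := by
  rw [plugT, realize_plug, LHom.realize_onFormula]

variable [PA.Model M]

theorem isTruth_of_compositionalAxioms {T : Set M} (h : ExpansionModels M T compositionalAxioms) :
    IsTruth fun x => x ∈ T := by
  let := truthStructure T
  have h' : ∀ σ ∈ compositionalAxioms, M ⊨ σ := h.realize_of_mem
  have hle (v : Fin 2 → M) : Formula.Realize (leF (fv 0) (fv 1) : LPA.Formula (Fin 2)) v ↔
      v 0 ≤ v 1 := by
    simp [Formula.Realize]
  simp only [compositionalAxioms, Set.mem_insert_iff, Set.mem_singleton_iff, forall_eq_or_imp,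
    forall_eq, Sentence.Realize, Formula.Realize] at h'
  simp [realize_trF, realize_plugT, hle, Fin.snoc] at h'
  obtain ⟨h1, h2, h3, h4, h5, h6, h7⟩ := h'
  exact ⟨fun hs ht ha hb => h1 _ _ _ _ _ hs ht ha hb rfl,
    fun hs ht ha hb => h2 _ _ _ _ _ hs ht ha hb rfl, fun h h' => h3 _ _ _ h h' rfl,
    fun h h' => h4 _ _ _ h h' rfl, h5 _, h6 _ _, fun h h' => by simp [h7 _ _ h h', and_assoc]⟩

/-! ### Codes of standard syntax and the biconditionals -/

theorem cast_pair (a b : ℕ) : ((Nat.pair a b : ℕ) : M) = pr (a : M) (b : M) := by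
  unfold Nat.pair pr
  simp only [Nat.cast_lt]
  split_ifs <;> push_cast <;> rfl

theorem cast_node (k a b : ℕ) : ((node k a b : ℕ) : M) = nd k (a : M) (b : M) := by
  simp [node, nd, cast_pair]

theorem cast_termCode (t : LPA.Term ℕ) : (termCode t : M) = tcode t fun _ => none := by
  induction t using term_cases with
  | var i => simp [termCode, tcode, cast_node]
  | zero ts | one ts => simp [termCode, tcode, cast_node]
  | succ ts ih => simp [termCode, tcode, cast_node, ih]
  | add ts ih ih' | mul ts ih ih' => simp [termCode, tcode, cast_node, ih, ih']

theorem cast_code (F : ArFormula) : (F.code : M) = fcode plainAtom F fun _ => none := by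
  have (i : ℕ) : Env.erase (fun _ => none : Env M) i = fun _ => none := by
    simp [Env.erase]
  induction F with
  | eq s t => simp [ArFormula.code, fcode, cast_node, cast_termCode]
  | le s t => simp [ArFormula.code, fcode, plainAtom, cast_node, cast_termCode]
  | neg φ ih => simp [ArFormula.code, fcode, cast_node, ih]
  | and φ ψ ih ih' | or φ ψ ih ih' => simp [ArFormula.code, fcode, cast_node, ih, ih']
  | all i φ ih | ex i φ ih => simp [ArFormula.code, fcode, cast_node, ih, this]

theorem realize_biconditional {T : Set M}
    (hT : ∀ (F : ArFormula) {ρ : Env M}, ClEnv ρ → ∀ {v : ℕ → M}, HasValues ρ v F.freeVars →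
      (fcode plainAtom F ρ ∈ T ↔ F.Eval (fun a b => a ≤ b) v))
    {φ : ArFormula} {n : ℕ} (hφ : φ.freeVars ⊆ Finset.range n) :
    letI := truthStructure T
    M ⊨ biconditional φ n := by
  let := truthStructure T
  unfold biconditional
  simp only [Sentence.Realize, Formula.realize_iAlls]
  intro z
  rw [Formula.Realize]
  simp only [BoundedFormula.realize_imp, BoundedFormula.realize_inf,
    BoundedFormula.realize_bdEqual, BoundedFormula.realize_iInf, realize_plugT,
    BoundedFormula.realize_iff, realize_trF, BoundedFormula.realize_subst]
  simp only [Term.realize_var, LHom.realize_onTerm, realize_num, natVal_eq, realize_clTermF,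
    realize_valF, realize_substF, Sum.elim_inl, Sum.elim_inr, Matrix.cons_val]
  rintro ⟨h0, h⟩
  refine Iff.trans ?_ ((LHom.realize_onFormula incl φ.toFormula).trans
    (φ.realize_toFormula _)).symm
  -- The first `i` substitutions have been carried out, so `c_i` is the code of `φ` with the
  -- assignment `ρ i`.
  let ρ (i : ℕ) : Env M := fun j =>
    if h : j < i ∧ j < n then some (z (.t ⟨j, h.2⟩)) else none
  have hρ (i : ℕ) : ClEnv (ρ i) := by
    intro j t hj
    by_cases hji : j < i ∧ j < n
    · simp only [ρ, dif_pos hji, Option.some.injEq] at hj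
      exact hj ▸ (h _).1.1
    · simp [ρ, hji] at hj
  have hc (i : ℕ) (hi : i < n + 1) : z (.c ⟨i, hi⟩) = fcode plainAtom φ (ρ i) := by
    induction i with
    | zero =>
      rw [show ρ 0 = fun _ => none by simp [ρ], ← cast_code]
      exact h0
    | succ i ih =>
      have hin := Nat.lt_of_succ_lt_succ hi
      have hs := (h ⟨i, hin⟩).2
      rw [show (Fin.castSucc ⟨i, hin⟩) = ⟨i, Nat.lt_of_succ_lt hi⟩ from rfl, ih,
        plainAtom_laws.subst_fcode φ.allLe_true (hρ i) (h _).1.1] at hs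
      refine hs.trans (congrArg _ ?_)
      funext j
      rcases lt_trichotomy j i with hj | rfl | hj
      · simp [Env.fill, ρ, hj, hj.trans hin, Nat.lt_succ_of_lt hj]
      · simp [Env.fill, ρ, hin]
      · simp [Env.fill, ρ, hj.not_gt, hj.ne', Nat.not_lt.2 (Nat.succ_le_of_lt hj)]
  rw [show Fin.last n = ⟨n, n.lt_succ_self⟩ from rfl, hc]
  refine hT φ (hρ n) fun j hj => ?_
  have hjn := Finset.mem_range.1 (hφ hj)
  exact ⟨z (.t ⟨j, hjn⟩), by simp [ρ, hjn], by simpa [hjn] using (h ⟨j, hjn⟩).1.2⟩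

/-- The semantic form of `UTB`: `hT` contains the biconditionals, and `hI` induction for all
definable predicates, with every hole read as `T`. -/
theorem expansionModels_UTB {T : Set M}
    (hT : ∀ (F : ArFormula) {ρ : Env M}, ClEnv ρ → ∀ {v : ℕ → M}, HasValues ρ v F.freeVars →
      (fcode plainAtom F ρ ∈ T ↔ F.Eval (fun a b => a ≤ b) v))
    (hI : ∀ P : (ℕ → M → Prop) → (Fin 1 → M) → Prop, Dfn P →
      P (fun _ x => x ∈ T) (fun _ => 0) →
      (∀ x, P (fun _ x => x ∈ T) (fun _ => x) → P (fun _ x => x ∈ T) (fun _ => x + 1)) →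
      ∀ x, P (fun _ x => x ∈ T) (fun _ => x)) :
    ExpansionModels M T UTB := by
  let := truthStructure T
  refine ⟨fun σ hσ => ?_⟩
  rcases hσ with (hσ | ⟨φ, n, hφ, rfl⟩) | ⟨n, φ, rfl⟩
  · exact ((LHom.onTheory_model incl PA).2 ‹_›).realize_of_mem σ hσ
  · exact realize_biconditional hT hφ
  · rw [realize_inductionAxiom]
    intro p h0 hs
    have hd : Dfn (n := 1) fun (Q : ℕ → M → Prop) xs =>
        letI := truthStructure {x | Q 0 x}
        φ.Realize (Matrix.vecCons (xs 0) p) := by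
      refine Dfn.of_iff (dfn_realize φ (fun i _ xs => Sum.elim (Matrix.vecCons (xs 0) p) default i)
        ?_) fun Q xs => ?_
      · rintro (i | i)
        · refine Fin.cases ?_ (fun i => ?_) i
          · exact DfnT.var 0
          · exact DfnT.const (p i)
        · exact i.elim0
      · unfold Formula.Realize
        exact iff_of_eq (congrArg _ (Subsingleton.elim _ _))
    exact hI _ hd h0 (by simpa only [suc_eq] using hs)

/-- The expansion by a truth predicate of a model all of whose elements are standard. -/
theorem IsTruth.models_UTB_of_standard {T : Set M} (hT : IsTruth fun x => x ∈ T)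
    (h : ∀ c : M, ∃ n : ℕ, c = n) : ExpansionModels M T UTB := by
  refine expansionModels_UTB (fun F _ hρ _ hv => hT.plain_iff F hρ hv) fun P _ h0 hs x => ?_
  obtain ⟨n, rfl⟩ := h x
  induction n with
  | zero => simpa using h0
  | succ n ih => simpa using hs _ ih

/-- The expansion by a set that is fine at all standard levels. -/
theorem models_UTB_of_fine {G : M → Prop}
    (hG : ∀ n : ℕ, Fine (tarskiLevel (fun _ b => G b) n) G (tarskiLevel (fun a b => a ≤ b) n)
      (depthLevel n)) : ExpansionModels M {x | G x} UTB := by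
  refine expansionModels_UTB (fun F ρ hρ v hv => ?_) fun P hP h0 hs x => ?_
  · exact ((hG F.depth).2 _ (depthLevel_fcode F le_rfl hρ)).trans
      (tarskiLevel_fcode _ F le_rfl hρ hv)
  · obtain ⟨F, w, -, hF⟩ := hP.exists_arFormula
    -- A formula with the predicate `T` is represented by an arithmetical code: its inequalities are
    -- coded as such but read as membership of the right-hand side in `G`. Fineness at the depth of
    -- `F` then provides induction.
    have hF := hF (fun _ b => G b) (fun _ b => G b) fun _ _ => Iff.rfl
    obtain ⟨ρ, hρ, -, -, hval⟩ := exists_env w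
    have hext (x : M) : Ext (tarskiLevel (fun _ b => G b) F.depth) (fcode plainAtom F ρ) x ↔
        P (fun _ b => G b) fun _ => x := by
      rw [← hF x]
      have key {u : M} (hu : ClTerm u) (hx : Val u x) :=
        tarskiLevel_fcode (fun _ b => G b) F le_rfl (hρ.fill (j := 0) hu) (hval hx _)
      have hsub {u y : M} (hu : ClTerm u) :=
        plainAtom_laws.subst_fcode (i := 0) (y := y) F.allLe_true hρ hu
      constructor
      · rintro ⟨u, y, hu, hx, hy, H⟩
        exact (key hu hx).1 ((hsub hu).1 hy ▸ H)
      · intro H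
        obtain ⟨u, hu, hx⟩ := exists_clTerm_val x
        exact ⟨u, _, hu, hx, (hsub hu).2 rfl, (key hu hx).2 H⟩
    exact (hext x).1 ((hG F.depth).1 _ ((hext 0).2 h0)
      (fun y hy => (hext _).2 (hs y ((hext y).1 hy))) x)

end Expansions

end TruthTheories

theorem mainTheorem1 (M : Type*) [TruthTheories.LPA.Structure M]
    (hPA : TruthTheories.PA.Model M)
    (hCT : TruthTheories.ExpandsTo M TruthTheories.CTminus) :
    TruthTheories.ExpandsTo M TruthTheories.UTB := by
  open TruthTheories in
  obtain ⟨T, hT⟩ := hCT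
  let := truthStructure T
  have hT : IsTruth fun x => x ∈ T :=
    isTruth_of_compositionalAxioms (Theory.Model.mono hT Set.subset_union_right)
  by_cases h : ∀ c : M, ∃ n : ℕ, c = n
  · exact ⟨T, hT.models_UTB_of_standard h⟩
  · push Not at h
    obtain ⟨c, hc⟩ := h
    obtain ⟨G, hG⟩ := exists_fine hT hc
    exact ⟨_, models_UTB_of_fine hG⟩
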